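/- Let $k>0$, $\theta\in(-\pi/2,\pi/2)$, $z\in\mathbb R$. Let $u(x,\zeta)$ be a field amplitude in the region $x>-\zeta\tan\theta$, $\zeta\le z$, produced by data $u_0(\zeta)$, $\zeta<z$, on the inclined line $x+\zeta\tan\theta=0$. This means: * $u$ is continuous on $\{x>-\zeta\tan\theta,\ \zeta\le z\}$ and is a (weak) solution of $2ik\,u_\zeta+u_{xx}=0$ in $\{x>-\zeta\tan\theta,\ \zeta<z\}$; * for every $a<z$ there are $N,C$ with $\int_{-\zeta\tan\theta}^\infty |u(x,\zeta)|\,(1+x+\zeta\tan\theta)^{-N}dx\le C$ for all $\zeta\in[a,z]$; * $u=u_0$ on the line: for every $a<z$, $\int_a^z|u(y-\zeta\tan\theta,\zeta)-u_0(\zeta)|\,d\zeta\to0$ as $y\to0^+$; * $u_0(\zeta)\,(z-\zeta)^{-1/2}(1+z-\zeta)^{-1}$ is integrable on $(-\infty,z)$; * (radiation condition: no field comes in from $\zeta=-\infty$) for every wave packet $w(x,\zeta)=\int_{\mathbb R} a(q)\,e^{i(qx-q^2\zeta/2k)}dq$ with Schwartz spectrum $a$ that vanishes identically on the line $x+\zeta\tan\theta=0$,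 one has $\int_{-\zeta\tan\theta}^\infty u(x,\zeta)\overline{w(x,\zeta)}\,dx\to0$ as $\zeta\to-\infty$. (This holds in particular if $\int_{-\zeta\tan\theta}^\infty|u(x,\zeta)|^2dx\to0$ as $\zeta\to-\infty$.) Let $z''<z$ be a point at which $u_0$ satisfies Dini's condition, i.e. $(u_0(\zeta)-u_0(z''))/(\zeta-z'')$ is integrable near $\zeta=z''$ (for instance, $u_0$ is Hölder continuous at $z''$). Then the principal value and the improper integral $\int^\infty=\lim_{R\to\infty}\int^R$ below exist, and, with the principal branch of the square root, $$u_0(z'')-\frac i\pi\sqrt{z-z''}\;\mathrm{P}\!\!\int_{-\infty}^z\frac{u_0(\zeta)}{z''-\zeta}\,e^{\frac{ik}{2}\tan^2\theta\,(z''-\zeta)}\frac{d\zeta}{\sqrt{z-\zeta}}=\sqrt{\frac{2ki}{\pi(z-z'')}}\int_{-z\tan\theta}^\infty u(x',z)\,e^{-\frac{ik(x'+z''\tan\theta)^2}{2(z-z'')}}dx'.$$ In particular, for $\theta=0$, $$u_0(z'')-\frac i\pi\sqrt{z-z''}\;\mathrm{P}\!\!\int_{-\infty}^z\frac{u_0(\zeta)}{z''-\zeta}\frac{d\zeta}{\sqrt{z-\zeta}}=\sqrt{\frac{2ki}{\pi(z-z'')}}\int_0^\infty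 u(x',z)\,e^{-\frac{ikx'^2}{2(z-z'')}}dx',$$ and for $\theta=0$, $z=0$, with $v(t)=u_0(-t)/\sqrt t$, at every $t>0$ such that $u_0$ satisfies Dini's condition at $-t$, $$v(t)+\frac1{\pi i}\,\mathrm{P}\!\!\int_0^\infty\frac{v(\mu)}{\mu-t}\,d\mu=H(t):=\sqrt{\frac{2ki}{\pi}}\,\frac1t\int_0^\infty u(x',0)\,e^{-\frac{ikx'^2}{2t}}dx'.$$ -/

import Mathlib

open Filter Topology MeasureTheory Set
open scoped ContDiff ComplexConjugate

noncomputable section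

/-- `P` is the Cauchy principal value of `∫_S f` at the point `c`: `f` is integrable on `S`
outside every neighbourhood of `c`, and the integrals over `S` minus a symmetric neighbourhood of
radius `ε` tend to `P` as `ε → 0+`. -/
def HasPrincipalValue (f : ℝ → ℂ) (c : ℝ) (S : Set ℝ) (P : ℂ) : Prop :=
  (∀ ε : ℝ, 0 < ε → IntegrableOn f (S \ Metric.ball c ε)) ∧
    Tendsto (fun ε : ℝ => ∫ ζ in S \ Metric.ball c ε, f ζ) (𝓝[>] 0) (𝓝 P)

/-- `J` is the (possibly only conditionally convergent) improper integral `∫_a^∞ f`, that is, the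
limit of `∫_a^R f` as `R → ∞`. -/
def HasImproperIntegral (f : ℝ → ℂ) (a : ℝ) (J : ℂ) : Prop :=
  (∀ R : ℝ, a < R → IntegrableOn f (Ioc a R)) ∧
    Tendsto (fun R : ℝ => ∫ x in a..R, f x) atTop (𝓝 J)

/-- `u` is a weak (distributional) solution of `2ik u_z + u_xx = 0` on the open set `D` of the
`(x, z)`-plane. Points of the plane are pairs `(x, z)`. -/
def IsWeakParabolicSolution (k : ℝ) (u : ℝ × ℝ → ℂ) (D : Set (ℝ × ℝ)) : Prop :=
  ∀ φ : ℝ × ℝ → ℂ, ContDiff ℝ ∞ φ → HasCompactSupport φ → tsupport φ ⊆ D →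
    ∫ p : ℝ × ℝ, u p * (-(2 * Complex.I * k) * deriv (fun ζ : ℝ => φ (p.1, ζ)) p.2
      + iteratedDeriv 2 (fun x : ℝ => φ (x, p.2)) p.1) = 0

/-- The wave packet `w(x, z) = ∫ a(q) exp (i (q x - q² z / (2k))) dq` with spectrum `a`, a
superposition of the plane wave solutions of `2ik w_z + w_xx = 0`. -/
def wavePacket (k : ℝ) (a : SchwartzMap ℝ ℂ) (p : ℝ × ℝ) : ℂ :=
  ∫ q : ℝ, a q * Complex.exp (Complex.I * (q * p.1 - q ^ 2 * p.2 / (2 * k)))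

/-- `u` is a field amplitude, at longitudinal coordinates up to `z`, in the region
`x > -ζ tan θ`, which solves the parabolic equation there, has the boundary values `u₀` on the
inclined line `x + ζ tan θ = 0`, and is produced by that line. -/
structure IsFieldOfInclinedLine (k θ z : ℝ) (u : ℝ × ℝ → ℂ) (u₀ : ℝ → ℂ) : Prop where
  /-- The amplitude is continuous off the line. -/
  continuousOn : ContinuousOn u {p : ℝ × ℝ | 0 < p.1 + p.2 * Real.tan θ ∧ p.2 ≤ z}
  /-- The parabolic equation. -/
  equation : IsWeakParabolicSolution k u {p : ℝ × ℝ | 0 < p.1 + p.2 * Real.tan θ ∧ p.2 < z}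
  /-- At most polynomial growth in `x`, in the mean, locally uniformly in `ζ`. -/
  growth : ∀ a : ℝ, a < z → ∃ (N : ℕ) (C : NNReal), ∀ ζ ∈ Icc a z,
    ∫⁻ x in Ioi (-ζ * Real.tan θ),
      ENNReal.ofReal (‖u (x, ζ)‖ / (1 + (x + ζ * Real.tan θ)) ^ N) ≤ C
  /-- `u = u₀` on the line, as a trace in `L¹_loc`; this holds in particular if `u` extends
  continuously to the line by `u₀`. -/
  trace : ∀ a : ℝ, a < z → Tendsto
    (fun y : ℝ => ∫⁻ ζ in Ioo a z, ‖u (y - ζ * Real.tan θ, ζ) - u₀ ζ‖ₑ) (𝓝[>] 0) (𝓝 0)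
  /-- The data have a Cauchy integral with weight `(z - ζ)^(-1/2)` which converges absolutely away
  from its singularity. -/
  data_integrable :
    IntegrableOn (fun ζ : ℝ => u₀ ζ / ((Real.sqrt (z - ζ) * (1 + (z - ζ)) : ℝ) : ℂ)) (Iio z)
  /-- Radiation condition (no field comes in from `ζ = -∞`): the overlap of `u` with every wave
  packet that vanishes on the line tends to zero as `ζ → -∞`. By Cauchy's inequality, it holds in
  particular if the energy `∫ |u(x, ζ)|² dx` tends to zero as `ζ → -∞`. -/
  radiation : ∀ a : SchwartzMap ℝ ℂ,
    (∀ ζ : ℝ, wavePacket k a (-ζ * Real.tan θ, ζ) = 0) →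
    Tendsto (fun ζ : ℝ => ∫ x in Ioi (-ζ * Real.tan θ), u (x, ζ) * conj (wavePacket k a (x, ζ)))
      atBot (𝓝 0)

/-- Dini's condition on `f` at `c`: the difference quotient is integrable near `c`. It holds, for
instance, if `f` is measurable near `c` and Hölder continuous at `c`. -/
def DiniAt (f : ℝ → ℂ) (c : ℝ) : Prop :=
  IntegrableAtFilter (fun ζ : ℝ => (f ζ - f c) / ((ζ - c : ℝ) : ℂ)) (𝓝 c)

end

/-! A Galilean change of variables `y = x + ζ tan θ`, accompanied by a unimodular phase, preserves
the parabolic equation and turns the inclined line into `y = 0`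
(`IsFieldOfInclinedLine.isHalfPlaneField`). It remains to treat a field `V` in the half-plane `x >
0` with boundary values `v₀`; write `c = z''`, `D = z - c`, `s = z - ζ`.

Pair `V` with `W = conj w`, where `w` is a wave packet with odd spectrum. `W` solves the adjoint
equation and vanishes at `x = 0`, so Green's identity gives `2ik F' = -v₀ W_x(0, ζ)` for the overlap
`F(ζ) = ∫ V W dx`. Integrating from `ζ = -∞`, where the radiation condition makes `F` vanish, gives
`-2ik F(z) = ∫ v₀ W_x(0, ζ) dζ` (`IsHalfPlaneField.overlap_eq`).

At `ζ = z` the packet may be any odd test function, and the Fresnel kernel then gives `W_x(0, ζ)`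
(`exists_wavePacket_eq`). Letting the test functions tend to the odd extension of `exp (-ikx²/2D)`
cut off at `x = R` expresses the truncated integral of the right-hand side, up to constants, as the
integral of `v₀ / ((c - ζ) √s)` against `1 - exp (iμ(D/s - 1))`, with `μ = kR²/2D`
(`IsHalfPlaneField.overlap_truncated`). The last factor vanishes at `ζ = c`, where the Cauchy kernel
is singular.

For `R → ∞` subtract `v₀ c` times the model singularity `√D / (s (c - ζ))` near `c`; by Dini's
condition the remainder is integrable. In the variable `ρ = D/s - 1` the phase is `exp (iμρ)`, so
the oscillating part of the remainder vanishes by the Riemann–Lebesgue lemma. The model becomes `-dρ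
/ (√D ρ)` on a symmetric interval: its principal value is zero, while its integral against `1 - exp
(iμρ)` tends to `iπ/√D` by the Dirichlet integral. The limit is therefore `P + iπ v₀(c)/√D`
(`tendsto_integral_cauchyIntegrand_mul`). This proves that the improper integral converges and gives
its value. -/

noncomputable section

/-! ### Wave packets: derivatives, smoothness and decay in `x`. -/

section WavePacket

variable {k : ℝ}

/-- Multiplication of a spectrum by the frequency. -/
def freqMul (a : SchwartzMap ℝ ℂ) : SchwartzMap ℝ ℂ :=
  SchwartzMap.smulLeftCLM ℂ (fun q : ℝ => (q : ℂ)) a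

lemma freqMul_apply (a : SchwartzMap ℝ ℂ) (q : ℝ) : freqMul a q = q * a q := by
  rw [freqMul, SchwartzMap.smulLeftCLM_apply_apply (by fun_prop)]
  rfl

/-- The plane wave with frequency `q`. -/
def planeWave (k q : ℝ) (p : ℝ × ℝ) : ℂ :=
  Complex.exp (Complex.I * (q * p.1 - q ^ 2 * p.2 / (2 * k)))

lemma wavePacket_eq (k : ℝ) (a : SchwartzMap ℝ ℂ) (p : ℝ × ℝ) :
    wavePacket k a p = ∫ q : ℝ, a q * planeWave k q p := rfl

lemma planeWave_eq (k q : ℝ) (p : ℝ × ℝ) :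
    planeWave k q p = Complex.exp (((q * p.1 - q ^ 2 * p.2 / (2 * k) : ℝ) : ℂ) * Complex.I) := by
  rw [planeWave, mul_comm]; push_cast; rfl

lemma norm_planeWave (k q : ℝ) (p : ℝ × ℝ) : ‖planeWave k q p‖ = 1 := by
  rw [planeWave_eq, Complex.norm_exp_ofReal_mul_I]

@[fun_prop]
lemma continuous_planeWave (k : ℝ) (p : ℝ × ℝ) : Continuous fun q => planeWave k q p := by
  unfold planeWave; fun_prop

lemma integrable_mul_planeWave (a : SchwartzMap ℝ ℂ) (p : ℝ × ℝ) :
    Integrable fun q => a q * planeWave k q p := by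
  refine a.integrable.norm.mono' ?_ ?_
  · exact (a.continuous.mul (continuous_planeWave k p)).aestronglyMeasurable
  · filter_upwards with q
    simp [norm_planeWave]

lemma norm_wavePacket_le (a : SchwartzMap ℝ ℂ) (p : ℝ × ℝ) :
    ‖wavePacket k a p‖ ≤ ∫ q, ‖a q‖ := by
  rw [wavePacket_eq]
  refine (norm_integral_le_integral_norm _).trans_eq ?_
  simp [norm_planeWave]

lemma wavePacket_hasDerivAt_fst (a : SchwartzMap ℝ ℂ) (x ζ : ℝ) :
    HasDerivAt (fun x => wavePacket k a (x, ζ)) (Complex.I * wavePacket k (freqMul a) (x, ζ)) x := by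
  have key := (hasDerivAt_integral_of_dominated_loc_of_deriv_le (μ := volume) (s := univ)
    (F := fun x q => a q * planeWave k q (x, ζ))
    (F' := fun x q => Complex.I * (freqMul a q * planeWave k q (x, ζ)))
    (bound := fun q => ‖freqMul a q‖) (x₀ := x) univ_mem
    (Eventually.of_forall fun y => (integrable_mul_planeWave a (y, ζ)).1)
    (integrable_mul_planeWave a (x, ζ))
    ((integrable_mul_planeWave (freqMul a) (x, ζ)).const_mul Complex.I).1
    ?_ (freqMul a).integrable.norm ?_).2
  · rw [integral_const_mul] at key
    exact key
  · filter_upwards with q y _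
    simp [norm_planeWave]
  · filter_upwards with q y _
    unfold planeWave
    have h1 : HasDerivAt (fun x : ℝ => Complex.I * ((q : ℂ) * (x : ℂ) - q ^ 2 * ζ / (2 * k)))
        (Complex.I * (q * 1)) y :=
      (((Complex.ofRealCLM.hasDerivAt (x := y)).const_mul (q : ℂ)).sub_const _).const_mul _
    refine (h1.cexp.const_mul (a q)).congr_deriv ?_
    rw [freqMul_apply]; ring

lemma wavePacket_hasDerivAt_snd (a : SchwartzMap ℝ ℂ) (x ζ : ℝ) :
    HasDerivAt (fun ζ => wavePacket k a (x, ζ))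
      (-(Complex.I / (2 * k)) * wavePacket k (freqMul (freqMul a)) (x, ζ)) ζ := by
  have key := (hasDerivAt_integral_of_dominated_loc_of_deriv_le (μ := volume) (s := univ)
    (F := fun ζ q => a q * planeWave k q (x, ζ))
    (F' := fun ζ q => -(Complex.I / (2 * k)) * (freqMul (freqMul a) q * planeWave k q (x, ζ)))
    (bound := fun q => ‖-(Complex.I / (2 * k))‖ * ‖freqMul (freqMul a) q‖) (x₀ := ζ) univ_mem
    (Eventually.of_forall fun y => (integrable_mul_planeWave a (x, y)).1)
    (integrable_mul_planeWave a (x, ζ))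
    ((integrable_mul_planeWave (freqMul (freqMul a)) (x, ζ)).const_mul _).1
    ?_ ((freqMul (freqMul a)).integrable.norm.const_mul _) ?_).2
  · rw [integral_const_mul] at key
    exact key
  · filter_upwards with q y _
    rw [norm_mul, norm_mul, norm_planeWave, mul_one]
  · filter_upwards with q y _
    unfold planeWave
    have h1 : HasDerivAt (fun ζ : ℝ => Complex.I * ((q : ℂ) * (x : ℂ) - q ^ 2 * (ζ : ℂ) / (2 * k)))
        (Complex.I * (-(q ^ 2 * 1 / (2 * k)))) y :=
      ((((Complex.ofRealCLM.hasDerivAt (x := y)).const_mul ((q : ℂ) ^ 2)).div_const _).const_sub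
        _).const_mul _
    refine (h1.cexp.const_mul (a q)).congr_deriv ?_
    rw [freqMul_apply, freqMul_apply]; ring

lemma integrable_pow_mul_schwartz (a : SchwartzMap ℝ ℂ) (n : ℕ) :
    Integrable fun q : ℝ => ‖q‖ ^ n * ‖a q‖ := a.integrable_pow_mul volume n

/-- A wave packet is the two-dimensional Fourier transform of the measure with density `a` carried
by the parabola `q ↦ (q, -q²/2k)`. All moments of this measure are finite because `a` is Schwartz,
so joint smoothness is an instance of smoothness of Fourier integrals. -/
lemma contDiff_wavePacket (a : SchwartzMap ℝ ℂ) : ContDiff ℝ ∞ (wavePacket k a) := by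
  -- The factor `-(2π)⁻¹` undoes the `-2π` in the exponent of the Fourier character.
  let L : ℝ × ℝ →L[ℝ] ℝ × ℝ →L[ℝ] ℝ :=
    (-(2 * Real.pi)⁻¹ : ℝ) • (((ContinuousLinearMap.mul ℝ ℝ).bilinearComp
      (ContinuousLinearMap.fst ℝ ℝ ℝ) (ContinuousLinearMap.fst ℝ ℝ ℝ)) +
      ((ContinuousLinearMap.mul ℝ ℝ).bilinearComp
      (ContinuousLinearMap.snd ℝ ℝ ℝ) (ContinuousLinearMap.snd ℝ ℝ ℝ)))
  have hL : ∀ v w, L.toLinearMap₁₂ v w = -(2 * Real.pi)⁻¹ * (v.1 * w.1 + v.2 * w.2) := fun v w => by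
    change L v w = _
    simp [L]
    ring
  let e : ℝ → ℝ × ℝ := fun q => (q, -q ^ 2 / (2 * k))
  have he : Continuous e := by fun_prop
  have hemb : MeasurableEmbedding e := by
    refine Continuous.measurableEmbedding he fun q r h => ?_
    exact congrArg Prod.fst h
  let μ : Measure (ℝ × ℝ) := volume.map e
  have h := VectorFourier.contDiff_fourierIntegral (N := ⊤) L (μ := μ) (f := fun v => a v.1) ?_
  · have heq : wavePacket k a
        = VectorFourier.fourierIntegral Real.fourierChar μ L.toLinearMap₁₂ fun v => a v.1 := by
      ext p
      rw [wavePacket_eq, VectorFourier.fourierIntegral, hemb.integral_map]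
      refine integral_congr_ae (Eventually.of_forall fun q => ?_)
      simp only [hL, Circle.smul_def, Real.fourierChar_apply,
        planeWave_eq, smul_eq_mul]
      rw [mul_comm]
      congr 3
      simp only [e]
      push_cast
      have : (Real.pi : ℂ) ≠ 0 := by exact_mod_cast Real.pi_ne_zero
      field_simp
      ring
    rw [heq]
    exact h
  · intro n _
    refine (hemb.integrable_map_iff).2 ?_
    have hb := ((integrable_pow_mul_schwartz a n).add
      ((integrable_pow_mul_schwartz a (2 * n)).const_mul (|(2 * k)⁻¹| ^ n)))
    refine hb.mono' ?_ ?_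
    · exact ((he.norm.pow n).mul
        ((a.continuous.comp (continuous_fst.comp he)).norm)).aestronglyMeasurable
    · filter_upwards with q
      simp only [Function.comp, e, Prod.norm_mk, Pi.add_apply]
      rw [Real.norm_of_nonneg (by positivity), ← mul_assoc, ← add_mul]
      refine mul_le_mul_of_nonneg_right ?_ (norm_nonneg _)
      have h2 : ‖-q ^ 2 / (2 * k)‖ ^ n = |(2 * k)⁻¹| ^ n * ‖q‖ ^ (2 * n) := by
        rw [div_eq_mul_inv, norm_mul, norm_neg, norm_pow, mul_pow, ← pow_mul, mul_comm,
          Real.norm_eq_abs (2 * k)⁻¹]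
      rcases max_cases ‖q‖ ‖-q ^ 2 / (2 * k)‖ with h | h
      · rw [h.1]
        have : 0 ≤ |(2 * k)⁻¹| ^ n * ‖q‖ ^ (2 * n) := by positivity
        linarith
      · rw [h.1, h2]
        have : 0 ≤ ‖q‖ ^ n := by positivity
        linarith

/-- Integration by parts in `q`: the `q`-derivative of the plane wave is the plane wave times `i (x
- qζ/k)`. -/
lemma mul_wavePacket (a : SchwartzMap ℝ ℂ) (x ζ : ℝ) :
    x * wavePacket k a (x, ζ) = Complex.I * wavePacket k (SchwartzMap.derivCLM ℂ ℂ a) (x, ζ)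
      + ζ / k * wavePacket k (freqMul a) (x, ζ) := by
  have hd : ∀ q : ℝ, HasDerivAt (fun q => planeWave k q (x, ζ))
      (planeWave k q (x, ζ) * (Complex.I * (x - q * ζ / k))) q := fun q => by
    unfold planeWave
    have h0 := Complex.ofRealCLM.hasDerivAt (x := q)
    have h1 : HasDerivAt (fun q : ℝ => Complex.I * ((q : ℂ) * (x : ℂ) - (q : ℂ) ^ 2 * ζ / (2 * k)))
        (Complex.I * (1 * x - ((2 : ℕ) * (q : ℂ) ^ (2 - 1) * 1) * ζ / (2 * k))) q :=
      ((h0.mul_const _).sub (((h0.pow 2).mul_const _).div_const _)).const_mul _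
    refine h1.cexp.congr_deriv ?_
    simp only
    congr 2
    rcases eq_or_ne k 0 with rfl | hk
    · simp
    · have : (k : ℂ) ≠ 0 := by exact_mod_cast hk
      push_cast
      field_simp
  have i1 := integrable_mul_planeWave (k := k) a (x, ζ)
  have i2 := integrable_mul_planeWave (k := k) (freqMul a) (x, ζ)
  have i3 := integrable_mul_planeWave (k := k) (SchwartzMap.derivCLM ℂ ℂ a) (x, ζ)
  have hform : (a * fun q => planeWave k q (x, ζ) * (Complex.I * (x - q * ζ / k)))
      = fun q => Complex.I * x * (a q * planeWave k q (x, ζ))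
        - Complex.I * ζ / k * (freqMul a q * planeWave k q (x, ζ)) := by
    ext q; simp only [Pi.mul_apply, freqMul_apply]; ring
  have hib := integral_mul_deriv_eq_deriv_mul_of_integrable (u := a)
    (v := fun q => planeWave k q (x, ζ)) (fun q _ => a.hasDerivAt q) (fun q _ => hd q)
    (by rw [hform]; exact (i1.const_mul _).sub (i2.const_mul _))
    (by simpa [Pi.mul_def] using! i3) i1
  have e1 : (fun q => a q * (planeWave k q (x, ζ) * (Complex.I * (x - q * ζ / k))))
      = fun q => Complex.I * x * (a q * planeWave k q (x, ζ))
        - Complex.I * ζ / k * (freqMul a q * planeWave k q (x, ζ)) := hform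
  rw [e1, integral_sub (i1.const_mul _) (i2.const_mul _), integral_const_mul,
    integral_const_mul] at hib
  simp only [wavePacket_eq, SchwartzMap.derivCLM_apply]
  linear_combination (-Complex.I) * hib + ((x : ℂ) * ∫ q, a q * planeWave k q (x, ζ)) * (Complex.I_sq)
    - (ζ / k * ∫ q, freqMul a q * planeWave k q (x, ζ)) * (Complex.I_sq)

/-- Each factor `x` is traded, by `mul_wavePacket`, for packets with the Schwartz spectra `a'` and
`q a`; the coefficient `ζ/k` stays bounded for `|ζ| ≤ A`. -/
lemma wavePacket_decay (n : ℕ) (A : ℝ) (a : SchwartzMap ℝ ℂ) :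
    ∃ C : ℝ, ∀ x ζ : ℝ, |ζ| ≤ A → |x| ^ n * ‖wavePacket k a (x, ζ)‖ ≤ C := by
  induction n generalizing a with
  | zero => exact ⟨∫ q, ‖a q‖, fun x ζ _ => by simpa using norm_wavePacket_le a (x, ζ)⟩
  | succ n ih =>
    obtain ⟨C₁, h₁⟩ := ih (SchwartzMap.derivCLM ℂ ℂ a)
    obtain ⟨C₂, h₂⟩ := ih (freqMul a)
    refine ⟨C₁ + A / |k| * C₂, fun x ζ hζ => ?_⟩
    have hn : |x| * ‖wavePacket k a (x, ζ)‖ = ‖x * wavePacket k a (x, ζ)‖ := by simp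
    rw [pow_succ, mul_assoc, hn, mul_wavePacket]
    have h2 : 0 ≤ |x| ^ n * ‖wavePacket k (freqMul a) (x, ζ)‖ := by positivity
    calc _ ≤ |x| ^ n * (‖wavePacket k (SchwartzMap.derivCLM ℂ ℂ a) (x, ζ)‖
          + |ζ| / |k| * ‖wavePacket k (freqMul a) (x, ζ)‖) := by
          gcongr
          refine (norm_add_le _ _).trans (by simp)
      _ = |x| ^ n * ‖wavePacket k (SchwartzMap.derivCLM ℂ ℂ a) (x, ζ)‖
          + |ζ| / |k| * (|x| ^ n * ‖wavePacket k (freqMul a) (x, ζ)‖) := by ring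
      _ ≤ _ := by
          refine add_le_add (h₁ x ζ hζ) ?_
          have : 0 ≤ A / |k| := div_nonneg ((abs_nonneg _).trans hζ) (abs_nonneg _)
          exact mul_le_mul (by gcongr) (h₂ x ζ hζ) h2 this

lemma wavePacket_bound (n : ℕ) (A : ℝ) (a : SchwartzMap ℝ ℂ) :
    ∃ C : ℝ, 0 ≤ C ∧ ∀ x ζ : ℝ, 0 ≤ x → |ζ| ≤ A → ‖wavePacket k a (x, ζ)‖ ≤ C / (1 + x) ^ n := by
  obtain ⟨C₁, h₁⟩ := wavePacket_decay (k := k) 0 A a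
  obtain ⟨C₂, h₂⟩ := wavePacket_decay (k := k) n A a
  refine ⟨2 ^ n * (|C₁| + |C₂|), by positivity, fun x ζ hx hζ => ?_⟩
  rw [le_div_iff₀ (by positivity)]
  have a1 := (h₁ x ζ hζ).trans (le_abs_self _)
  have a2 := (h₂ x ζ hζ).trans (le_abs_self _)
  rw [abs_of_nonneg hx] at a2
  have : (1 + x) ^ n ≤ 2 ^ n * (1 + x ^ n) := by
    rcases le_total x 1 with h | h
    · calc (1 + x) ^ n ≤ (2 : ℝ) ^ n := by gcongr; linarith
        _ ≤ _ := by have : (0:ℝ) ≤ 2 ^ n * x ^ n := by positivity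
                    linarith
    · calc (1 + x) ^ n ≤ (2 * x) ^ n := by gcongr; linarith
        _ = 2 ^ n * x ^ n := mul_pow _ _ _
        _ ≤ _ := by have : (0:ℝ) ≤ 2 ^ n := by positivity
                    linarith
  calc _ ≤ ‖wavePacket k a (x, ζ)‖ * (2 ^ n * (1 + x ^ n)) := by gcongr
    _ = 2 ^ n * (|x| ^ 0 * ‖wavePacket k a (x, ζ)‖ + x ^ n * ‖wavePacket k a (x, ζ)‖) := by ring
    _ ≤ _ := by gcongr

/-- On `x = 0` the plane wave is even in `q`. -/
lemma wavePacket_zero_of_odd {a : SchwartzMap ℝ ℂ} (ha : ∀ q, a (-q) = -a q) (ζ : ℝ) :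
    wavePacket k a (0, ζ) = 0 := by
  have h : wavePacket k a (0, ζ) = -wavePacket k a (0, ζ) := by
    conv_lhs => rw [wavePacket_eq, ← integral_neg_eq_self]
    rw [wavePacket_eq, ← integral_neg]
    simp [ha, planeWave]
  exact self_eq_neg.1 h

lemma continuous_wavePacket (a : SchwartzMap ℝ ℂ) : Continuous (wavePacket k a) :=
  (contDiff_wavePacket a).continuous

end WavePacket

/-! ### The smooth transition function and the moments of its derivatives. -/

section Cutoff

/-- The first derivative of the smooth transition function. -/
def transDeriv (t : ℝ) : ℝ := deriv Real.smoothTransition t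

/-- The second derivative of the smooth transition function. -/
def transDeriv₂ (t : ℝ) : ℝ := deriv transDeriv t

lemma contDiff_transDeriv : ContDiff ℝ ∞ transDeriv :=
  (contDiff_infty_iff_deriv.1 Real.smoothTransition.contDiff).2

lemma hasDerivAt_smoothTransition (t : ℝ) : HasDerivAt Real.smoothTransition (transDeriv t) t :=
  ((Real.smoothTransition.contDiff (n := 1)).differentiable (by simp) t).hasDerivAt

lemma hasDerivAt_transDeriv (t : ℝ) : HasDerivAt transDeriv (transDeriv₂ t) t :=
  (contDiff_transDeriv.differentiable (by simp) t).hasDerivAt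

@[fun_prop]
lemma continuous_transDeriv : Continuous transDeriv := contDiff_transDeriv.continuous

@[fun_prop]
lemma continuous_transDeriv₂ : Continuous transDeriv₂ :=
  (contDiff_infty_iff_deriv.1 contDiff_transDeriv).2.continuous

lemma smoothTransition_eventuallyEq_one {t : ℝ} (h : 1 < t) :
    Real.smoothTransition =ᶠ[𝓝 t] fun _ => 1 := by
  filter_upwards [lt_mem_nhds h] with s hs using Real.smoothTransition.one_of_one_le hs.le

lemma smoothTransition_eventuallyEq_zero {t : ℝ} (h : t < 0) :
    Real.smoothTransition =ᶠ[𝓝 t] fun _ => 0 := by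
  filter_upwards [gt_mem_nhds h] with s hs using Real.smoothTransition.zero_of_nonpos hs.le

lemma transDeriv_of_one_lt {t : ℝ} (h : 1 < t) : transDeriv t = 0 := by
  rw [transDeriv, (smoothTransition_eventuallyEq_one h).deriv_eq, deriv_const]

lemma transDeriv_of_neg {t : ℝ} (h : t < 0) : transDeriv t = 0 := by
  rw [transDeriv, (smoothTransition_eventuallyEq_zero h).deriv_eq, deriv_const]

lemma transDeriv₂_of_one_lt {t : ℝ} (h : 1 < t) : transDeriv₂ t = 0 := by
  have : transDeriv =ᶠ[𝓝 t] fun _ => 0 := by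
    filter_upwards [lt_mem_nhds h] with s hs using transDeriv_of_one_lt hs
  rw [transDeriv₂, this.deriv_eq, deriv_const]

lemma transDeriv₂_of_neg {t : ℝ} (h : t < 0) : transDeriv₂ t = 0 := by
  have : transDeriv =ᶠ[𝓝 t] fun _ => 0 := by
    filter_upwards [gt_mem_nhds h] with s hs using transDeriv_of_neg hs
  rw [transDeriv₂, this.deriv_eq, deriv_const]

lemma transDeriv_mem {t : ℝ} (h : transDeriv t ≠ 0) : t ∈ Icc (0 : ℝ) 1 := by
  by_contra hc
  rw [mem_Icc, not_and_or, not_le, not_le] at hc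
  rcases hc with hc | hc
  · exact h (transDeriv_of_neg hc)
  · exact h (transDeriv_of_one_lt hc)

lemma transDeriv₂_mem {t : ℝ} (h : transDeriv₂ t ≠ 0) : t ∈ Icc (0 : ℝ) 1 := by
  by_contra hc
  rw [mem_Icc, not_and_or, not_le, not_le] at hc
  rcases hc with hc | hc
  · exact h (transDeriv₂_of_neg hc)
  · exact h (transDeriv₂_of_one_lt hc)

lemma hasCompactSupport_transDeriv : HasCompactSupport transDeriv :=
  HasCompactSupport.of_support_subset_isCompact isCompact_Icc fun _ h => transDeriv_mem h

lemma hasCompactSupport_transDeriv₂ : HasCompactSupport transDeriv₂ :=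
  HasCompactSupport.of_support_subset_isCompact isCompact_Icc fun _ h => transDeriv₂_mem h

lemma exists_transition_bound : ∃ S : ℝ, 1 ≤ S ∧ ∀ t, |Real.smoothTransition t| ≤ S ∧
    |transDeriv t| ≤ S ∧ |transDeriv₂ t| ≤ S := by
  obtain ⟨C₁, h₁⟩ := hasCompactSupport_transDeriv.exists_bound_of_continuous continuous_transDeriv
  obtain ⟨C₂, h₂⟩ := hasCompactSupport_transDeriv₂.exists_bound_of_continuous
    continuous_transDeriv₂
  refine ⟨max 1 (max C₁ C₂), le_max_left _ _, fun t => ⟨?_, ?_, ?_⟩⟩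
  · rw [abs_of_nonneg (Real.smoothTransition.nonneg t)]
    exact (Real.smoothTransition.le_one t).trans (le_max_left _ _)
  · exact (h₁ t).trans ((le_max_left _ _).trans (le_max_right _ _))
  · exact (h₂ t).trans ((le_max_right _ _).trans (le_max_right _ _))

lemma integral_transDeriv : ∫ t in Ioi (0 : ℝ), transDeriv t = 1 := by
  have h := integral_Ioi_of_hasDerivAt_of_tendsto (f := Real.smoothTransition) (f' := transDeriv)
    (a := 0) (m := 1) Real.smoothTransition.continuousAt.continuousWithinAt
    (fun x _ => hasDerivAt_smoothTransition x)
    (continuous_transDeriv.integrable_of_hasCompactSupport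
      hasCompactSupport_transDeriv).integrableOn
    (tendsto_const_nhds.congr' ?_)
  · simpa using h
  · filter_upwards [eventually_ge_atTop 1] with x hx
    exact (Real.smoothTransition.one_of_one_le hx).symm

lemma integral_transDeriv_sub_one : ∫ t in Ioi (0 : ℝ), transDeriv (t - 1) = 1 := by
  have h := integral_Ioi_of_hasDerivAt_of_tendsto (f := fun t => Real.smoothTransition (t - 1))
    (f' := fun t => transDeriv (t - 1)) (a := 0) (m := 1)
    (by fun_prop)
    (fun x _ => by simpa using (hasDerivAt_smoothTransition (x - 1)).comp_sub_const x 1)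
    ((continuous_transDeriv.integrable_of_hasCompactSupport
      hasCompactSupport_transDeriv).comp_sub_right 1).integrableOn
    (tendsto_const_nhds.congr' ?_)
  · rw [h, Real.smoothTransition.zero_of_nonpos (by norm_num), sub_zero]
  · filter_upwards [eventually_ge_atTop 2] with x hx
    exact (Real.smoothTransition.one_of_one_le (by linarith)).symm

/-- Integration by parts reduces this to `integral_transDeriv_sub_one`. The two moments, `1` and
`-1`, are the weights of the boundary terms in `integral_eq_neg_of_cutoff`. -/
lemma integral_mul_transDeriv₂ : ∫ t in Ioi (0 : ℝ), t * transDeriv₂ (t - 1) = -1 := by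
  have h1 : IntegrableOn (fun t => transDeriv (t - 1)) (Ioi 0) :=
    ((continuous_transDeriv.integrable_of_hasCompactSupport
      hasCompactSupport_transDeriv).comp_sub_right 1).integrableOn
  have h2 : IntegrableOn (fun t => t * transDeriv₂ (t - 1)) (Ioi 0) := by
    refine (Continuous.integrable_of_hasCompactSupport (by fun_prop)
      (HasCompactSupport.of_support_subset_isCompact (K := Icc 1 2) isCompact_Icc
        fun t h => ?_)).integrableOn
    have := transDeriv₂_mem (right_ne_zero_of_mul h)
    constructor <;> linarith [this.1, this.2]
  have h := integral_Ioi_of_hasDerivAt_of_tendsto (f := fun t => t * transDeriv (t - 1))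
    (f' := fun t => transDeriv (t - 1) + t * transDeriv₂ (t - 1)) (a := 0) (m := 0)
    (by fun_prop)
    (fun x _ => by
      simpa using! (hasDerivAt_id x).mul ((hasDerivAt_transDeriv (x - 1)).comp_sub_const x 1))
    (h1.add h2)
    (tendsto_const_nhds.congr' ?_)
  · rw [integral_add h1 h2, integral_transDeriv_sub_one] at h
    linarith
  · filter_upwards [eventually_gt_atTop 2] with x hx
    rw [transDeriv_of_one_lt (by linarith), mul_zero]

end Cutoff

/-! ### Green's identity on a half-line by cutoffs. -/

section OneDim

/-- A one-sided approximate identity: the rescaled `κ` lives on `[0, 2/(n+1)]`, so only the right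
limit of `f` at `0` matters. Measurability of `f` is enough because the integrand is bounded once
the support is small. -/
lemma tendsto_integral_concentrate {κ f : ℝ → ℂ} {A : ℂ} (hκ : Continuous κ)
    (hs : ∀ t, κ t ≠ 0 → t ∈ Icc (0 : ℝ) 2)
    (hfm : AEStronglyMeasurable f (volume.restrict (Ioi 0)))
    (hf : Tendsto f (𝓝[>] 0) (𝓝 A)) :
    Tendsto (fun n : ℕ => ∫ y in Ioi (0 : ℝ), ((n + 1 : ℝ) : ℂ) * κ ((n + 1 : ℝ) * y) * f y) atTop
      (𝓝 ((∫ t in Ioi (0 : ℝ), κ t) * A)) := by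
  have hκi : Integrable κ := hκ.integrable_of_hasCompactSupport
    (HasCompactSupport.of_support_subset_isCompact (K := Icc 0 2) isCompact_Icc fun t h => hs t h)
  set B := ∫ t in Ioi (0 : ℝ), ‖κ t‖ with hB
  have hB0 : 0 ≤ B := integral_nonneg fun _ => norm_nonneg _
  rw [Metric.tendsto_atTop]
  intro ε hε
  have hε' : 0 < ε / (B + 1) := by positivity
  obtain ⟨δ, hδ, hfδ⟩ := Metric.mem_nhdsWithin_iff.1 (hf (Metric.ball_mem_nhds A hε'))
  obtain ⟨N, hN⟩ := exists_nat_gt (2 / δ)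
  refine ⟨N, fun n hn => ?_⟩
  have hn0 : (0 : ℝ) < n + 1 := by positivity
  have hnδ : 2 / δ < (n : ℝ) + 1 := by
    have : (N : ℝ) ≤ n := by exact_mod_cast hn
    linarith
  have hscale : ∀ g : ℝ → ℝ, ∫ y in Ioi (0 : ℝ), (n + 1 : ℝ) * g ((n + 1) * y)
      = ∫ t in Ioi (0 : ℝ), g t := fun g => by
    rw [integral_const_mul, integral_comp_mul_left_Ioi _ _ hn0]
    simp [mul_inv_cancel_left₀ hn0.ne']
  have hscale' : ∫ y in Ioi (0 : ℝ), ((n + 1 : ℝ) : ℂ) * κ ((n + 1 : ℝ) * y)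
      = ∫ t in Ioi (0 : ℝ), κ t := by
    have h0 : ((n + 1 : ℝ) : ℂ) ≠ 0 := by exact_mod_cast hn0.ne'
    rw [integral_const_mul, integral_comp_mul_left_Ioi _ _ hn0]
    simp only [mul_zero, Complex.real_smul, Complex.ofReal_inv]
    rw [mul_inv_cancel_left₀ h0]
  have hpt : ∀ y ∈ Ioi (0 : ℝ), ‖((n + 1 : ℝ) : ℂ) * κ ((n + 1 : ℝ) * y) * (f y - A)‖
      ≤ (n + 1 : ℝ) * ‖κ ((n + 1 : ℝ) * y)‖ * (ε / (B + 1)) := by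
    intro y hy
    rw [norm_mul, norm_mul, Complex.norm_real, Real.norm_of_nonneg hn0.le]
    by_cases h : κ ((n + 1 : ℝ) * y) = 0
    · simp [h]
    · have h2 := (hs _ h).2
      refine mul_le_mul_of_nonneg_left ?_ (by positivity)
      have hy' : y < δ := by
        have : (n + 1 : ℝ) * y < (n + 1) * δ := by
          refine h2.trans_lt ?_
          rwa [div_lt_iff₀ hδ] at hnδ
        exact lt_of_mul_lt_mul_left this hn0.le
      have := hfδ ⟨by simpa [abs_of_pos (mem_Ioi.1 hy)] using! hy', hy⟩
      rw [mem_preimage, Metric.mem_ball, dist_eq_norm] at this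
      exact this.le
  have hκn : Integrable fun y => ((n + 1 : ℝ) : ℂ) * κ ((n + 1 : ℝ) * y) :=
    (hκi.comp_mul_left' hn0.ne').const_mul _
  have hbnd : IntegrableOn (fun y => (n + 1 : ℝ) * ‖κ ((n + 1 : ℝ) * y)‖ * (ε / (B + 1)))
      (Ioi 0) :=
    (((hκi.comp_mul_left' hn0.ne').norm.const_mul _).mul_const _).integrableOn
  have hdi : IntegrableOn (fun y => ((n + 1 : ℝ) : ℂ) * κ ((n + 1 : ℝ) * y) * (f y - A))
      (Ioi 0) := by
    refine hbnd.mono' ?_ ((ae_restrict_iff' measurableSet_Ioi).2 (ae_of_all _ hpt))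
    exact hκn.1.restrict.mul (hfm.sub aestronglyMeasurable_const)
  have hfi : IntegrableOn (fun y => ((n + 1 : ℝ) : ℂ) * κ ((n + 1 : ℝ) * y) * f y) (Ioi 0) := by
    refine (hdi.add (hκn.integrableOn.mul_const A)).congr (ae_of_all _ fun y => ?_)
    simp only [Pi.add_apply]; ring
  rw [dist_eq_norm, ← hscale', ← integral_mul_const, ← integral_sub hfi
    (hκn.integrableOn.mul_const A)]
  calc _ = ‖∫ y in Ioi (0 : ℝ), ((n + 1 : ℝ) : ℂ) * κ ((n + 1 : ℝ) * y) * (f y - A)‖ := by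
        congr 2; ext y; ring
    _ ≤ ∫ y in Ioi (0 : ℝ), (n + 1 : ℝ) * ‖κ ((n + 1 : ℝ) * y)‖ * (ε / (B + 1)) :=
        norm_integral_le_of_norm_le hbnd ((ae_restrict_iff' measurableSet_Ioi).2 (ae_of_all _ hpt))
    _ = B * (ε / (B + 1)) := by
        rw [integral_mul_const, hscale (fun t => ‖κ t‖)]
    _ < ε := by
        rw [mul_div_assoc', div_lt_iff₀ (by positivity)]
        nlinarith

variable {M M₁ M₂ : ℝ → ℂ}

/-- Compact support of the cutoff is relaxed to boundedness: multiply `ρ` by a cutoff at scale `n +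
1`, whose derivatives are uniformly bounded and vanish eventually at each point, and use dominated
convergence. -/
lemma integral_eq_zero_of_bounded_cutoff (hM : IntegrableOn M (Ioi 0)) (hM₁ : IntegrableOn M₁ (Ioi 0))
    (hM₂ : IntegrableOn M₂ (Ioi 0))
    (h : ∀ η η₁ η₂ : ℝ → ℝ, ContDiff ℝ ∞ η → HasCompactSupport η → tsupport η ⊆ Ioi 0 →
      (∀ y, HasDerivAt η (η₁ y) y) → (∀ y, HasDerivAt η₁ (η₂ y) y) →
      ∫ y in Ioi (0 : ℝ), (η₂ y * M y + 2 * η₁ y * M₁ y + η y * M₂ y) = 0)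
    {ρ ρ₁ ρ₂ : ℝ → ℝ} {B δ : ℝ} (hδ : 0 < δ) (hρ : ContDiff ℝ ∞ ρ)
    (hρ₁ : ∀ y, HasDerivAt ρ (ρ₁ y) y) (hρ₂ : ∀ y, HasDerivAt ρ₁ (ρ₂ y) y) (hρc : Continuous ρ₂)
    (hB : ∀ y, |ρ y| ≤ B ∧ |ρ₁ y| ≤ B ∧ |ρ₂ y| ≤ B) (hsupp : ∀ y < δ, ρ y = 0) :
    ∫ y in Ioi (0 : ℝ), (ρ₂ y * M y + 2 * ρ₁ y * M₁ y + ρ y * M₂ y) = 0 := by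
  obtain ⟨S, hS1, hS⟩ := exists_transition_bound
  have hB0 : 0 ≤ B := (abs_nonneg _).trans (hB 0).1
  -- Equal to `1` for `y ≤ n + 1` and to `0` for `y ≥ 2 (n + 1)`.
  let τ : ℕ → ℝ → ℝ := fun n y => Real.smoothTransition (2 - y / (n + 1))
  let τ₁ : ℕ → ℝ → ℝ := fun n y => -(transDeriv (2 - y / (n + 1)) / (n + 1))
  let τ₂ : ℕ → ℝ → ℝ := fun n y => transDeriv₂ (2 - y / (n + 1)) / (n + 1) / (n + 1)
  have hlin : ∀ (n : ℕ) y, HasDerivAt (fun y : ℝ => 2 - y / (n + 1 : ℝ)) (-(1 / (n + 1))) y :=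
    fun n y => ((hasDerivAt_id y).div_const _).const_sub _
  have hτ₁ : ∀ n y, HasDerivAt (τ n) (τ₁ n y) y := fun n y =>
    ((hasDerivAt_smoothTransition _).comp y (hlin n y)).congr_deriv (by simp only [τ₁]; ring)
  have hτ₂ : ∀ n y, HasDerivAt (τ₁ n) (τ₂ n y) y := fun n y =>
    (((hasDerivAt_transDeriv _).comp y (hlin n y)).div_const _).neg.congr_deriv
      (by simp only [τ₂]; ring)
  have hτb : ∀ (n : ℕ) y, |τ n y| ≤ S ∧ |τ₁ n y| ≤ S ∧ |τ₂ n y| ≤ S := by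
    intro n y
    have hS' := hS (2 - y / (n + 1))
    have hn1 : (1 : ℝ) ≤ n + 1 := by simp
    have hn : |(n + 1 : ℝ)| = n + 1 := abs_of_pos (by positivity)
    refine ⟨hS'.1, ?_, ?_⟩
    · simp only [τ₁]
      rw [abs_neg, abs_div, hn]
      exact (div_le_self (abs_nonneg _) hn1).trans hS'.2.1
    · simp only [τ₂]
      rw [abs_div, abs_div, hn]
      exact (div_le_self (by positivity) hn1).trans
        ((div_le_self (abs_nonneg _) hn1).trans hS'.2.2)
  have hlim : ∀ y : ℝ, ∀ᶠ n : ℕ in atTop, τ n y = 1 ∧ τ₁ n y = 0 ∧ τ₂ n y = 0 := by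
    intro y
    obtain ⟨N, hN⟩ := exists_nat_gt y
    filter_upwards [eventually_ge_atTop N] with n hn
    have h1 : 1 < 2 - y / ((n : ℝ) + 1) := by
      have : y / ((n : ℝ) + 1) < 1 := by
        rw [div_lt_one (by positivity)]
        have : (N : ℝ) ≤ n := by exact_mod_cast hn
        linarith
      linarith
    simp only [τ, τ₁, τ₂]
    rw [Real.smoothTransition.one_of_one_le h1.le, transDeriv_of_one_lt h1,
      transDeriv₂_of_one_lt h1]
    simp
  have hzero : ∀ n : ℕ, ∫ y in Ioi (0 : ℝ),
      (((ρ₂ y * τ n y + ρ₁ y * τ₁ n y + (ρ₁ y * τ₁ n y + ρ y * τ₂ n y) : ℝ) : ℂ) * M y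
        + 2 * ((ρ₁ y * τ n y + ρ y * τ₁ n y : ℝ) : ℂ) * M₁ y
        + ((ρ y * τ n y : ℝ) : ℂ) * M₂ y) = 0 := by
    intro n
    have hsub : Function.support (fun y => ρ y * τ n y) ⊆ Icc δ (2 * (n + 1)) := by
      intro y hy
      rw [Function.mem_support] at hy
      refine ⟨?_, ?_⟩
      · by_contra hc
        exact left_ne_zero_of_mul hy (hsupp y (not_le.1 hc))
      · by_contra hc
        refine right_ne_zero_of_mul hy (Real.smoothTransition.zero_of_nonpos ?_)
        have : 2 ≤ y / ((n : ℝ) + 1) := by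
          rw [le_div_iff₀ (by positivity)]
          exact (not_le.1 hc).le
        linarith
    refine h (fun y => ρ y * τ n y) _ _ ?_ ?_ ?_ (fun y => (hρ₁ y).mul (hτ₁ n y))
      (fun y => ((hρ₂ y).mul (hτ₁ n y)).add ((hρ₁ y).mul (hτ₂ n y)))
    · exact hρ.mul (Real.smoothTransition.contDiff.comp (by fun_prop))
    · exact HasCompactSupport.of_support_subset_isCompact isCompact_Icc hsub
    · exact (closure_minimal hsub isClosed_Icc).trans fun y hy => hδ.trans_le hy.1
  have hρ_c : Continuous ρ := hρ.continuous
  have hρ₁_c : Continuous ρ₁ := continuous_iff_continuousAt.2 fun y => (hρ₂ y).continuousAt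
  have hτ_c : ∀ n, Continuous (τ n) := fun n =>
    continuous_iff_continuousAt.2 fun y => (hτ₁ n y).continuousAt
  have hτ₁_c : ∀ n, Continuous (τ₁ n) := fun n =>
    continuous_iff_continuousAt.2 fun y => (hτ₂ n y).continuousAt
  have hτ₂_c : ∀ n, Continuous (τ₂ n) := fun n => by simp only [τ₂]; fun_prop
  have ht := tendsto_integral_of_dominated_convergence
    (F := fun (n : ℕ) y =>
      (((ρ₂ y * τ n y + ρ₁ y * τ₁ n y + (ρ₁ y * τ₁ n y + ρ y * τ₂ n y) : ℝ) : ℂ) * M y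
        + 2 * ((ρ₁ y * τ n y + ρ y * τ₁ n y : ℝ) : ℂ) * M₁ y
        + ((ρ y * τ n y : ℝ) : ℂ) * M₂ y))
    (f := fun y => ρ₂ y * M y + 2 * ρ₁ y * M₁ y + ρ y * M₂ y)
    (μ := volume.restrict (Ioi 0))
    (bound := fun y => 4 * (B * S) * (‖M y‖ + ‖M₁ y‖ + ‖M₂ y‖)) ?_ ?_ ?_ ?_
  · simp only [hzero] at ht
    exact tendsto_nhds_unique ht tendsto_const_nhds
  · intro n
    refine ((AEStronglyMeasurable.mul ?_ hM.1).add (AEStronglyMeasurable.mul ?_ hM₁.1)).add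
      (AEStronglyMeasurable.mul ?_ hM₂.1)
    · exact Continuous.aestronglyMeasurable (by fun_prop)
    · exact Continuous.aestronglyMeasurable (by fun_prop)
    · exact Continuous.aestronglyMeasurable (by fun_prop)
  · exact ((hM.norm.add hM₁.norm).add hM₂.norm).const_mul _
  · intro n
    refine ae_of_all _ fun y => ?_
    obtain ⟨b0, b1, b2⟩ := hB y
    obtain ⟨s0, s1, s2⟩ := hτb n y
    have hp : ∀ {u v : ℝ}, |u| ≤ B → |v| ≤ S → |u * v| ≤ B * S := fun {u v} hu hv => by
      rw [abs_mul]; gcongr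
    have e2 : |ρ₂ y * τ n y + ρ₁ y * τ₁ n y + (ρ₁ y * τ₁ n y + ρ y * τ₂ n y)| ≤ 4 * (B * S) := by
      refine (abs_add_le _ _).trans ?_
      have := abs_add_le (ρ₂ y * τ n y) (ρ₁ y * τ₁ n y)
      have := abs_add_le (ρ₁ y * τ₁ n y) (ρ y * τ₂ n y)
      linarith [hp b2 s0, hp b1 s1, hp b0 s2]
    have e1 : |ρ₁ y * τ n y + ρ y * τ₁ n y| ≤ 2 * (B * S) := by
      refine (abs_add_le _ _).trans ?_
      linarith [hp b1 s0, hp b0 s1]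
    have e0 : |ρ y * τ n y| ≤ 4 * (B * S) := by
      have : 0 ≤ B * S := by positivity
      linarith [hp b0 s0]
    refine (norm_add_le _ _).trans ?_
    rw [mul_add]
    refine add_le_add ((norm_add_le _ _).trans ?_) ?_
    · rw [mul_add]
      refine add_le_add ?_ ?_
      · rw [norm_mul, Complex.norm_real]
        exact mul_le_mul_of_nonneg_right e2 (norm_nonneg _)
      · rw [norm_mul, norm_mul, Complex.norm_real]
        refine mul_le_mul_of_nonneg_right ?_ (norm_nonneg _)
        rw [Complex.norm_two, Real.norm_eq_abs]
        linarith
    · rw [norm_mul, Complex.norm_real]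
      exact mul_le_mul_of_nonneg_right e0 (norm_nonneg _)
  · refine ae_of_all _ fun y => tendsto_const_nhds.congr' ?_
    filter_upwards [hlim y] with n hn
    rw [hn.1, hn.2.1, hn.2.2]
    simp

set_option maxHeartbeats 400000 in
/-- Green's identity on a half-line, tested with cutoffs that converge to `1`. -/
lemma integral_eq_neg_of_cutoff {A : ℂ} (hM : IntegrableOn M (Ioi 0))
    (hM₁ : IntegrableOn M₁ (Ioi 0)) (hM₂ : IntegrableOn M₂ (Ioi 0))
    (h : ∀ η η₁ η₂ : ℝ → ℝ, ContDiff ℝ ∞ η → HasCompactSupport η → tsupport η ⊆ Ioi 0 →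
      (∀ y, HasDerivAt η (η₁ y) y) → (∀ y, HasDerivAt η₁ (η₂ y) y) →
      ∫ y in Ioi (0 : ℝ), (η₂ y * M y + 2 * η₁ y * M₁ y + η y * M₂ y) = 0)
    (hA : Tendsto (fun y : ℝ => M y / y) (𝓝[>] 0) (𝓝 A)) (hA₁ : Tendsto M₁ (𝓝[>] 0) (𝓝 A)) :
    ∫ y in Ioi (0 : ℝ), M₂ y = -A := by
  obtain ⟨S, hS1, hS⟩ := exists_transition_bound
  -- The shift by `1` makes `ρ n` vanish for `y < 1/(n+1)`, so that its support stays off the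
  -- boundary.
  let ρ : ℕ → ℝ → ℝ := fun n y => Real.smoothTransition ((n + 1) * y - 1)
  let ρ₁ : ℕ → ℝ → ℝ := fun n y => (n + 1) * transDeriv ((n + 1) * y - 1)
  let ρ₂ : ℕ → ℝ → ℝ := fun n y => (n + 1) * ((n + 1) * transDeriv₂ ((n + 1) * y - 1))
  have hlin : ∀ (n : ℕ) y, HasDerivAt (fun y : ℝ => (n + 1 : ℝ) * y - 1) (n + 1) y :=
    fun n y => by simpa using ((hasDerivAt_id y).const_mul (n + 1 : ℝ)).sub_const 1
  have hρ₁ : ∀ n y, HasDerivAt (ρ n) (ρ₁ n y) y := fun n y =>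
    ((hasDerivAt_smoothTransition _).comp y (hlin n y)).congr_deriv (by simp only [ρ₁]; ring)
  have hρ₂ : ∀ n y, HasDerivAt (ρ₁ n) (ρ₂ n y) y := fun n y =>
    (((hasDerivAt_transDeriv _).comp y (hlin n y)).const_mul _).congr_deriv
      (by simp only [ρ₂]; ring)
  have hρc : ∀ n, Continuous (ρ n) := fun n => by simp only [ρ]; fun_prop
  have hρ₁c : ∀ n, Continuous (ρ₁ n) := fun n => by simp only [ρ₁]; fun_prop
  have hρ₂c : ∀ n, Continuous (ρ₂ n) := fun n => by simp only [ρ₂]; fun_prop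
  have hρb : ∀ (n : ℕ) y, |ρ n y| ≤ (n + 1) * ((n + 1) * S) ∧ |ρ₁ n y| ≤ (n + 1) * ((n + 1) * S)
      ∧ |ρ₂ n y| ≤ (n + 1) * ((n + 1) * S) := by
    intro n y
    have hn1 : (1 : ℝ) ≤ n + 1 := by simp
    have hn : |(n + 1 : ℝ)| = n + 1 := abs_of_pos (by positivity)
    have hS' := hS ((n + 1) * y - 1)
    have k1 : S ≤ (n + 1) * S := le_mul_of_one_le_left (by linarith) hn1
    have k2 : (n + 1) * S ≤ (n + 1) * ((n + 1) * S) :=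
      le_mul_of_one_le_left (by positivity) hn1
    refine ⟨hS'.1.trans (k1.trans k2), ?_, ?_⟩
    · simp only [ρ₁]
      rw [abs_mul, hn]
      exact (mul_le_mul_of_nonneg_left hS'.2.1 (by positivity)).trans k2
    · simp only [ρ₂]
      rw [abs_mul, abs_mul, hn]
      gcongr
      exact hS'.2.2
  have hz : ∀ n : ℕ, ∫ y in Ioi (0 : ℝ),
      (ρ₂ n y * M y + 2 * ρ₁ n y * M₁ y + ρ n y * M₂ y) = 0 := by
    intro n
    refine integral_eq_zero_of_bounded_cutoff hM hM₁ hM₂ h (δ := 1 / (n + 1)) (by positivity) ?_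
      (hρ₁ n) (hρ₂ n) (hρ₂c n) (hρb n) ?_
    · exact Real.smoothTransition.contDiff.comp (by fun_prop)
    · intro y hy
      refine Real.smoothTransition.zero_of_nonpos ?_
      rw [lt_div_iff₀ (by positivity)] at hy
      linarith
  have hbd : ∀ {f : ℝ → ℂ} {r : ℝ → ℝ} {C : ℝ}, IntegrableOn f (Ioi 0) → Continuous r →
      (∀ y, |r y| ≤ C) → IntegrableOn (fun y => (r y : ℂ) * f y) (Ioi 0) := by
    intro f r C hf hr hb
    refine Integrable.bdd_mul hf (Continuous.aestronglyMeasurable (by fun_prop))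
      (c := C) (ae_of_all _ fun y => ?_)
    simpa using hb y
  have i0 : ∀ n, IntegrableOn (fun y => (ρ n y : ℂ) * M₂ y) (Ioi 0) := fun n =>
    hbd hM₂ (hρc n) fun y => (hρb n y).1
  have i1 : ∀ n, IntegrableOn (fun y => (ρ₁ n y : ℂ) * M₁ y) (Ioi 0) := fun n =>
    hbd hM₁ (hρ₁c n) fun y => (hρb n y).2.1
  have i2 : ∀ n, IntegrableOn (fun y => (ρ₂ n y : ℂ) * M y) (Ioi 0) := fun n =>
    hbd hM (hρ₂c n) fun y => (hρb n y).2.2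
  have t0 : Tendsto (fun n : ℕ => ∫ y in Ioi (0 : ℝ), (ρ n y : ℂ) * M₂ y) atTop
      (𝓝 (∫ y in Ioi (0 : ℝ), M₂ y)) := by
    refine tendsto_integral_of_dominated_convergence (fun y => ‖M₂ y‖) (fun n => (i0 n).1)
      hM₂.norm (fun n => ae_of_all _ fun y => ?_) ?_
    · rw [norm_mul, Complex.norm_real, Real.norm_of_nonneg (Real.smoothTransition.nonneg _)]
      exact mul_le_of_le_one_left (norm_nonneg _) (Real.smoothTransition.le_one _)
    · refine (ae_restrict_iff' measurableSet_Ioi).2 (ae_of_all _ fun y hy => ?_)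
      refine tendsto_const_nhds.congr' ?_
      obtain ⟨N, hN⟩ := exists_nat_gt (2 / y)
      filter_upwards [eventually_ge_atTop N] with n hn
      have : 1 ≤ (n + 1 : ℝ) * y - 1 := by
        have h1 : (N : ℝ) ≤ n := by exact_mod_cast hn
        rw [div_lt_iff₀ hy] at hN
        have h2 : (N : ℝ) * y ≤ (n + 1) * y := mul_le_mul_of_nonneg_right (by linarith) (le_of_lt hy)
        linarith
      simp only [ρ]
      rw [Real.smoothTransition.one_of_one_le this]
      simp
  have t1 : Tendsto (fun n : ℕ => ∫ y in Ioi (0 : ℝ), (ρ₁ n y : ℂ) * M₁ y) atTop (𝓝 A) := by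
    have := tendsto_integral_concentrate (κ := fun t => (transDeriv (t - 1) : ℂ)) (by fun_prop)
      (fun t ht => ?_) hM₁.1 hA₁
    · rw [integral_complex_ofReal, integral_transDeriv_sub_one] at this
      simpa [ρ₁] using this
    · have := transDeriv_mem (Complex.ofReal_ne_zero.1 ht)
      constructor <;> linarith [this.1, this.2]
  have hMm : AEStronglyMeasurable (fun y : ℝ => M y / y) (volume.restrict (Ioi 0)) := by
    simp only [div_eq_mul_inv]
    exact hM.1.mul (Measurable.aestronglyMeasurable (by fun_prop))
  -- For `y > 0`, `ρ₂ n y * M y` is `(n+1) κ((n+1)y) · M y / y` with `κ t = t * transDeriv₂ (t -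
  -- 1)`; this is why first-order vanishing of `M` is needed.
  have t2 : Tendsto (fun n : ℕ => ∫ y in Ioi (0 : ℝ), (ρ₂ n y : ℂ) * M y) atTop (𝓝 (-A)) := by
    have := tendsto_integral_concentrate (κ := fun t => ((t * transDeriv₂ (t - 1) : ℝ) : ℂ))
      (by fun_prop) (fun t ht => ?_)
      hMm hA
    · rw [integral_complex_ofReal, integral_mul_transDeriv₂] at this
      simp only [Complex.ofReal_neg, Complex.ofReal_one, neg_mul, one_mul] at this
      refine this.congr fun n => setIntegral_congr_fun measurableSet_Ioi fun y hy => ?_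
      have hy0 : (y : ℂ) ≠ 0 := by exact_mod_cast (ne_of_gt (mem_Ioi.1 hy))
      simp only [ρ₂]
      push_cast
      field_simp
    · have := transDeriv₂_mem (right_ne_zero_of_mul (Complex.ofReal_ne_zero.1 ht))
      constructor <;> linarith [this.1, this.2]
  -- The boundary contributions `-A` from the second derivative and `2A` from the first leave `A`.
  have hsum : Tendsto (fun n : ℕ => ∫ y in Ioi (0 : ℝ),
      (ρ₂ n y * M y + 2 * ρ₁ n y * M₁ y + ρ n y * M₂ y)) atTop
      (𝓝 (-A + 2 * A + ∫ y in Ioi (0 : ℝ), M₂ y)) := by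
    refine ((t2.add (t1.const_mul 2)).add t0).congr fun n => ?_
    have i21 : IntegrableOn (fun y => ρ₂ n y * M y + 2 * (ρ₁ n y * M₁ y)) (Ioi 0) :=
      (i2 n).add ((i1 n).const_mul 2)
    rw [← integral_const_mul, ← integral_add (i2 n) ((i1 n).const_mul 2), ← integral_add i21 (i0 n)]
    simp only [mul_assoc]
  simp only [hz] at hsum
  have := tendsto_nhds_unique hsum tendsto_const_nhds
  linear_combination this

end OneDim

/-! ### Fields in the half-plane: integrability, continuity of overlaps, traces. -/

section HalfPlane

/-- A field amplitude in the half-plane `x > 0` with the boundary values `v₀` at `x = 0`. -/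
structure IsHalfPlaneField (k z : ℝ) (V : ℝ × ℝ → ℂ) (v₀ : ℝ → ℂ) : Prop where
  continuousOn : ContinuousOn V {p : ℝ × ℝ | 0 < p.1 ∧ p.2 ≤ z}
  equation : IsWeakParabolicSolution k V {p : ℝ × ℝ | 0 < p.1 ∧ p.2 < z}
  growth : ∀ a : ℝ, a < z → ∃ (N : ℕ) (C : NNReal), ∀ ζ ∈ Icc a z,
    ∫⁻ x in Ioi (0 : ℝ), ENNReal.ofReal (‖V (x, ζ)‖ / (1 + x) ^ N) ≤ C
  trace : ∀ a : ℝ, a < z → Tendsto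
    (fun y : ℝ => ∫⁻ ζ in Ioo a z, ‖V (y, ζ) - v₀ ζ‖ₑ) (𝓝[>] 0) (𝓝 0)
  data_integrable :
    IntegrableOn (fun ζ : ℝ => v₀ ζ / ((Real.sqrt (z - ζ) * (1 + (z - ζ)) : ℝ) : ℂ)) (Iio z)
  radiation : ∀ a : SchwartzMap ℝ ℂ, (∀ q, a (-q) = -a q) →
    Tendsto (fun ζ : ℝ => ∫ x in Ioi (0 : ℝ), V (x, ζ) * conj (wavePacket k a (x, ζ))) atBot (𝓝 0)

/-- Continuity, and decay faster than any power of `x ≥ 0`, locally uniformly in `ζ`. -/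
structure RapidDecay (g : ℝ × ℝ → ℂ) : Prop where
  continuous : Continuous g
  decay : ∀ (n : ℕ) (A : ℝ), ∃ C : ℝ, 0 ≤ C ∧ ∀ x ζ : ℝ, 0 ≤ x → |ζ| ≤ A →
    ‖g (x, ζ)‖ ≤ C / (1 + x) ^ n

variable {k z : ℝ} {V : ℝ × ℝ → ℂ} {v₀ : ℝ → ℂ} {g : ℝ × ℝ → ℂ}

lemma abs_le_of_mem_Icc {a b x : ℝ} (h : x ∈ Icc a b) : |x| ≤ max |a| |b| :=
  abs_le_max_abs_abs h.1 h.2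

lemma integrableOn_of_div_weight
    (hdata : IntegrableOn (fun ζ : ℝ => v₀ ζ / ((Real.sqrt (z - ζ) * (1 + (z - ζ)) : ℝ) : ℂ)) (Iio z))
    (a : ℝ) : IntegrableOn v₀ (Ioo a z) := by
  rw [← Iio_inter_Ioi]
  have h := hdata.mono_set (inter_subset_left (s := Iio z) (t := Ioi a))
  have hb := Integrable.bdd_mul (c := Real.sqrt (z - a) * (1 + (z - a))) h
    (f := fun ζ => ((Real.sqrt (z - ζ) * (1 + (z - ζ)) : ℝ) : ℂ))
    (Continuous.aestronglyMeasurable (by fun_prop)) ?_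
  · refine hb.congr ((ae_restrict_iff' (measurableSet_Iio.inter measurableSet_Ioi)).2
      (ae_of_all _ fun ζ hζ => ?_))
    have h1 : 0 < z - ζ := sub_pos.2 hζ.1
    have h2 : 0 < Real.sqrt (z - ζ) := Real.sqrt_pos.2 h1
    have : ((Real.sqrt (z - ζ) * (1 + (z - ζ)) : ℝ) : ℂ) ≠ 0 := by
      exact_mod_cast (by positivity : Real.sqrt (z - ζ) * (1 + (z - ζ)) ≠ 0)
    simp only
    rw [mul_div_cancel₀ _ this]
  · refine (ae_restrict_iff' (measurableSet_Iio.inter measurableSet_Ioi)).2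
      (ae_of_all _ fun ζ hζ => ?_)
    have h1 : 0 < z - ζ := sub_pos.2 hζ.1
    have h2 : a < ζ := hζ.2
    rw [Complex.norm_real, Real.norm_of_nonneg (by positivity)]
    gcongr

namespace IsHalfPlaneField

lemma data_integrableOn_Ioc (hV : IsHalfPlaneField k z V v₀) (a : ℝ) :
    IntegrableOn v₀ (Ioc a z) := by
  rw [integrableOn_Ioc_iff_integrableOn_Ioo]
  exact integrableOn_of_div_weight hV.data_integrable a

lemma continuousOn_slice (hV : IsHalfPlaneField k z V v₀) {ζ : ℝ} (hζ : ζ ≤ z) :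
    ContinuousOn (fun x => V (x, ζ)) (Ioi 0) :=
  hV.continuousOn.comp (by fun_prop) fun _ hx => ⟨hx, hζ⟩

lemma continuousOn_slice' (hV : IsHalfPlaneField k z V v₀) {x : ℝ} (hx : 0 < x) :
    ContinuousOn (fun ζ => V (x, ζ)) (Iic z) :=
  hV.continuousOn.comp (by fun_prop) fun _ hζ => ⟨hx, hζ⟩

/-- The mean growth bound on `V` loses `(1 + x)^N`, which the decay of `g` supplies; the bound is
uniform in `ζ` whenever `C` and `K` are. -/
lemma lintegral_mul_le {N : ℕ} {C : NNReal} {ζ : ℝ} {S : Set ℝ} (hS : MeasurableSet S)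
    (hS0 : S ⊆ Ioi 0)
    (hC : ∫⁻ x in Ioi (0 : ℝ), ENNReal.ofReal (‖V (x, ζ)‖ / (1 + x) ^ N) ≤ C) {K : ℝ} (hK : 0 ≤ K)
    (hg : ∀ x ∈ S, ‖g (x, ζ)‖ ≤ K / (1 + x) ^ N) :
    ∫⁻ x in S, ‖V (x, ζ) * g (x, ζ)‖ₑ ≤ ENNReal.ofReal (K * C) := by
  calc ∫⁻ x in S, ‖V (x, ζ) * g (x, ζ)‖ₑ
      ≤ ∫⁻ x in S, ENNReal.ofReal K * ENNReal.ofReal (‖V (x, ζ)‖ / (1 + x) ^ N) := by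
        refine setLIntegral_mono' hS fun x hx => ?_
        have hx0 : 0 < x := hS0 hx
        rw [← ofReal_norm, ← ENNReal.ofReal_mul hK, norm_mul]
        refine ENNReal.ofReal_le_ofReal ?_
        calc _ ≤ ‖V (x, ζ)‖ * (K / (1 + x) ^ N) := by gcongr; exact hg x hx
          _ = _ := by ring
    _ = ENNReal.ofReal K * ∫⁻ x in S, ENNReal.ofReal (‖V (x, ζ)‖ / (1 + x) ^ N) :=
        lintegral_const_mul' _ _ ENNReal.ofReal_ne_top
    _ ≤ ENNReal.ofReal K * C := by
        gcongr
        exact (lintegral_mono_set hS0).trans hC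
    _ = _ := by rw [ENNReal.ofReal_mul hK, ENNReal.ofReal_coe_nnreal]

lemma integrableOn_slice (hV : IsHalfPlaneField k z V v₀) (hg : RapidDecay g) {ζ : ℝ}
    (hζ : ζ ≤ z) : IntegrableOn (fun x => V (x, ζ) * g (x, ζ)) (Ioi 0) := by
  obtain ⟨N, C, hC⟩ := hV.growth (ζ - 1) (by linarith)
  obtain ⟨K, hK, hgK⟩ := hg.decay N |ζ|
  refine ⟨((hV.continuousOn_slice hζ).mul
    (hg.continuous.comp (by fun_prop : Continuous fun x : ℝ => (x, ζ))).continuousOn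
    ).aestronglyMeasurable measurableSet_Ioi, ?_⟩
  exact (lintegral_mul_le measurableSet_Ioi Subset.rfl (hC ζ ⟨by linarith, hζ⟩) hK
    fun x hx => hgK x ζ (le_of_lt hx) le_rfl).trans_lt ENNReal.ofReal_lt_top

lemma integrable_strip (hV : IsHalfPlaneField k z V v₀) (hg : RapidDecay g) {a : ℝ} (ha : a < z) :
    Integrable (fun p => V p * g p)
      ((volume.restrict (Ioi (0 : ℝ))).prod (volume.restrict (Ioc a z))) := by
  have hS : MeasurableSet (Ioi (0 : ℝ) ×ˢ Ioc a z) := measurableSet_Ioi.prod measurableSet_Ioc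
  have hm : AEStronglyMeasurable (fun p => V p * g p)
      ((volume.restrict (Ioi (0 : ℝ))).prod (volume.restrict (Ioc a z))) := by
    rw [Measure.prod_restrict]
    exact ((hV.continuousOn.mono fun p hp => ⟨hp.1, hp.2.2⟩).mul
      hg.continuous.continuousOn).aestronglyMeasurable hS
  refine ⟨hm, ?_⟩
  obtain ⟨N, C, hC⟩ := hV.growth a ha
  obtain ⟨K, hK, hgK⟩ := hg.decay N (max |a| |z|)
  rw [HasFiniteIntegral, lintegral_prod_symm _ hm.enorm]
  calc _ ≤ ∫⁻ ζ in Ioc a z, ENNReal.ofReal (K * C) := by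
        refine setLIntegral_mono' measurableSet_Ioc fun ζ hζ => ?_
        have hζ' := Ioc_subset_Icc_self hζ
        exact lintegral_mul_le measurableSet_Ioi Subset.rfl (hC ζ hζ') hK fun x hx =>
          hgK x ζ (le_of_lt hx) (abs_le_of_mem_Icc hζ')
    _ < ⊤ := by
        rw [setLIntegral_const]
        exact ENNReal.mul_lt_top ENNReal.ofReal_lt_top (by simp)

/-- The overlap integral with a rapidly decaying function that vanishes on the line is continuous
up to `ζ = z`. -/
lemma continuousOn_overlap (hV : IsHalfPlaneField k z V v₀) (hg : RapidDecay g) {L : ℝ}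
    (hL : ∀ x ζ : ℝ, ‖g (x, ζ)‖ ≤ L * |x|) {a : ℝ} (ha : a < z) :
    ContinuousOn (fun ζ => ∫ x in Ioi (0 : ℝ), V (x, ζ) * g (x, ζ)) (Icc a z) := by
  obtain ⟨N, C, hC⟩ := hV.growth a ha
  obtain ⟨K, hK, hgK⟩ := hg.decay (N + 1) (max |a| |z|)
  have hL0 : 0 ≤ L := by simpa using (norm_nonneg _).trans (hL 1 0)
  have hIcc : ∀ n : ℕ, Icc (1 / (n + 1 : ℝ)) (n + 1) ⊆ Ioi 0 := fun n x hx =>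
    lt_of_lt_of_le (by positivity) hx.1
  -- Off `[1/(n+1), n+1]` the function `g` is small relative to `(1 + x)^(-N)`: near `0` because it
  -- is at most `L x`, at infinity because one spare power of decay was requested. Hence the
  -- truncated overlaps converge uniformly in `ζ`, up to `ζ = z`.
  have hoff : ∀ n : ℕ, ∀ ζ ∈ Icc a z, ∀ x ∈ Ioi (0 : ℝ) \ Icc (1 / (n + 1 : ℝ)) (n + 1),
      ‖g (x, ζ)‖ ≤ ((K + L * 2 ^ N) / (n + 1)) / (1 + x) ^ N := by
    intro n ζ hζ x ⟨hx0, hx⟩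
    have hx0' : 0 < x := hx0
    rw [mem_Icc, not_and_or, not_le, not_le] at hx
    have hn : (0 : ℝ) < n + 1 := by positivity
    rcases hx with hx | hx
    · have hx1 : 1 + x ≤ 2 := by
        have : 1 / ((n : ℝ) + 1) ≤ 1 := by
          rw [div_le_one hn]; simp
        linarith
      calc ‖g (x, ζ)‖ ≤ L * x := by simpa [abs_of_pos hx0'] using hL x ζ
        _ ≤ L * (1 / (n + 1)) := by gcongr
        _ = (L * 2 ^ N / (n + 1)) / 2 ^ N := by field_simp
        _ ≤ (L * 2 ^ N / (n + 1)) / (1 + x) ^ N := by gcongr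
        _ ≤ _ := by gcongr; linarith
    · calc ‖g (x, ζ)‖ ≤ K / (1 + x) ^ (N + 1) := hgK x ζ hx0'.le (abs_le_of_mem_Icc hζ)
        _ = K / (1 + x) / (1 + x) ^ N := by rw [pow_succ']; field_simp
        _ ≤ K / (n + 1) / (1 + x) ^ N :=
            div_le_div_of_nonneg_right
              (div_le_div_of_nonneg_left hK hn (by linarith)) (by positivity)
        _ ≤ _ := by gcongr; have : 0 ≤ L * 2 ^ N := by positivity
                    linarith
  have hunif : TendstoUniformlyOn
      (fun (n : ℕ) ζ => ∫ x in Icc (1 / (n + 1 : ℝ)) (n + 1), V (x, ζ) * g (x, ζ))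
      (fun ζ => ∫ x in Ioi (0 : ℝ), V (x, ζ) * g (x, ζ)) atTop (Icc a z) := by
    rw [Metric.tendstoUniformlyOn_iff]
    intro ε hε
    have hlim : Tendsto (fun n : ℕ => (K + L * 2 ^ N) * C / ((n : ℝ) + 1)) atTop (𝓝 0) :=
      tendsto_const_nhds.div_atTop (tendsto_natCast_atTop_atTop.atTop_add tendsto_const_nhds)
    filter_upwards [hlim.eventually (gt_mem_nhds hε)] with n hn ζ hζ
    refine lt_of_le_of_lt ?_ hn
    rw [dist_eq_norm, ← setIntegral_sdiff measurableSet_Icc (hV.integrableOn_slice hg hζ.2)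
      (hIcc n)]
    have h1 := (enorm_integral_le_lintegral_enorm _).trans
      (lintegral_mul_le (V := V) (measurableSet_Ioi.diff measurableSet_Icc) sdiff_subset (hC ζ hζ)
        (by positivity) (hoff n ζ hζ))
    rw [← ofReal_norm, ENNReal.ofReal_le_ofReal_iff (by positivity)] at h1
    refine h1.trans_eq (by ring)
  refine hunif.continuousOn (Eventually.of_forall fun n => ?_).frequently
  have hcont : ContinuousOn (fun p => V p * g p) (Icc (1 / (n + 1 : ℝ)) (n + 1) ×ˢ Icc a z) :=
    (hV.continuousOn.mono fun p hp => ⟨hIcc n hp.1, hp.2.2⟩).mul hg.continuous.continuousOn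
  obtain ⟨B, hB⟩ := (isCompact_Icc.prod isCompact_Icc).exists_bound_of_continuousOn hcont
  intro ζ₀ hζ₀
  refine continuousWithinAt_of_dominated (bound := fun _ => B) ?_ ?_ ?_ ?_
  · filter_upwards [self_mem_nhdsWithin] with ζ hζ
    exact (hcont.comp (by fun_prop : ContinuousOn (fun x : ℝ => (x, ζ)) _) fun x hx =>
      ⟨hx, hζ⟩).aestronglyMeasurable measurableSet_Icc
  · filter_upwards [self_mem_nhdsWithin] with ζ hζ
    exact (ae_restrict_iff' measurableSet_Icc).2 (ae_of_all _ fun x hx => hB (x, ζ) ⟨hx, hζ⟩)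
  · exact integrableOn_const (by simp)
  · refine (ae_restrict_iff' measurableSet_Icc).2 (ae_of_all _ fun x hx => ?_)
    exact (hcont.comp (by fun_prop : ContinuousOn (fun ζ : ℝ => (x, ζ)) _) fun ζ hζ =>
      ⟨hx, hζ⟩) ζ₀ hζ₀

/-- Limits of weighted integrals along lines parallel to the boundary. -/
lemma tendsto_integral_trace (hV : IsHalfPlaneField k z V v₀) {a : ℝ} (ha : a < z)
    {f : ℝ → ℝ → ℂ} {f₀ : ℝ → ℂ} {C : ℝ} (hf : ∀ y, 0 < y → Continuous (f y)) (hf₀ : Continuous f₀)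
    (hC : ∀ y, 0 < y → ∀ ζ ∈ Ioc a z, ‖f y ζ‖ ≤ C)
    (hL : ∀ y, 0 < y → ∀ ζ ∈ Ioc a z, ‖f y ζ - f₀ ζ‖ ≤ C * y) :
    Tendsto (fun y => ∫ ζ in Ioc a z, V (y, ζ) * f y ζ) (𝓝[>] 0)
      (𝓝 (∫ ζ in Ioc a z, v₀ ζ * f₀ ζ)) := by
  have hv₀ := hV.data_integrableOn_Ioc a
  have hVi : ∀ y, 0 < y → IntegrableOn (fun ζ => V (y, ζ)) (Ioc a z) := fun y hy =>
    (((hV.continuousOn_slice' hy).mono Icc_subset_Iic_self).integrableOn_compact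
      isCompact_Icc).mono_set Ioc_subset_Icc_self
  have htr : Tendsto (fun y => ∫ ζ in Ioc a z, ‖V (y, ζ) - v₀ ζ‖) (𝓝[>] 0) (𝓝 0) := by
    have h1 := (ENNReal.tendsto_toReal ENNReal.zero_ne_top).comp (hV.trace a ha)
    refine (h1.congr' ?_).trans (by simp)
    filter_upwards [self_mem_nhdsWithin] with y hy
    rw [Function.comp, ← integral_norm_eq_lintegral_enorm, integral_Ioc_eq_integral_Ioo]
    exact (((hVi y hy).sub hv₀).mono_set Ioo_subset_Ioc_self).1
  rw [tendsto_iff_norm_sub_tendsto_zero]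
  have hbound : Tendsto (fun y => C * (∫ ζ in Ioc a z, ‖V (y, ζ) - v₀ ζ‖)
      + C * y * ∫ ζ in Ioc a z, ‖v₀ ζ‖) (𝓝[>] 0) (𝓝 0) := by
    have hy : Tendsto (fun y : ℝ => y) (𝓝[>] 0) (𝓝 0) := nhdsWithin_le_nhds
    simpa using (htr.const_mul C).add ((hy.const_mul C).mul_const (∫ ζ in Ioc a z, ‖v₀ ζ‖))
  refine squeeze_zero' (Eventually.of_forall fun _ => norm_nonneg _) ?_ hbound
  filter_upwards [self_mem_nhdsWithin] with y hy
  have hy0 : 0 < y := hy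
  have i1 : IntegrableOn (fun ζ => (V (y, ζ) - v₀ ζ) * f y ζ) (Ioc a z) :=
    Integrable.mul_bdd (c := C) ((hVi y hy).sub hv₀) (hf y hy).aestronglyMeasurable
      ((ae_restrict_iff' measurableSet_Ioc).2 (ae_of_all _ (hC y hy)))
  have i2 : IntegrableOn (fun ζ => v₀ ζ * (f y ζ - f₀ ζ)) (Ioc a z) :=
    Integrable.mul_bdd (c := C * y) hv₀ ((hf y hy).sub hf₀).aestronglyMeasurable
      ((ae_restrict_iff' measurableSet_Ioc).2 (ae_of_all _ (hL y hy)))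
  have i3 : IntegrableOn (fun ζ => V (y, ζ) * f y ζ) (Ioc a z) :=
    Integrable.mul_bdd (c := C) (hVi y hy) (hf y hy).aestronglyMeasurable
      ((ae_restrict_iff' measurableSet_Ioc).2 (ae_of_all _ (hC y hy)))
  have i4 : IntegrableOn (fun ζ => v₀ ζ * f₀ ζ) (Ioc a z) := by
    refine ((i3.sub i1).sub i2).congr (ae_of_all _ fun ζ => ?_)
    simp only [Pi.sub_apply]; ring
  rw [← integral_sub i3 i4]
  -- The first term is small by the `L¹` trace, the second because `f y` is within `C y` of `f₀`.
  have e : (fun ζ => V (y, ζ) * f y ζ - v₀ ζ * f₀ ζ)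
      = fun ζ => (V (y, ζ) - v₀ ζ) * f y ζ + v₀ ζ * (f y ζ - f₀ ζ) := by ext ζ; ring
  rw [e, integral_add i1 i2]
  refine (norm_add_le _ _).trans (add_le_add ?_ ?_)
  · rw [← integral_const_mul]
    refine norm_integral_le_of_norm_le (((hVi y hy).sub hv₀).norm.const_mul C)
      ((ae_restrict_iff' measurableSet_Ioc).2 (ae_of_all _ fun ζ hζ => ?_))
    rw [norm_mul, mul_comm]
    exact mul_le_mul_of_nonneg_right (hC y hy ζ hζ) (norm_nonneg _)
  · rw [← integral_const_mul]
    refine norm_integral_le_of_norm_le (hv₀.norm.const_mul (C * y))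
      ((ae_restrict_iff' measurableSet_Ioc).2 (ae_of_all _ fun ζ hζ => ?_))
    rw [norm_mul, mul_comm]
    exact mul_le_mul_of_nonneg_right (hL y hy ζ hζ) (norm_nonneg _)

end IsHalfPlaneField

end HalfPlane

/-! ### Green's identity for the field and a solution of the adjoint equation. -/

section Green

/-- A smooth solution `W` of the adjoint equation, with its `x`-derivatives `W₁`, `W₂` and its
`ζ`-derivative `Wt`, which decays rapidly and vanishes at `x = 0`. -/
structure IsTestSolution (k : ℝ) (W W₁ W₂ Wt : ℝ × ℝ → ℂ) : Prop where
  contDiff : ContDiff ℝ ∞ W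
  deriv_fst : ∀ x ζ, HasDerivAt (fun x => W (x, ζ)) (W₁ (x, ζ)) x
  deriv_fst₂ : ∀ x ζ, HasDerivAt (fun x => W₁ (x, ζ)) (W₂ (x, ζ)) x
  deriv_snd : ∀ x ζ, HasDerivAt (fun ζ => W (x, ζ)) (Wt (x, ζ)) ζ
  equation : ∀ p, -(2 * Complex.I * k) * Wt p + W₂ p = 0
  decay : RapidDecay W
  decay₁ : RapidDecay W₁
  zero : ∀ ζ, W (0, ζ) = 0
  bound : ∃ L, ∀ p, ‖W₁ p‖ ≤ L ∧ ‖W₂ p‖ ≤ L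

variable {k z : ℝ} {V : ℝ × ℝ → ℂ} {v₀ : ℝ → ℂ} {W W₁ W₂ Wt : ℝ × ℝ → ℂ}

namespace IsTestSolution

lemma norm_le (hW : IsTestSolution k W W₁ W₂ Wt) {L : ℝ} (hL : ∀ p, ‖W₁ p‖ ≤ L ∧ ‖W₂ p‖ ≤ L)
    (x ζ : ℝ) : ‖W (x, ζ)‖ ≤ L * |x| := by
  have := Convex.norm_image_sub_le_of_norm_hasDerivWithin_le (s := univ)
    (f := fun x => W (x, ζ)) (fun x _ => (hW.deriv_fst x ζ).hasDerivWithinAt)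
    (fun x _ => (hL (x, ζ)).1) convex_univ (mem_univ 0) (mem_univ x)
  simpa [hW.zero] using this

lemma norm_sub_le (hW : IsTestSolution k W W₁ W₂ Wt) {L : ℝ}
    (hL : ∀ p, ‖W₁ p‖ ≤ L ∧ ‖W₂ p‖ ≤ L) (x ζ : ℝ) : ‖W₁ (x, ζ) - W₁ (0, ζ)‖ ≤ L * |x| := by
  have := Convex.norm_image_sub_le_of_norm_hasDerivWithin_le (s := univ)
    (f := fun x => W₁ (x, ζ)) (fun x _ => (hW.deriv_fst₂ x ζ).hasDerivWithinAt)
    (fun x _ => (hL (x, ζ)).2) convex_univ (mem_univ 0) (mem_univ x)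
  simpa using this

/-- `W (y, ζ) - y W₁ (0, ζ)` vanishes at `y = 0` and has derivative at most `L x` on `[0, x]`; apply
the mean value inequality and divide by `x`. -/
lemma norm_div_sub_le (hW : IsTestSolution k W W₁ W₂ Wt) {L : ℝ}
    (hL : ∀ p, ‖W₁ p‖ ≤ L ∧ ‖W₂ p‖ ≤ L) {x : ℝ} (hx : 0 < x) (ζ : ℝ) :
    ‖W (x, ζ) / x - W₁ (0, ζ)‖ ≤ L * x := by
  have hd : ∀ y, HasDerivAt (fun y : ℝ => W (y, ζ) - y * W₁ (0, ζ)) (W₁ (y, ζ) - W₁ (0, ζ)) y :=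
    fun y => by
      simpa using! (hW.deriv_fst y ζ).sub
        ((Complex.ofRealCLM.hasDerivAt (x := y)).mul_const (W₁ (0, ζ)))
  have := Convex.norm_image_sub_le_of_norm_hasDerivWithin_le (s := Icc 0 x) (C := L * x)
    (fun y _ => (hd y).hasDerivWithinAt) (fun y hy => ?_) (convex_Icc 0 x)
    (left_mem_Icc.2 hx.le) (right_mem_Icc.2 hx.le)
  · have hx0 : (x : ℂ) ≠ 0 := by exact_mod_cast hx.ne'
    have e : W (x, ζ) / x - W₁ (0, ζ) = (W (x, ζ) - x * W₁ (0, ζ)) / x := by field_simp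
    rw [e, norm_div, Complex.norm_real, Real.norm_of_nonneg hx.le, div_le_iff₀ hx]
    simpa [hW.zero, abs_of_pos hx] using this
  · refine (hW.norm_sub_le hL y ζ).trans ?_
    have hL0 : 0 ≤ L := (norm_nonneg _).trans (hL (0, 0)).1
    rw [abs_of_nonneg hy.1]
    exact mul_le_mul_of_nonneg_left hy.2 hL0

end IsTestSolution

namespace IsHalfPlaneField

/-- The weak equation is tested with `χ(ζ) η(x) W`. In the product rule the terms carrying `χ η`
without derivatives cancel by the adjoint equation for `W`, leaving only terms where a cutoff is
differentiated. -/
lemma integral_test_eq_zero (hV : IsHalfPlaneField k z V v₀) (hW : IsTestSolution k W W₁ W₂ Wt)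
    {χ χ₁ η η₁ η₂ : ℝ → ℝ} (hχ : ContDiff ℝ ∞ χ) (hχc : HasCompactSupport χ)
    (hχs : tsupport χ ⊆ Iio z) (hχ₁ : ∀ ζ, HasDerivAt χ (χ₁ ζ) ζ)
    (hη : ContDiff ℝ ∞ η) (hηc : HasCompactSupport η) (hηs : tsupport η ⊆ Ioi 0)
    (hη₁ : ∀ y, HasDerivAt η (η₁ y) y) (hη₂ : ∀ y, HasDerivAt η₁ (η₂ y) y) :
    ∫ p : ℝ × ℝ, (η₂ p.1 * (χ p.2 * (V p * W p)) + 2 * η₁ p.1 * (χ p.2 * (V p * W₁ p))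
      + η p.1 * (-(2 * Complex.I * k) * (χ₁ p.2 * (V p * W p)))) = 0 := by
  let φ : ℝ × ℝ → ℂ := fun p => (χ p.2 * η p.1 : ℝ) • W p
  have hsub : tsupport φ ⊆ tsupport η ×ˢ tsupport χ := by
    refine closure_minimal (fun p hp => ?_) ((isClosed_tsupport η).prod (isClosed_tsupport χ))
    have h1 := left_ne_zero_of_smul hp
    exact ⟨subset_tsupport _ (right_ne_zero_of_mul h1), subset_tsupport _ (left_ne_zero_of_mul h1)⟩
  have h := hV.equation φ
    (((hχ.comp contDiff_snd).mul (hη.comp contDiff_fst)).smul hW.contDiff)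
    ((hηc.isCompact.prod hχc.isCompact).of_isClosed_subset (isClosed_tsupport _) hsub)
    (hsub.trans fun p hp => ⟨hηs hp.1, hχs hp.2⟩)
  rw [← h]
  refine integral_congr_ae (ae_of_all _ fun p => ?_)
  have cast : ∀ {f : ℝ → ℝ} {f' x : ℝ}, HasDerivAt f f' x →
      HasDerivAt (fun x => (f x : ℂ)) (f' : ℂ) x := fun h => h.ofReal_comp
  have d1 : HasDerivAt (fun ζ => φ (p.1, ζ))
      (χ₁ p.2 * η p.1 * W p + χ p.2 * η p.1 * Wt p) p.2 := by
    simpa [φ] using! ((cast (hχ₁ p.2)).mul_const (η p.1 : ℂ)).mul (hW.deriv_snd p.1 p.2)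
  have d2 : ∀ x, HasDerivAt (fun x => φ (x, p.2))
      (χ p.2 * (η₁ x * W (x, p.2) + η x * W₁ (x, p.2))) x := fun x => by
    have := ((cast (hη₁ x)).mul (hW.deriv_fst x p.2)).const_mul (χ p.2 : ℂ)
    simpa [φ, mul_assoc] using! this
  have d3 : HasDerivAt (fun x : ℝ => (χ p.2 : ℂ) * (η₁ x * W (x, p.2) + η x * W₁ (x, p.2)))
      (χ p.2 * (η₂ p.1 * W p + η₁ p.1 * W₁ p + (η₁ p.1 * W₁ p + η p.1 * W₂ p))) p.1 :=
    (((cast (hη₂ p.1)).mul (hW.deriv_fst p.1 p.2)).add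
      ((cast (hη₁ p.1)).mul (hW.deriv_fst₂ p.1 p.2))).const_mul _
  have e2 : iteratedDeriv 2 (fun x => φ (x, p.2)) p.1
      = χ p.2 * (η₂ p.1 * W p + η₁ p.1 * W₁ p + (η₁ p.1 * W₁ p + η p.1 * W₂ p)) := by
    rw [iteratedDeriv_succ, iteratedDeriv_one, funext fun x => (d2 x).deriv]
    exact d3.deriv
  simp only
  rw [d1.deriv, e2]
  linear_combination (-(V p * χ p.2 * η p.1)) * hW.equation p

/-- The weak form of `2ik dF/dζ = -v₀ W₁(0, ζ)` for the overlap `F` of the field with a test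
solution. -/
lemma integral_deriv_mul_overlap (hV : IsHalfPlaneField k z V v₀)
    (hW : IsTestSolution k W W₁ W₂ Wt) {a : ℝ} (ha : a < z)
    {χ χ₁ : ℝ → ℝ} (hχ : ContDiff ℝ ∞ χ) (hχs : tsupport χ ⊆ Ioo a z)
    (hχ₁ : ∀ ζ, HasDerivAt χ (χ₁ ζ) ζ) (hχ₁c : Continuous χ₁) :
    ∫ ζ in Ioc a z, 2 * Complex.I * k * (χ₁ ζ * ∫ x in Ioi (0 : ℝ), V (x, ζ) * W (x, ζ))
      = ∫ ζ in Ioc a z, v₀ ζ * (χ ζ * W₁ (0, ζ)) := by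
  obtain ⟨L, hL⟩ := hW.bound
  have hL0 : 0 ≤ L := (norm_nonneg _).trans (hL (0, 0)).1
  have hχc : HasCompactSupport χ :=
    isCompact_Icc.of_isClosed_subset (isClosed_tsupport _) (hχs.trans Ioo_subset_Icc_self)
  have hχ₁s : ∀ ζ, ζ ∉ Ioo a z → χ₁ ζ = 0 := fun ζ hζ => by
    have hn : χ =ᶠ[𝓝 ζ] fun _ => 0 := by
      have := (isClosed_tsupport χ).isOpen_compl.mem_nhds (fun h => hζ (hχs h))
      filter_upwards [this] with t ht using image_eq_zero_of_notMem_tsupport ht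
    rw [← (hχ₁ ζ).deriv, hn.deriv_eq, deriv_const]
  have hχ0 : ∀ ζ, ζ ∉ Ioo a z → χ ζ = 0 := fun ζ hζ =>
    image_eq_zero_of_notMem_tsupport fun h => hζ (hχs h)
  have hχ₁cs : HasCompactSupport χ₁ := HasCompactSupport.of_support_subset_isCompact
    (K := Icc a z) isCompact_Icc fun ζ h => by
      by_contra hc
      exact h (hχ₁s ζ fun h' => hc (Ioo_subset_Icc_self h'))
  obtain ⟨B, hB⟩ := hχc.exists_bound_of_continuous hχ.continuous
  obtain ⟨B₁, hB₁⟩ := hχ₁cs.exists_bound_of_continuous hχ₁c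
  have hB0 : 0 ≤ B := (norm_nonneg _).trans (hB 0)
  set ν := (volume.restrict (Ioi (0 : ℝ))).prod (volume.restrict (Ioc a z)) with hν
  have hχcont := hχ.continuous
  have I0 : Integrable (fun p : ℝ × ℝ => (χ p.2 : ℂ) * (V p * W p)) ν :=
    (hV.integrable_strip hW.decay ha).bdd_mul (c := B)
      (Continuous.aestronglyMeasurable (by fun_prop)) (ae_of_all _ fun p => by simpa using hB p.2)
  have I1 : Integrable (fun p : ℝ × ℝ => (χ p.2 : ℂ) * (V p * W₁ p)) ν :=
    (hV.integrable_strip hW.decay₁ ha).bdd_mul (c := B)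
      (Continuous.aestronglyMeasurable (by fun_prop)) (ae_of_all _ fun p => by simpa using hB p.2)
  have I2 : Integrable (fun p : ℝ × ℝ =>
      -(2 * Complex.I * k) * ((χ₁ p.2 : ℂ) * (V p * W p))) ν :=
    ((hV.integrable_strip hW.decay ha).bdd_mul (c := B₁)
      (Continuous.aestronglyMeasurable (by fun_prop))
      (ae_of_all _ fun p => by simpa using hB₁ p.2)).const_mul _
  -- Averaging over `ζ` with weight `χ` reduces the matter to one variable. Since `W` vanishes on
  -- the line with slope `W₁ (0, ζ)`, both `M y / y` and `M₁ y` tend to the same boundary integral.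
  have key := integral_eq_neg_of_cutoff
    (M := fun y => ∫ ζ in Ioc a z, (χ ζ : ℂ) * (V (y, ζ) * W (y, ζ)))
    (M₁ := fun y => ∫ ζ in Ioc a z, (χ ζ : ℂ) * (V (y, ζ) * W₁ (y, ζ)))
    (M₂ := fun y => ∫ ζ in Ioc a z, -(2 * Complex.I * k) * ((χ₁ ζ : ℂ) * (V (y, ζ) * W (y, ζ))))
    (A := ∫ ζ in Ioc a z, v₀ ζ * (χ ζ * W₁ (0, ζ)))
    I0.integral_prod_left I1.integral_prod_left I2.integral_prod_left ?_ ?_ ?_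
  · rw [integral_integral_swap (f := fun y ζ =>
      -(2 * Complex.I * k) * ((χ₁ ζ : ℂ) * (V (y, ζ) * W (y, ζ)))) I2] at key
    rw [← neg_inj, ← key, ← integral_neg]
    refine integral_congr_ae (ae_of_all _ fun ζ => ?_)
    simp only
    rw [integral_const_mul, integral_const_mul]
    ring
  · intro η η₁ η₂ hη hηc hηs hη₁ hη₂
    have h := hV.integral_test_eq_zero hW hχ hχc (hχs.trans fun ζ h => h.2) hχ₁ hη hηc hηs hη₁ hη₂
    have hη₁c : Continuous η₁ := continuous_iff_continuousAt.2 fun y => (hη₂ y).continuousAt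
    have hη0 : ∀ y, y ∉ Ioi (0 : ℝ) → η y = 0 ∧ η₁ y = 0 ∧ η₂ y = 0 := by
      intro y hy
      have hn : η =ᶠ[𝓝 y] fun _ => 0 := by
        have := (isClosed_tsupport η).isOpen_compl.mem_nhds (fun h => hy (hηs h))
        filter_upwards [this] with t ht using image_eq_zero_of_notMem_tsupport ht
      have e1 : η₁ = deriv η := funext fun y => (hη₁ y).deriv.symm
      have e2 : η₂ = deriv η₁ := funext fun y => (hη₂ y).deriv.symm
      refine ⟨hn.eq_of_nhds, ?_, ?_⟩
      · rw [e1, hn.deriv_eq, deriv_const]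
      · rw [e2, e1, hn.deriv.deriv_eq]
        simp
    have e1 : η₁ = deriv η := funext fun y => (hη₁ y).deriv.symm
    have e2 : η₂ = deriv (deriv η) := by rw [← e1]; exact funext fun y => (hη₂ y).deriv.symm
    have hη₂c : Continuous η₂ := by
      rw [e2]
      exact (contDiff_infty_iff_deriv.1 (contDiff_infty_iff_deriv.1 hη).2).2.continuous
    obtain ⟨b0, hb0⟩ := hηc.exists_bound_of_continuous hη.continuous
    obtain ⟨b1, hb1⟩ := (e1 ▸ hηc.deriv : HasCompactSupport η₁).exists_bound_of_continuous hη₁c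
    obtain ⟨b2, hb2⟩ :=
      (e2 ▸ hηc.deriv.deriv : HasCompactSupport η₂).exists_bound_of_continuous hη₂c
    have hηcont := hη.continuous
    have hint : Integrable (fun p : ℝ × ℝ =>
        (η₂ p.1 * (χ p.2 * (V p * W p)) + 2 * η₁ p.1 * (χ p.2 * (V p * W₁ p))
        + η p.1 * (-(2 * Complex.I * k) * (χ₁ p.2 * (V p * W p))))) ν := by
      refine ((I0.bdd_mul (c := b2) (Continuous.aestronglyMeasurable (by fun_prop))
        (ae_of_all _ fun p => by simpa using hb2 p.1)).add
        (I1.bdd_mul (c := 2 * b1) (Continuous.aestronglyMeasurable (by fun_prop))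
        (ae_of_all _ fun p => by simpa using hb1 p.1))).add
        (I2.bdd_mul (c := b0) (Continuous.aestronglyMeasurable (by fun_prop))
        (ae_of_all _ fun p => by simpa using hb0 p.1))
    -- All cutoffs and their derivatives vanish outside the strip, where Fubini's theorem is
    -- available.
    rw [← setIntegral_eq_integral_of_forall_compl_eq_zero (s := Ioi (0 : ℝ) ×ˢ Ioc a z),
      Measure.volume_eq_prod, ← Measure.prod_restrict, integral_prod _ hint] at h
    · rw [← h]
      refine integral_congr_ae ?_
      filter_upwards [I0.prod_right_ae, I1.prod_right_ae, I2.prod_right_ae] with y j0 j1 j2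
      rw [integral_add (by exact (j0.const_mul _).add (j1.const_mul _)) (j2.const_mul _),
        integral_add (j0.const_mul _) (j1.const_mul _)]
      simp only [integral_const_mul]
    · intro p hp
      by_cases h1 : p.1 ∈ Ioi (0 : ℝ)
      · have h2 : p.2 ∉ Ioo a z := fun h2 => hp ⟨h1, Ioo_subset_Ioc_self h2⟩
        rw [hχ0 _ h2, hχ₁s _ h2]; simp
      · rw [(hη0 _ h1).1, (hη0 _ h1).2.1, (hη0 _ h1).2.2]; simp
  · have hlim := hV.tendsto_integral_trace ha (f := fun y ζ => χ ζ * (W (y, ζ) / y))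
      (f₀ := fun ζ => χ ζ * W₁ (0, ζ)) (C := B * L) ?_ ?_ ?_ ?_
    · refine hlim.congr' ?_
      filter_upwards [self_mem_nhdsWithin] with y hy
      rw [← integral_div]
      refine integral_congr_ae (ae_of_all _ fun ζ => ?_)
      simp only; ring
    · intro y hy
      have := hW.decay.continuous
      fun_prop
    · have := hW.decay₁.continuous
      fun_prop
    · intro y hy ζ _
      rw [norm_mul, Complex.norm_real, norm_div, Complex.norm_real, Real.norm_of_nonneg hy.le]
      refine mul_le_mul (hB ζ) ?_ (by positivity) hB0
      rw [div_le_iff₀ hy]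
      simpa [abs_of_pos hy] using hW.norm_le hL y ζ
    · intro y hy ζ _
      rw [← mul_sub, norm_mul, Complex.norm_real, mul_assoc]
      exact mul_le_mul (hB ζ) (hW.norm_div_sub_le hL hy ζ) (norm_nonneg _) hB0
  · have hlim := hV.tendsto_integral_trace ha (f := fun y ζ => χ ζ * W₁ (y, ζ))
      (f₀ := fun ζ => χ ζ * W₁ (0, ζ)) (C := B * L) ?_ ?_ ?_ ?_
    · refine hlim.congr fun y => integral_congr_ae (ae_of_all _ fun ζ => ?_)
      simp only; ring
    · intro y hy
      have := hW.decay₁.continuous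
      fun_prop
    · have := hW.decay₁.continuous
      fun_prop
    · intro y hy ζ _
      rw [norm_mul, Complex.norm_real]
      exact mul_le_mul (hB ζ) (hL _).1 (norm_nonneg _) hB0
    · intro y hy ζ _
      rw [← mul_sub, norm_mul, Complex.norm_real, mul_assoc]
      refine mul_le_mul (hB ζ) ?_ (norm_nonneg _) hB0
      simpa [abs_of_pos hy] using hW.norm_sub_le hL y ζ

end IsHalfPlaneField

end Green

/-! ### Integrating Green's identity in `ζ`: reciprocity. -/

section Overlap

variable {k z : ℝ} {V : ℝ × ℝ → ℂ} {v₀ : ℝ → ℂ} {W W₁ W₂ Wt : ℝ × ℝ → ℂ}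

/-- The kernel is an approximate delta function concentrated just to the right of `c`; translation
by `c` reduces it to `tendsto_integral_concentrate`. -/
lemma tendsto_integral_transDeriv_mul {F : ℝ → ℂ} {a z c : ℝ} (hF : ContinuousOn F (Icc a z))
    (hc : c ∈ Ioo a z) :
    Tendsto (fun n : ℕ => ∫ ζ in Ioc a z,
      (((n + 1) * transDeriv ((n + 1) * (ζ - c)) : ℝ) : ℂ) * F ζ) atTop (𝓝 (F c)) := by
  have hFm : AEStronglyMeasurable ((Ioc a z).indicator F) volume :=
    (aestronglyMeasurable_indicator_iff measurableSet_Ioc).2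
      ((hF.mono Ioc_subset_Icc_self).aestronglyMeasurable measurableSet_Ioc)
  have hFt : Tendsto (fun y => (Ioc a z).indicator F (y + c)) (𝓝[>] 0) (𝓝 (F c)) := by
    have h1 : Tendsto F (𝓝 c) (𝓝 (F c)) := hF.continuousAt (Icc_mem_nhds hc.1 hc.2)
    have h2 : Tendsto (fun y : ℝ => y + c) (𝓝[>] 0) (𝓝 c) := by
      have : Tendsto (fun y : ℝ => y + c) (𝓝 0) (𝓝 (0 + c)) :=
        (continuous_id.add continuous_const).tendsto 0
      rw [zero_add] at this
      exact this.mono_left nhdsWithin_le_nhds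
    refine (h1.comp h2).congr' ?_
    filter_upwards [h2 (Ioc_mem_nhds hc.1 hc.2)] with y hy
    exact (indicator_of_mem (show y + c ∈ Ioc a z from hy) F).symm
  have h := tendsto_integral_concentrate (κ := fun t => (transDeriv t : ℂ)) (by fun_prop)
    (fun t ht => ?_)
    (hFm.comp_quasiMeasurePreserving
      (measurePreserving_add_right volume c).quasiMeasurePreserving).restrict hFt
  · rw [integral_complex_ofReal, integral_transDeriv, Complex.ofReal_one, one_mul] at h
    refine h.congr fun n => ?_
    rw [← integral_Ici_eq_integral_Ioi, setIntegral_eq_integral_of_forall_compl_eq_zero]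
    · conv_rhs => rw [← integral_indicator measurableSet_Ioc, ← integral_add_right_eq_self _ c]
      refine integral_congr_ae (ae_of_all _ fun y => ?_)
      simp only [Function.comp]
      by_cases hy : y + c ∈ Ioc a z
      · rw [indicator_of_mem hy, indicator_of_mem hy]
        push_cast
        simp
      · rw [indicator_of_notMem hy, indicator_of_notMem hy, mul_zero]
    · intro y hy
      have : ((n : ℝ) + 1) * y < 0 := mul_neg_of_pos_of_neg (by positivity) (not_le.1 hy)
      rw [transDeriv_of_neg this]
      simp
  · have := transDeriv_mem (Complex.ofReal_ne_zero.1 ht)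
    constructor <;> linarith [this.1, this.2]

namespace IsHalfPlaneField

/-- Let `χ` in `integral_deriv_mul_overlap` tend to the indicator of `(c₁, c₂]`; its derivative then
tends to the difference of the delta functions at `c₁` and `c₂`. The overlap is continuous, so it
may be evaluated at these points. -/
lemma overlap_sub (hV : IsHalfPlaneField k z V v₀) (hW : IsTestSolution k W W₁ W₂ Wt)
    {c₁ c₂ : ℝ} (h₁₂ : c₁ < c₂) (h₂ : c₂ < z) :
    2 * Complex.I * k * ((∫ x in Ioi (0 : ℝ), V (x, c₁) * W (x, c₁))
        - ∫ x in Ioi (0 : ℝ), V (x, c₂) * W (x, c₂))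
      = ∫ ζ in Ioc c₁ c₂, v₀ ζ * W₁ (0, ζ) := by
  set a := c₁ - 1 with ha
  have haz : a < z := by linarith
  obtain ⟨L, hL⟩ := hW.bound
  set F : ℝ → ℂ := fun ζ => ∫ x in Ioi (0 : ℝ), V (x, ζ) * W (x, ζ) with hF
  have hFc : ContinuousOn F (Icc a z) := hV.continuousOn_overlap hW.decay (hW.norm_le hL) haz
  have hFi : IntegrableOn F (Ioc a z) :=
    (hFc.integrableOn_compact isCompact_Icc).mono_set Ioc_subset_Icc_self
  let χ : ℕ → ℝ → ℝ := fun n ζ => Real.smoothTransition ((n + 1) * (ζ - c₁))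
    - Real.smoothTransition ((n + 1) * (ζ - c₂))
  let χ₁ : ℕ → ℝ → ℝ := fun n ζ => (n + 1) * transDeriv ((n + 1) * (ζ - c₁))
    - (n + 1) * transDeriv ((n + 1) * (ζ - c₂))
  have hlin : ∀ (n : ℕ) c y, HasDerivAt (fun y : ℝ => (n + 1 : ℝ) * (y - c)) (n + 1) y :=
    fun n c y => by simpa using ((hasDerivAt_id y).sub_const c).const_mul (n + 1 : ℝ)
  have hχ₁ : ∀ n y, HasDerivAt (χ n) (χ₁ n y) y := fun n y =>
    (((hasDerivAt_smoothTransition _).comp y (hlin n c₁ y)).sub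
      ((hasDerivAt_smoothTransition _).comp y (hlin n c₂ y))).congr_deriv
        (by simp only [χ₁]; ring)
  -- The transition at `c₂` ends at `c₂ + 1/(n+1)`, which must lie below `z` for the test function
  -- to be admissible.
  have hsmall : ∀ᶠ n : ℕ in atTop, c₂ + 1 / ((n : ℝ) + 1) < z := by
    have : Tendsto (fun n : ℕ => c₂ + 1 / ((n : ℝ) + 1)) atTop (𝓝 (c₂ + 0)) :=
      tendsto_const_nhds.add tendsto_one_div_add_atTop_nhds_zero_nat
    exact this.eventually (gt_mem_nhds (by linarith))
  have hid : ∀ᶠ n : ℕ in atTop,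
      ∫ ζ in Ioc a z, 2 * Complex.I * k * (χ₁ n ζ * F ζ)
        = ∫ ζ in Ioc a z, v₀ ζ * (χ n ζ * W₁ (0, ζ)) := by
    filter_upwards [hsmall] with n hn
    refine hV.integral_deriv_mul_overlap hW haz ?_ ?_ (hχ₁ n) (by simp only [χ₁]; fun_prop)
    · exact (Real.smoothTransition.contDiff.comp (by fun_prop)).sub
        (Real.smoothTransition.contDiff.comp (by fun_prop))
    · have : Function.support (χ n) ⊆ Icc c₁ (c₂ + 1 / (n + 1)) := by
        intro ζ hζ
        have hn0 : (0 : ℝ) < n + 1 := by positivity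
        refine ⟨?_, ?_⟩
        · by_contra hc
          have hc' := not_le.1 hc
          refine hζ ?_
          simp only [χ]
          rw [Real.smoothTransition.zero_of_nonpos, Real.smoothTransition.zero_of_nonpos, sub_zero]
          · exact mul_nonpos_of_nonneg_of_nonpos hn0.le (by linarith)
          · exact mul_nonpos_of_nonneg_of_nonpos hn0.le (by linarith)
        · by_contra hc
          have hc' := not_le.1 hc
          have h2 : 1 ≤ ((n : ℝ) + 1) * (ζ - c₂) := by
            have : 1 / ((n : ℝ) + 1) ≤ ζ - c₂ := by linarith
            rw [div_le_iff₀ hn0] at this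
            linarith
          have h3 : ((n : ℝ) + 1) * (ζ - c₂) ≤ ((n : ℝ) + 1) * (ζ - c₁) := by gcongr
          refine hζ ?_
          simp only [χ]
          rw [Real.smoothTransition.one_of_one_le h2,
            Real.smoothTransition.one_of_one_le (h2.trans h3), sub_self]
      refine (closure_minimal this isClosed_Icc).trans fun ζ hζ => ⟨?_, ?_⟩
      · linarith [hζ.1]
      · linarith [hζ.2]
  have hleft : Tendsto (fun n : ℕ => ∫ ζ in Ioc a z, 2 * Complex.I * k * (χ₁ n ζ * F ζ)) atTop
      (𝓝 (2 * Complex.I * k * (F c₁ - F c₂))) := by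
    have t1 := tendsto_integral_transDeriv_mul hFc (c := c₁) ⟨by linarith, by linarith⟩
    have t2 := tendsto_integral_transDeriv_mul hFc (c := c₂) ⟨by linarith, h₂⟩
    have hi : ∀ (n : ℕ) c, IntegrableOn (fun ζ =>
        (((n + 1) * transDeriv ((n + 1) * (ζ - c)) : ℝ) : ℂ) * F ζ) (Ioc a z) := fun n c => by
      refine IntegrableOn.mono_set (ContinuousOn.integrableOn_compact isCompact_Icc ?_)
        Ioc_subset_Icc_self
      exact ContinuousOn.mul (Continuous.continuousOn (by fun_prop)) hFc
    refine ((t1.sub t2).const_mul (2 * Complex.I * (k : ℂ))).congr fun n => ?_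
    rw [← integral_sub (hi n c₁) (hi n c₂), ← integral_const_mul]
    refine integral_congr_ae (ae_of_all _ fun ζ => ?_)
    simp only [χ₁]
    push_cast
    ring
  have hv := hV.data_integrableOn_Ioc a
  have hW₁c := hW.decay₁.continuous
  have hright : Tendsto (fun n : ℕ => ∫ ζ in Ioc a z, v₀ ζ * (χ n ζ * W₁ (0, ζ))) atTop
      (𝓝 (∫ ζ in Ioc a z, (Ioc c₁ c₂).indicator (fun ζ => v₀ ζ * W₁ (0, ζ)) ζ)) := by
    refine tendsto_integral_of_dominated_convergence (fun ζ => ‖v₀ ζ‖ * L) (fun n => ?_)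
      (hv.norm.mul_const L) (fun n => ae_of_all _ fun ζ => ?_) (ae_of_all _ fun ζ => ?_)
    · refine hv.1.mul (Continuous.aestronglyMeasurable ?_)
      have : Continuous (χ n) := continuous_iff_continuousAt.2 fun y => (hχ₁ n y).continuousAt
      fun_prop
    · rw [norm_mul, norm_mul, Complex.norm_real]
      have hb : ‖χ n ζ‖ ≤ 1 := by
        simp only [χ]
        rw [Real.norm_eq_abs, abs_le]
        constructor <;> linarith [Real.smoothTransition.nonneg (((n : ℝ) + 1) * (ζ - c₁)),
          Real.smoothTransition.nonneg (((n : ℝ) + 1) * (ζ - c₂)),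
          Real.smoothTransition.le_one (((n : ℝ) + 1) * (ζ - c₁)),
          Real.smoothTransition.le_one (((n : ℝ) + 1) * (ζ - c₂))]
      refine mul_le_mul_of_nonneg_left ?_ (norm_nonneg _)
      calc _ ≤ 1 * L := mul_le_mul hb (hL _).1 (norm_nonneg _) zero_le_one
        _ = L := one_mul L
    -- The transition function is `0` at `0`, so the limit is `0` at `ζ = c` itself; hence the
    -- half-open interval.
    · have hst : ∀ c : ℝ, Tendsto (fun n : ℕ => Real.smoothTransition (((n : ℝ) + 1) * (ζ - c)))
          atTop (𝓝 (if c < ζ then 1 else 0)) := by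
        intro c
        refine tendsto_const_nhds.congr' ?_
        split_ifs with hc
        · obtain ⟨N, hN⟩ := exists_nat_gt (1 / (ζ - c))
          filter_upwards [eventually_ge_atTop N] with n hn
          refine (Real.smoothTransition.one_of_one_le ?_).symm
          have h1 : (N : ℝ) ≤ n := by exact_mod_cast hn
          have h0 : 0 < ζ - c := sub_pos.2 hc
          rw [div_lt_iff₀ h0] at hN
          nlinarith
        · filter_upwards with n
          refine (Real.smoothTransition.zero_of_nonpos ?_).symm
          exact mul_nonpos_of_nonneg_of_nonpos (by positivity) (by linarith [not_lt.1 hc])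
      have hχt := (Complex.continuous_ofReal.tendsto _).comp ((hst c₁).sub (hst c₂))
      have := (hχt.mul_const (W₁ (0, ζ))).const_mul (v₀ ζ)
      refine this.trans (le_of_eq ?_)
      congr 1
      by_cases m1 : c₁ < ζ <;> by_cases m2 : c₂ < ζ
      · simp [m1, m2]
      · simp [m1, m2, indicator_of_mem (show ζ ∈ Ioc c₁ c₂ from ⟨m1, not_lt.1 m2⟩)]
      · exact absurd (h₁₂.trans m2) m1
      · simp [m1, m2]
  have := tendsto_nhds_unique hleft (hright.congr' (hid.mono fun n hn => hn.symm))
  rw [this, setIntegral_indicator measurableSet_Ioc]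
  congr 2
  exact inter_eq_right.2 (Ioc_subset_Ioc (by linarith) h₂.le)

/-- `overlap_sub` is taken along an exhaustion of `(-∞, z)`: the upper endpoint is reached by
continuity of the overlap up to `ζ = z`, the lower contribution vanishes by `hrad`. -/
lemma overlap_eq (hV : IsHalfPlaneField k z V v₀) (hW : IsTestSolution k W W₁ W₂ Wt)
    (hint : IntegrableOn (fun ζ => v₀ ζ * W₁ (0, ζ)) (Iio z))
    (hrad : Tendsto (fun ζ => ∫ x in Ioi (0 : ℝ), V (x, ζ) * W (x, ζ)) atBot (𝓝 0)) :
    -(2 * Complex.I * k) * (∫ x in Ioi (0 : ℝ), V (x, z) * W (x, z))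
      = ∫ ζ in Iio z, v₀ ζ * W₁ (0, ζ) := by
  obtain ⟨L, hL⟩ := hW.bound
  set F : ℝ → ℂ := fun ζ => ∫ x in Ioi (0 : ℝ), V (x, ζ) * W (x, ζ) with hF
  have hFc : ContinuousOn F (Icc (z - 1) z) :=
    hV.continuousOn_overlap hW.decay (hW.norm_le hL) (by linarith)
  -- The offset `2` keeps these points in `[z - 1/2, z)` and above the lower endpoints `z - (n + 2)`
  -- for every `n`.
  have e0 : Tendsto (fun n : ℕ => z - 1 / ((n : ℝ) + 2)) atTop (𝓝 z) := by
    have h1 : Tendsto (fun n : ℕ => (n : ℝ) + 2) atTop atTop :=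
      tendsto_natCast_atTop_atTop.atTop_add tendsto_const_nhds
    have : Tendsto (fun n : ℕ => z - 1 / ((n : ℝ) + 2)) atTop (𝓝 (z - 0)) :=
      tendsto_const_nhds.sub (tendsto_const_nhds.div_atTop h1)
    rwa [sub_zero] at this
  have hle : ∀ n : ℕ, 0 < 1 / ((n : ℝ) + 2) ∧ 1 / ((n : ℝ) + 2) ≤ 1 / 2 := fun n =>
    ⟨by positivity, one_div_le_one_div_of_le (by norm_num) (by linarith [n.cast_nonneg (α := ℝ)])⟩
  have t2 : Tendsto (fun n : ℕ => F (z - 1 / ((n : ℝ) + 2))) atTop (𝓝 (F z)) := by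
    refine (hFc z ⟨by linarith, le_rfl⟩).tendsto.comp (tendsto_nhdsWithin_iff.2 ⟨e0, ?_⟩)
    filter_upwards with n
    constructor <;> linarith [(hle n).1, (hle n).2]
  have t1 : Tendsto (fun n : ℕ => F (z - ((n : ℝ) + 2))) atTop (𝓝 0) := by
    refine hrad.comp ?_
    refine tendsto_atBot.2 fun b => ?_
    obtain ⟨N, hN⟩ := exists_nat_ge (z - b)
    filter_upwards [eventually_ge_atTop N] with n hn
    have : (N : ℝ) ≤ n := by exact_mod_cast hn
    linarith
  have hUnion : ⋃ n : ℕ, Ioc (z - ((n : ℝ) + 2)) (z - 1 / ((n : ℝ) + 2)) = Iio z := by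
    ext ζ
    simp only [mem_iUnion, mem_Ioc, mem_Iio]
    constructor
    · rintro ⟨n, _, h⟩
      linarith [(hle n).1]
    · intro h
      obtain ⟨N₁, h1⟩ := exists_nat_ge (z - ζ)
      obtain ⟨N₂, h2⟩ := exists_nat_ge (1 / (z - ζ))
      refine ⟨N₁ + N₂, ?_, ?_⟩
      · push_cast
        linarith [N₂.cast_nonneg (α := ℝ)]
      · have h0 : 0 < z - ζ := sub_pos.2 h
        rw [div_le_iff₀ h0] at h2
        have : 1 / (((N₁ + N₂ : ℕ) : ℝ) + 2) ≤ z - ζ := by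
          rw [div_le_iff₀ (by positivity)]
          push_cast
          nlinarith [N₁.cast_nonneg (α := ℝ), N₂.cast_nonneg (α := ℝ)]
        linarith
  have hmono : Monotone fun n : ℕ => Ioc (z - ((n : ℝ) + 2)) (z - 1 / ((n : ℝ) + 2)) := by
    intro m n hmn
    have : (m : ℝ) ≤ n := by exact_mod_cast hmn
    refine Ioc_subset_Ioc (by linarith) ?_
    have : 1 / ((n : ℝ) + 2) ≤ 1 / ((m : ℝ) + 2) :=
      one_div_le_one_div_of_le (by positivity) (by linarith)
    linarith
  have t3 := tendsto_setIntegral_of_monotone (μ := volume) (f := fun ζ => v₀ ζ * W₁ (0, ζ))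
    (fun n : ℕ => measurableSet_Ioc) hmono (by rw [hUnion]; exact hint)
  rw [hUnion] at t3
  have t4 := (t1.sub t2).const_mul (2 * Complex.I * (k : ℂ))
  have := tendsto_nhds_unique (t4.congr fun n => hV.overlap_sub hW (by
    linarith [(hle n).2, n.cast_nonneg (α := ℝ)]) (by linarith [(hle n).1])) t3
  rw [← this]
  ring

end IsHalfPlaneField

lemma rapidDecay_conj_wavePacket (k : ℝ) (a : SchwartzMap ℝ ℂ) (c : ℂ) :
    RapidDecay fun p => conj (c * wavePacket k a p) where
  continuous := Complex.continuous_conj.comp (continuous_const.mul (continuous_wavePacket a))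
  decay n A := by
    obtain ⟨C, hC, h⟩ := wavePacket_bound (k := k) n A a
    refine ⟨‖c‖ * C, by positivity, fun x ζ hx hζ => ?_⟩
    rw [Complex.norm_conj, norm_mul, mul_div_assoc]
    gcongr
    exact h x ζ hx hζ

/-- Conjugation turns the parabolic equation into its adjoint, and an odd spectrum gives vanishing
at `x = 0`. -/
lemma isTestSolution_conj_wavePacket (hk : k ≠ 0) {a : SchwartzMap ℝ ℂ}
    (ha : ∀ q, a (-q) = -a q) :
    IsTestSolution k (fun p => conj (wavePacket k a p))
      (fun p => conj (Complex.I * wavePacket k (freqMul a) p))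
      (fun p => conj (Complex.I * (Complex.I * wavePacket k (freqMul (freqMul a)) p)))
      (fun p => conj (-(Complex.I / (2 * k)) * wavePacket k (freqMul (freqMul a)) p)) where
  contDiff := Complex.conjCLE.contDiff.comp (contDiff_wavePacket a)
  deriv_fst x ζ := (wavePacket_hasDerivAt_fst a x ζ).star
  deriv_fst₂ x ζ := ((wavePacket_hasDerivAt_fst (freqMul a) x ζ).const_mul Complex.I).star
  deriv_snd x ζ := (wavePacket_hasDerivAt_snd a x ζ).star
  equation p := by
    have : (k : ℂ) ≠ 0 := by exact_mod_cast hk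
    simp only [map_mul, map_neg, map_div₀, Complex.conj_I, Complex.conj_ofReal, map_ofNat]
    field_simp
    ring
  decay := by simpa using rapidDecay_conj_wavePacket k a 1
  decay₁ := rapidDecay_conj_wavePacket k (freqMul a) Complex.I
  zero ζ := by rw [wavePacket_zero_of_odd ha, map_zero]
  bound := by
    refine ⟨max (∫ q, ‖freqMul a q‖) (∫ q, ‖freqMul (freqMul a) q‖), fun p => ⟨?_, ?_⟩⟩
    · simpa using Or.inl (norm_wavePacket_le (k := k) (freqMul a) p)
    · simpa using Or.inr (norm_wavePacket_le (k := k) (freqMul (freqMul a)) p)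

/-- Reciprocity: the overlap of the field at `ζ = z` with a wave packet that vanishes on the line
is an integral over the boundary data. -/
lemma IsHalfPlaneField.overlap_wavePacket (hk : k ≠ 0) (hV : IsHalfPlaneField k z V v₀)
    {a : SchwartzMap ℝ ℂ} (ha : ∀ q, a (-q) = -a q)
    (hint : IntegrableOn (fun ζ => v₀ ζ * conj (Complex.I * wavePacket k (freqMul a) (0, ζ)))
      (Iio z)) :
    -(2 * Complex.I * k) * (∫ x in Ioi (0 : ℝ), V (x, z) * conj (wavePacket k a (x, z)))
      = ∫ ζ in Iio z, v₀ ζ * conj (Complex.I * wavePacket k (freqMul a) (0, ζ)) :=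
  hV.overlap_eq (isTestSolution_conj_wavePacket hk ha) hint (hV.radiation a ha)

end Overlap

/-! ### Wave packets with prescribed values at `ζ = z`; the Fresnel kernel. -/

section Spectrum

open scoped FourierTransform SchwartzMap

lemma hasTemperateGrowth_cexp_mul_I :
    (fun x : ℝ => Complex.exp (x * Complex.I)).HasTemperateGrowth := by
  have hd : ∀ n : ℕ, iteratedDeriv n (fun x : ℝ => Complex.exp (x * Complex.I))
      = fun x : ℝ => Complex.I ^ n * Complex.exp (x * Complex.I) := by
    intro n
    induction n with
    | zero => ext x; simp
    | succ n ih =>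
      rw [iteratedDeriv_succ, ih]
      ext x
      have h := (((Complex.ofRealCLM.hasDerivAt (x := x)).mul_const Complex.I).cexp).const_mul
        (Complex.I ^ n)
      refine h.deriv.trans ?_
      simp only [Complex.ofRealCLM_apply, Complex.ofReal_one]
      ring
  refine ⟨(Complex.ofRealCLM.contDiff.mul contDiff_const).cexp, fun n => ⟨0, 1, fun x => ?_⟩⟩
  rw [norm_iteratedFDeriv_eq_norm_iteratedDeriv, hd]
  simp [Complex.norm_exp_ofReal_mul_I]

lemma hasTemperateGrowth_chirp (c : ℝ) :
    (fun q : ℝ => Complex.exp ((c * q ^ 2 : ℝ) * Complex.I)).HasTemperateGrowth :=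
  hasTemperateGrowth_cexp_mul_I.comp
    (f := fun q : ℝ => c * q ^ 2) (by fun_prop)

/-- Parseval's identity with a chirp, the oscillatory Gaussian integral. -/
lemma integral_fourier_mul_chirp (f : 𝓢(ℝ, ℂ)) {t : ℝ} (ht : 0 < t) :
    ∫ p : ℝ, 𝓕 (f : ℝ → ℂ) p * Complex.exp ((Real.pi * t * p ^ 2 : ℝ) * Complex.I)
      = 1 / (-(Complex.I * t)) ^ (1 / 2 : ℂ)
        * ∫ y : ℝ, f y * Complex.exp (-((Real.pi / t * y ^ 2 : ℝ) * Complex.I)) := by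
  -- The Gaussian with coefficient `-it` is not integrable; adding `1/(n+1)` gives a genuine
  -- Gaussian whose Fourier transform is known, and dominated convergence removes the
  -- regularization.
  let b : ℕ → ℂ := fun n => 1 / ((n : ℝ) + 1 : ℝ) - Complex.I * t
  have hbre : ∀ n, 0 < (b n).re := fun n => by
    simp only [b]
    rw [Complex.sub_re, ← Complex.ofReal_one, ← Complex.ofReal_div, Complex.ofReal_re]
    simp
    positivity
  have hb : Tendsto b atTop (𝓝 (-(Complex.I * t))) := by
    have h1 : Tendsto (fun n : ℕ => ((1 / ((n : ℝ) + 1) : ℝ) : ℂ)) atTop (𝓝 ((0 : ℝ) : ℂ)) :=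
      (Complex.continuous_ofReal.tendsto _).comp tendsto_one_div_add_atTop_nhds_zero_nat
    have := h1.sub_const (Complex.I * t)
    simpa [b] using this
  have hb0 : -(Complex.I * (t : ℂ)) ≠ 0 := by
    simp [ht.ne']
  -- The limit stays off the cut, so the principal square root is continuous there and its branch is
  -- fixed.
  have hslit : -(Complex.I * (t : ℂ)) ∈ Complex.slitPlane := by
    right; simp [ht.ne']
  have hFi : Integrable (𝓕 (f : ℝ → ℂ)) := by
    rw [← SchwartzMap.fourier_coe]; exact (𝓕 f).integrable
  have hFc : Continuous (𝓕 (f : ℝ → ℂ)) := by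
    rw [← SchwartzMap.fourier_coe]; exact (𝓕 f).continuous
  have hpars : ∀ n, ∫ p : ℝ, 𝓕 (f : ℝ → ℂ) p * Complex.exp (-Real.pi * b n * p ^ 2)
      = 1 / (b n) ^ (1 / 2 : ℂ) * ∫ y : ℝ, f y * Complex.exp (-Real.pi / b n * y ^ 2) := by
    intro n
    have hg : Integrable fun p : ℝ => Complex.exp (-Real.pi * b n * p ^ 2) := by
      have : 0 < (Real.pi * b n).re := by
        rw [Complex.re_ofReal_mul]; exact mul_pos Real.pi_pos (hbre n)
      simpa using integrable_cexp_quadratic this 0 0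
    have h := VectorFourier.integral_fourierIntegral_smul_eq_flip (L := innerₗ ℝ)
      (μ := volume) (ν := volume) Real.continuous_fourierChar continuous_inner f.integrable hg
    rw [flip_innerₗ] at h
    have e1 : VectorFourier.fourierIntegral Real.fourierChar volume (innerₗ ℝ)
        (fun p : ℝ => Complex.exp (-Real.pi * b n * p ^ 2))
        = fun t : ℝ => 1 / b n ^ (1 / 2 : ℂ) * Complex.exp (-Real.pi / b n * t ^ 2) :=
      fourier_gaussian_pi (hbre n)
    rw [e1] at h
    refine h.trans ?_
    rw [← integral_const_mul]
    refine integral_congr_ae (ae_of_all _ fun y => ?_)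
    simp only [smul_eq_mul]; ring
  have hleft : Tendsto (fun n => ∫ p : ℝ, 𝓕 (f : ℝ → ℂ) p * Complex.exp (-Real.pi * b n * p ^ 2))
      atTop (𝓝 (∫ p : ℝ, 𝓕 (f : ℝ → ℂ) p
        * Complex.exp ((Real.pi * t * p ^ 2 : ℝ) * Complex.I))) := by
    refine tendsto_integral_of_dominated_convergence (fun p => ‖𝓕 (f : ℝ → ℂ) p‖)
      (fun n => Continuous.aestronglyMeasurable (by fun_prop)) hFi.norm
      (fun n => ae_of_all _ fun p => ?_) (ae_of_all _ fun p => ?_)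
    · rw [norm_mul]
      refine mul_le_of_le_one_right (norm_nonneg _) ?_
      rw [Complex.norm_exp, Real.exp_le_one_iff]
      have : (-(Real.pi : ℂ) * b n * p ^ 2).re = -(Real.pi * (b n).re * p ^ 2) := by
        have : -(Real.pi : ℂ) * b n * p ^ 2 = ((-(Real.pi * p ^ 2) : ℝ) : ℂ) * b n := by
          push_cast; ring
        rw [this, Complex.re_ofReal_mul]; ring
      rw [this]
      have := Real.pi_pos
      have := hbre n
      exact neg_nonpos.2 (by positivity)
    · have hc : Continuous fun w : ℂ => 𝓕 (f : ℝ → ℂ) p * Complex.exp (-Real.pi * w * p ^ 2) := by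
        fun_prop
      have := (hc.tendsto _).comp hb
      refine this.trans (le_of_eq ?_)
      congr 3
      push_cast; ring
  have hright : Tendsto (fun n => 1 / (b n) ^ (1 / 2 : ℂ)
      * ∫ y : ℝ, f y * Complex.exp (-Real.pi / b n * y ^ 2)) atTop
      (𝓝 (1 / (-(Complex.I * t)) ^ (1 / 2 : ℂ)
        * ∫ y : ℝ, f y * Complex.exp (-((Real.pi / t * y ^ 2 : ℝ) * Complex.I)))) := by
    refine Tendsto.mul ?_ ?_
    · refine tendsto_const_nhds.div ?_ ?_
      · exact ((continuousAt_id.cpow continuousAt_const hslit).tendsto).comp hb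
      · rw [Complex.cpow_ne_zero_iff]
        exact Or.inl hb0
    · refine tendsto_integral_of_dominated_convergence (fun y => ‖f y‖)
        (fun n => Continuous.aestronglyMeasurable (by fun_prop)) f.integrable.norm
        (fun n => ae_of_all _ fun p => ?_) (ae_of_all _ fun p => ?_)
      · rw [norm_mul]
        refine mul_le_of_le_one_right (norm_nonneg _) ?_
        rw [Complex.norm_exp, Real.exp_le_one_iff]
        have : (-(Real.pi : ℂ) / b n * p ^ 2).re = -(Real.pi * (b n)⁻¹.re * p ^ 2) := by
          have : -(Real.pi : ℂ) / b n * p ^ 2 = ((-(Real.pi * p ^ 2) : ℝ) : ℂ) * (b n)⁻¹ := by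
            push_cast; ring
          rw [this, Complex.re_ofReal_mul]; ring
        rw [this]
        have := Real.pi_pos
        have h3 : 0 ≤ (b n)⁻¹.re := by
          rw [Complex.inv_re]
          exact div_nonneg (hbre n).le (Complex.normSq_nonneg _)
        exact neg_nonpos.2 (by positivity)
      · have hc : ContinuousAt (fun w : ℂ => f p * Complex.exp (-Real.pi / w * p ^ 2))
            (-(Complex.I * t)) :=
          continuousAt_const.mul
            (((continuousAt_const.div continuousAt_id hb0).mul continuousAt_const).cexp)
        have := hc.tendsto.comp hb
        refine this.trans (le_of_eq ?_)
        congr 3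
        have : (t : ℂ) ≠ 0 := by exact_mod_cast ht.ne'
        push_cast
        field_simp
        rw [Complex.I_sq]
        ring
  simp only [hpars] at hleft
  exact tendsto_nhds_unique hleft hright

lemma fourier_odd {h : ℝ → ℂ} (hh : ∀ y, h (-y) = -h y) (p : ℝ) : 𝓕 h (-p) = -𝓕 h p := by
  rw [Real.fourier_real_eq_integral_exp_smul, Real.fourier_real_eq_integral_exp_smul,
    ← integral_neg_eq_self, ← integral_neg]
  refine integral_congr_ae (ae_of_all _ fun y => ?_)
  simp only [hh, smul_neg]
  congr 4
  push_cast; ring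

/-- The amplitude of the Schrödinger kernel after the distance `s`. -/
def kernelAmp (k s : ℝ) : ℂ := 1 / (Complex.I * (2 * Real.pi * s / k : ℝ)) ^ (1 / 2 : ℂ)

lemma conj_one_div_cpow {t : ℝ} (ht : 0 < t) :
    conj (1 / (-(Complex.I * t)) ^ (1 / 2 : ℂ)) = 1 / (Complex.I * t) ^ (1 / 2 : ℂ) := by
  have harg : (-(Complex.I * (t : ℂ))).arg ≠ Real.pi := by
    intro h
    have := (Complex.arg_eq_pi_iff.1 h).2
    simp [ht.ne'] at this
  have h := Complex.conj_cpow (-(Complex.I * (t : ℂ))) (1 / 2) harg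
  have e : conj (-(Complex.I * (t : ℂ))) = Complex.I * t := by simp
  have e2 : conj (1 / 2 : ℂ) = 1 / 2 := by rw [map_div₀, map_one, map_ofNat]
  rw [e, e2] at h
  rw [map_div₀, map_one, ← h]

/-- Wave packets with prescribed odd amplitude `g` at `ζ = z`, and their normal derivative on the
line `x = 0`. -/
lemma exists_wavePacket_eq {k : ℝ} (hk : 0 < k) (z : ℝ) {g : ℝ → ℂ} (hg : ContDiff ℝ ∞ g)
    (hgc : HasCompactSupport g) (hgo : ∀ y, g (-y) = -g y) :
    ∃ a : 𝓢(ℝ, ℂ), (∀ q, a (-q) = -a q) ∧ (∀ y, conj (wavePacket k a (y, z)) = g y) ∧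
      ∀ ζ < z, conj (Complex.I * wavePacket k (freqMul a) (0, ζ))
        = kernelAmp k (z - ζ)
          * ∫ y, deriv g y * Complex.exp ((k * y ^ 2 / (2 * (z - ζ)) : ℝ) * Complex.I) := by
  have hpi : (0 : ℝ) < 2 * Real.pi := by positivity
  have hpiC : (Real.pi : ℂ) ≠ 0 := by exact_mod_cast Real.pi_ne_zero
  have hkC : (k : ℂ) ≠ 0 := by exact_mod_cast hk.ne'
  let h : ℝ → ℂ := fun y => conj (g y)
  have hh : ContDiff ℝ ∞ h := Complex.conjCLE.contDiff.comp hg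
  have hhc : HasCompactSupport h := hgc.comp_left (map_zero _)
  let f : 𝓢(ℝ, ℂ) := hhc.toSchwartzMap hh
  have hf : ∀ y, f y = conj (g y) := fun y => rfl
  have hodd : ∀ p, 𝓕 f (-p) = -𝓕 f p := fun p => by
    rw [SchwartzMap.fourier_coe]
    exact fourier_odd (fun y => by rw [hf, hf, hgo, map_neg]) p
  -- The Fourier transform of `conj g`, rescaled to `q = 2πp`, times a chirp that cancels the
  -- propagation phase at `ζ = z`.
  let a : 𝓢(ℝ, ℂ) := SchwartzMap.smulLeftCLM ℂ
    (fun q : ℝ => Complex.exp ((z / (2 * k) * q ^ 2 : ℝ) * Complex.I))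
    (((2 * Real.pi : ℝ) : ℂ)⁻¹ • SchwartzMap.compCLMOfContinuousLinearEquiv ℂ
      (ContinuousLinearEquiv.unitsEquivAut ℝ (Units.mk0 (2 * Real.pi)⁻¹ (inv_ne_zero hpi.ne')))
      (𝓕 f))
  have ha : ∀ q, a q = Complex.exp ((z / (2 * k) * q ^ 2 : ℝ) * Complex.I)
      * (((2 * Real.pi : ℝ) : ℂ)⁻¹ * 𝓕 f (q * (2 * Real.pi)⁻¹)) := fun q => by
    simp only [a]
    rw [SchwartzMap.smulLeftCLM_apply_apply (hasTemperateGrowth_chirp _)]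
    rfl
  have hscale : ∀ G : ℝ → ℂ, ∫ q : ℝ, ((2 * Real.pi : ℝ) : ℂ)⁻¹ * G (q * (2 * Real.pi)⁻¹)
      = ∫ p, G p := fun G => by
    rw [integral_const_mul, Measure.integral_comp_mul_right, inv_inv, abs_of_pos hpi,
      Complex.real_smul, ← mul_assoc, inv_mul_cancel₀ (by exact_mod_cast hpi.ne'), one_mul]
  refine ⟨a, fun q => ?_, fun y => ?_, fun ζ hζ => ?_⟩
  · rw [ha, ha, neg_mul, hodd, neg_sq]; ring
  · have h1 : wavePacket k a (y, z) = f y := by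
      have e1 : wavePacket k a (y, z) = ∫ q : ℝ, ((2 * Real.pi : ℝ) : ℂ)⁻¹
          * (fun p : ℝ => Complex.exp ((2 * Real.pi * (p * y) : ℝ) * Complex.I) * 𝓕 f p)
            (q * (2 * Real.pi)⁻¹) := by
        rw [wavePacket_eq]
        refine integral_congr_ae (ae_of_all _ fun q => ?_)
        simp only [ha, planeWave]
        have e2 : Complex.exp ((2 * Real.pi * (q * (2 * Real.pi)⁻¹ * y) : ℝ) * Complex.I)
            = Complex.exp ((z / (2 * k) * q ^ 2 : ℝ) * Complex.I)
              * Complex.exp (Complex.I * (q * y - q ^ 2 * z / (2 * k))) := by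
          rw [← Complex.exp_add]
          congr 1
          push_cast
          field_simp
          ring
        rw [e2]; ring
      rw [e1, hscale fun p : ℝ => Complex.exp ((2 * Real.pi * (p * y) : ℝ) * Complex.I) * 𝓕 f p]
      have h2 : 𝓕⁻ (𝓕 f) y = f y := by rw [FourierTransform.fourierInv_fourier_eq]
      rw [← h2, SchwartzMap.fourierInv_coe, Real.fourierInv_eq']
      refine integral_congr_ae (ae_of_all _ fun p => ?_)
      simp only [smul_eq_mul, RCLike.inner_apply, conj_trivial]
      congr 3
      push_cast
      simp
      ring
    rw [h1, hf, Complex.conj_conj]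
  · set s := z - ζ with hs
    have hs0 : 0 < s := sub_pos.2 hζ
    -- With `q = 2πp` the phase `q² s / (2k)` is `π t p²`.
    set t := 2 * Real.pi * s / k with ht
    have ht0 : 0 < t := by positivity
    let f' : 𝓢(ℝ, ℂ) := SchwartzMap.derivCLM ℂ ℂ f
    have hf' : ∀ y, f' y = conj (deriv g y) := fun y => by
      have : HasDerivAt (fun y => conj (g y)) (conj (deriv g y)) y :=
        ((hg.differentiable (by simp)) y).hasDerivAt.star
      exact this.deriv
    -- The factor `iq` of the normal derivative becomes a derivative of the amplitude.
    have hF' : ∀ p : ℝ, 𝓕 (f' : ℝ → ℂ) p = 2 * Real.pi * Complex.I * p * 𝓕 f p := fun p => by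
      have := Real.fourier_deriv f.integrable (f.smooth 1 |>.differentiable (by simp)) f'.integrable
      exact congrFun this p
    have key := integral_fourier_mul_chirp f' ht0
    have e1 : Complex.I * wavePacket k (freqMul a) (0, ζ)
        = ∫ p : ℝ, 𝓕 (f' : ℝ → ℂ) p * Complex.exp ((Real.pi * t * p ^ 2 : ℝ) * Complex.I) := by
      rw [wavePacket_eq, ← integral_const_mul, ← hscale fun p : ℝ =>
        𝓕 (f' : ℝ → ℂ) p * Complex.exp ((Real.pi * t * p ^ 2 : ℝ) * Complex.I)]
      refine integral_congr_ae (ae_of_all _ fun q => ?_)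
      simp only [freqMul_apply, ha, planeWave, hF']
      have e2 : Complex.exp ((Real.pi * t * (q * (2 * Real.pi)⁻¹) ^ 2 : ℝ) * Complex.I)
          = Complex.exp ((z / (2 * k) * q ^ 2 : ℝ) * Complex.I)
            * Complex.exp (Complex.I * (q * (0 : ℝ) - q ^ 2 * ζ / (2 * k))) := by
        rw [← Complex.exp_add]
        congr 1
        simp only [ht, hs]
        push_cast
        field_simp
        ring
      rw [e2]
      push_cast
      field_simp
    rw [e1, key, map_mul, conj_one_div_cpow ht0, kernelAmp, ← ht, ← integral_conj]
    congr 1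
    refine integral_congr_ae (ae_of_all _ fun y => ?_)
    simp only [map_mul, hf', Complex.conj_conj, ← Complex.exp_conj, map_neg, Complex.conj_ofReal,
      Complex.conj_I]
    congr 2
    simp only [ht]
    push_cast
    have : (s : ℂ) ≠ 0 := by exact_mod_cast hs0.ne'
    field_simp

end Spectrum

/-! ### Reciprocity with a Gaussian chirp truncated at `x = R`. -/

section Truncated

variable {k z : ℝ} {V : ℝ × ℝ → ℂ} {v₀ : ℝ → ℂ} {g : ℝ → ℂ}

/-- The oscillating Gaussian `exp (i b y²)`. -/
def chirp (b y : ℝ) : ℂ := Complex.exp ((b * y ^ 2 : ℝ) * Complex.I)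

lemma norm_chirp (b y : ℝ) : ‖chirp b y‖ = 1 := Complex.norm_exp_ofReal_mul_I _

lemma contDiff_chirp (b : ℝ) : ContDiff ℝ ∞ (chirp b) :=
  ((Complex.ofRealCLM.contDiff.comp (contDiff_const.mul (contDiff_id.pow 2))).mul
    contDiff_const).cexp

@[fun_prop]
lemma continuous_chirp (b : ℝ) : Continuous (chirp b) := (contDiff_chirp b).continuous

lemma hasDerivAt_chirp (b y : ℝ) :
    HasDerivAt (chirp b) (2 * b * y * Complex.I * chirp b y) y := by
  have h : HasDerivAt (fun y : ℝ => b * y ^ 2) (b * (2 * y)) y := by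
    simpa using (hasDerivAt_pow 2 y).const_mul b
  refine ((h.ofReal_comp.mul_const Complex.I).cexp).congr_deriv ?_
  simp only [chirp]
  push_cast
  ring

lemma chirp_mul_chirp (b c y : ℝ) : chirp b y * chirp c y = chirp (b + c) y := by
  rw [chirp, chirp, chirp, ← Complex.exp_add]
  congr 1
  push_cast
  ring

/-- The normal derivative at `x = 0`, at distance `s` before the plane `ζ = z`, of the solution
with amplitude `g` at `ζ = z`. -/
def boundaryDeriv (k : ℝ) (g : ℝ → ℂ) (s : ℝ) : ℂ :=
  kernelAmp k s * ∫ y, deriv g y * chirp (k / (2 * s)) y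

lemma norm_kernelAmp (hk : 0 < k) {s : ℝ} (hs : 0 < s) :
    ‖kernelAmp k s‖ = Real.sqrt (k / (2 * Real.pi)) / Real.sqrt s := by
  have h1 : ‖Complex.I * ((2 * Real.pi * s / k : ℝ) : ℂ)‖ = 2 * Real.pi * s / k := by
    rw [norm_mul, Complex.norm_I, one_mul, Complex.norm_real, Real.norm_of_nonneg (by positivity)]
  have h2 : (1 / 2 : ℂ) = ((1 / 2 : ℝ) : ℂ) := by push_cast; rfl
  rw [kernelAmp, norm_div, norm_one, h2, Complex.norm_cpow_real, h1, ← Real.sqrt_eq_rpow,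
    ← Real.sqrt_div (by positivity), one_div, ← Real.sqrt_inv]
  congr 1
  field_simp

/-- Integration by parts moves the derivative from `g` to the chirp. This gains `1/s` at large
distances, and leaves a form that passes to the limit when `g` tends to a discontinuous function. -/
lemma boundaryDeriv_eq (hg : ContDiff ℝ ∞ g) (hgc : HasCompactSupport g) {s : ℝ} (hs : 0 < s) :
    boundaryDeriv k g s
      = kernelAmp k s * (-(k / s * Complex.I) * ∫ y : ℝ, g y * (y * chirp (k / (2 * s)) y)) := by
  have hsC : (s : ℂ) ≠ 0 := by exact_mod_cast hs.ne'
  have hd : ∀ y, HasDerivAt (chirp (k / (2 * s)))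
      (k / s * Complex.I * (y * chirp (k / (2 * s)) y)) y := fun y => by
    refine (hasDerivAt_chirp _ y).congr_deriv ?_
    push_cast
    field_simp
  have hgd : Continuous (deriv g) := (contDiff_infty_iff_deriv.1 hg).2.continuous
  have hgcont := hg.continuous
  have h := integral_mul_deriv_eq_deriv_mul_of_integrable (u := g) (v := chirp (k / (2 * s)))
    (fun y _ => ((hg.differentiable (by simp)) y).hasDerivAt) (fun y _ => hd y)
    (Continuous.integrable_of_hasCompactSupport (by fun_prop) hgc.mul_right)
    (Continuous.integrable_of_hasCompactSupport (by fun_prop) hgc.deriv.mul_right)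
    (Continuous.integrable_of_hasCompactSupport (by fun_prop) hgc.mul_right)
  rw [boundaryDeriv]
  congr 1
  rw [← neg_eq_iff_eq_neg] at h
  rw [← h, neg_mul, ← integral_const_mul]
  congr 2
  ext y
  ring

/-- The definition gives a bound of order `s^(-1/2)`, `boundaryDeriv_eq` one of order `s^(-3/2)`.
Together they produce exactly the weight under which the data are integrable, depending on `g` only
through `A` and `B`. -/
lemma norm_boundaryDeriv_le (hk : 0 < k) (hg : ContDiff ℝ ∞ g) (hgc : HasCompactSupport g)
    {A B : ℝ} (hA : ∫ y, ‖deriv g y‖ ≤ A) (hB : ∫ y, ‖g y * y‖ ≤ B) {s : ℝ} (hs : 0 < s) :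
    ‖boundaryDeriv k g s‖
      ≤ Real.sqrt (k / (2 * Real.pi)) * (A + k * B) / (Real.sqrt s * (1 + s)) := by
  have h1 : ‖boundaryDeriv k g s‖ ≤ Real.sqrt (k / (2 * Real.pi)) / Real.sqrt s * A := by
    rw [boundaryDeriv, norm_mul, norm_kernelAmp hk hs]
    gcongr
    refine (norm_integral_le_integral_norm _).trans (le_trans (le_of_eq ?_) hA)
    simp [norm_chirp]
  have h2 : ‖boundaryDeriv k g s‖ ≤ Real.sqrt (k / (2 * Real.pi)) / Real.sqrt s * (k / s * B) := by
    rw [boundaryDeriv_eq hg hgc hs, norm_mul, norm_kernelAmp hk hs, norm_mul]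
    have e : ‖-((k : ℂ) / s * Complex.I)‖ = k / s := by
      rw [norm_neg, norm_mul, Complex.norm_I, mul_one, norm_div, Complex.norm_real,
        Complex.norm_real, Real.norm_of_nonneg hk.le, Real.norm_of_nonneg hs.le]
    rw [e]
    gcongr
    refine (norm_integral_le_integral_norm _).trans (le_trans (le_of_eq ?_) hB)
    simp [norm_chirp]
  rw [← div_div, le_div_iff₀ (by positivity), mul_add, mul_one]
  calc _ ≤ Real.sqrt (k / (2 * Real.pi)) / Real.sqrt s * A
        + Real.sqrt (k / (2 * Real.pi)) / Real.sqrt s * (k / s * B) * s :=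
        add_le_add h1 (mul_le_mul_of_nonneg_right h2 hs.le)
    _ = _ := by field_simp

namespace IsHalfPlaneField

lemma aestronglyMeasurable_data (hV : IsHalfPlaneField k z V v₀) :
    AEStronglyMeasurable v₀ (volume.restrict (Iio z)) := by
  have h := hV.data_integrable.1.mul
    (g := fun ζ => ((Real.sqrt (z - ζ) * (1 + (z - ζ)) : ℝ) : ℂ))
    (Continuous.aestronglyMeasurable (by fun_prop))
  refine h.congr ((ae_restrict_iff' measurableSet_Iio).2 (ae_of_all _ fun ζ hζ => ?_))
  have h1 : 0 < z - ζ := sub_pos.2 hζ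
  have h2 : 0 < Real.sqrt (z - ζ) := Real.sqrt_pos.2 h1
  have : ((Real.sqrt (z - ζ) * (1 + (z - ζ)) : ℝ) : ℂ) ≠ 0 := by
    exact_mod_cast (by positivity : Real.sqrt (z - ζ) * (1 + (z - ζ)) ≠ 0)
  simp only [Pi.mul_apply]
  rw [div_mul_cancel₀ _ this]

lemma norm_data_mul_le {ζ : ℝ} (hζ : ζ < z) {w : ℂ} {K : ℝ}
    (hw : ‖w‖ ≤ K / (Real.sqrt (z - ζ) * (1 + (z - ζ)))) :
    ‖v₀ ζ * w‖ ≤ K * ‖v₀ ζ / ((Real.sqrt (z - ζ) * (1 + (z - ζ)) : ℝ) : ℂ)‖ := by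
  have h1 : 0 < z - ζ := sub_pos.2 hζ
  rw [norm_mul, norm_div, Complex.norm_real, Real.norm_of_nonneg (by positivity)]
  calc _ ≤ ‖v₀ ζ‖ * (K / (Real.sqrt (z - ζ) * (1 + (z - ζ)))) := by gcongr
    _ = _ := by ring

/-- Reciprocity stated for an arbitrary odd test function `g` at `ζ = z`, with the wave packet
eliminated. -/
lemma integrableOn_mul_boundaryDeriv (hk : 0 < k) (hV : IsHalfPlaneField k z V v₀)
    (hg : ContDiff ℝ ∞ g) (hgc : HasCompactSupport g) (hgo : ∀ y, g (-y) = -g y) :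
    IntegrableOn (fun ζ => v₀ ζ * boundaryDeriv k g (z - ζ)) (Iio z) ∧
      -(2 * Complex.I * k) * (∫ x in Ioi (0 : ℝ), V (x, z) * g x)
        = ∫ ζ in Iio z, v₀ ζ * boundaryDeriv k g (z - ζ) := by
  obtain ⟨a, hao, haz, haζ⟩ := exists_wavePacket_eq hk z hg hgc hgo
  have he : ∀ ζ < z, conj (Complex.I * wavePacket k (freqMul a) (0, ζ))
      = boundaryDeriv k g (z - ζ) := fun ζ hζ => by
    rw [haζ ζ hζ, boundaryDeriv]
    congr 2
    ext y
    rw [chirp]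
    congr 4
    ring
  have hint : IntegrableOn (fun ζ => v₀ ζ * conj (Complex.I * wavePacket k (freqMul a) (0, ζ)))
      (Iio z) := by
    refine Integrable.mono' (hV.data_integrable.norm.const_mul
      (Real.sqrt (k / (2 * Real.pi)) * ((∫ y, ‖deriv g y‖) + k * ∫ y, ‖g y * y‖))) ?_ ?_
    · have := (rapidDecay_conj_wavePacket k (freqMul a) Complex.I).continuous
      exact hV.aestronglyMeasurable_data.mul
        (this.comp (by fun_prop : Continuous fun ζ : ℝ => ((0 : ℝ), ζ))).aestronglyMeasurable
    · refine (ae_restrict_iff' measurableSet_Iio).2 (ae_of_all _ fun ζ hζ => ?_)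
      rw [he ζ hζ]
      exact norm_data_mul_le hζ (norm_boundaryDeriv_le hk hg hgc le_rfl le_rfl (sub_pos.2 hζ))
  have hcongr : EqOn (fun ζ => v₀ ζ * conj (Complex.I * wavePacket k (freqMul a) (0, ζ)))
      (fun ζ => v₀ ζ * boundaryDeriv k g (z - ζ)) (Iio z) := fun ζ hζ => by
    simp only [he ζ hζ]
  refine ⟨hint.congr_fun hcongr measurableSet_Iio, ?_⟩
  rw [← setIntegral_congr_fun measurableSet_Iio hcongr,
    ← hV.overlap_wavePacket hk.ne' hao hint]
  simp only [haz]

lemma integrableOn_Ioc (hV : IsHalfPlaneField k z V v₀) (R : ℝ) :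
    IntegrableOn (fun x => V (x, z)) (Ioc 0 R) := by
  obtain ⟨N, C, hC⟩ := hV.growth (z - 1) (by linarith)
  refine ⟨((hV.continuousOn_slice le_rfl).mono
    Ioc_subset_Ioi_self).aestronglyMeasurable measurableSet_Ioc, ?_⟩
  have h := lintegral_mul_le (V := V) (g := fun _ => 1) (S := Ioc 0 R) measurableSet_Ioc
    Ioc_subset_Ioi_self (hC z ⟨by linarith, le_rfl⟩) (K := (1 + |R|) ^ N) (by positivity)
    fun x hx => by
      rw [norm_one, le_div_iff₀ (by have := hx.1; positivity), one_mul]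
      have := hx.1
      gcongr
      exact hx.2.trans (le_abs_self R)
  simp only [mul_one] at h
  exact h.trans_lt ENNReal.ofReal_lt_top

end IsHalfPlaneField

/-- Smooth odd approximations of the sign function on `[-R, R]`. -/
def oddCutoff (R : ℝ) (n : ℕ) (y : ℝ) : ℝ :=
  (Real.smoothTransition ((n + 1) * y) - Real.smoothTransition ((n + 1) * (y - R)))
    - (Real.smoothTransition ((n + 1) * -y) - Real.smoothTransition ((n + 1) * (-y - R)))

variable {R : ℝ}

lemma oddCutoff_neg (n : ℕ) (y : ℝ) : oddCutoff R n (-y) = -oddCutoff R n y := by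
  simp only [oddCutoff, neg_neg]; ring

lemma contDiff_oddCutoff (R : ℝ) (n : ℕ) : ContDiff ℝ ∞ (oddCutoff R n) := by
  have h : ∀ f : ℝ → ℝ, ContDiff ℝ ∞ f → ContDiff ℝ ∞ fun y => Real.smoothTransition (f y) :=
    fun f hf => Real.smoothTransition.contDiff.comp hf
  refine ((h _ ?_).sub (h _ ?_)).sub ((h _ ?_).sub (h _ ?_)) <;> fun_prop

lemma abs_oddCutoff_le (n : ℕ) (y : ℝ) : |oddCutoff R n y| ≤ 2 := by
  simp only [oddCutoff, abs_le]
  have h0 := Real.smoothTransition.nonneg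
  have h1 := Real.smoothTransition.le_one
  constructor <;> linarith [h0 ((n + 1) * y), h1 ((n + 1) * y), h0 ((n + 1) * (y - R)),
    h1 ((n + 1) * (y - R)), h0 ((n + 1) * -y), h1 ((n + 1) * -y), h0 ((n + 1) * (-y - R)),
    h1 ((n + 1) * (-y - R))]

lemma oddCutoff_of_pos (hR : 0 < R) (n : ℕ) {y : ℝ} (hy : 0 < y) : oddCutoff R n y
    = Real.smoothTransition ((n + 1) * y) - Real.smoothTransition ((n + 1) * (y - R)) := by
  have hn : (0 : ℝ) < n + 1 := by positivity
  rw [oddCutoff, Real.smoothTransition.zero_of_nonpos (x := (n + 1) * -y),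
    Real.smoothTransition.zero_of_nonpos (x := (n + 1) * (-y - R))]
  · ring
  · exact mul_nonpos_of_nonneg_of_nonpos hn.le (by linarith)
  · exact mul_nonpos_of_nonneg_of_nonpos hn.le (by linarith)

lemma oddCutoff_eq_zero (hR : 0 < R) (n : ℕ) {y : ℝ} (hy : R + 1 < |y|) : oddCutoff R n y = 0 := by
  have hn : (0 : ℝ) ≤ n := by positivity
  have key : ∀ y, R + 1 < y → oddCutoff R n y = 0 := fun y hy => by
    rw [oddCutoff_of_pos hR n (by linarith), Real.smoothTransition.one_of_one_le,
      Real.smoothTransition.one_of_one_le, sub_self]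
    · nlinarith
    · nlinarith
  rcases lt_abs.1 hy with h | h
  · exact key y h
  · rw [← neg_neg y, oddCutoff_neg, key _ h, neg_zero]

lemma tendsto_oddCutoff (hR : 0 < R) {y : ℝ} (hy : 0 < y) :
    Tendsto (fun n => oddCutoff R n y) atTop (𝓝 (if y ≤ R then 1 else 0)) := by
  have hlarge : ∀ δ : ℝ, 0 < δ → ∀ᶠ n : ℕ in atTop, 1 ≤ ((n : ℝ) + 1) * δ := fun δ hδ => by
    obtain ⟨N, hN⟩ := exists_nat_gt (1 / δ)
    filter_upwards [eventually_ge_atTop N] with n hn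
    have h1 : (N : ℝ) ≤ n := by exact_mod_cast hn
    rw [div_lt_iff₀ hδ] at hN
    nlinarith
  refine tendsto_const_nhds.congr' ?_
  split_ifs with h
  · filter_upwards [hlarge y hy] with n hn
    rw [oddCutoff_of_pos hR n hy, Real.smoothTransition.one_of_one_le hn,
      Real.smoothTransition.zero_of_nonpos, sub_zero]
    exact mul_nonpos_of_nonneg_of_nonpos (by positivity) (by linarith)
  · filter_upwards [hlarge y hy, hlarge (y - R) (by linarith [not_le.1 h])] with n h1 h2
    rw [oddCutoff_of_pos hR n hy, Real.smoothTransition.one_of_one_le h1,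
      Real.smoothTransition.one_of_one_le h2, sub_self]

/-- The `L¹` norm of the derivative of a transition does not change under rescaling, and there are
four transitions. The bound uniform in `n` is what permits domination as the cutoff sharpens. -/
lemma exists_integral_deriv_oddCutoff_le (R : ℝ) :
    ∃ A, ∀ n, Integrable (deriv (oddCutoff R n)) ∧ ∫ y, ‖deriv (oddCutoff R n) y‖ ≤ A := by
  have hi : Integrable transDeriv :=
    continuous_transDeriv.integrable_of_hasCompactSupport hasCompactSupport_transDeriv
  have hterm : ∀ (n : ℕ) (c ε : ℝ), |ε| = 1 →
      Integrable (fun y => ε * (n + 1) * transDeriv ((n + 1) * (ε * y - c))) ∧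
      ∫ y, ‖ε * (n + 1) * transDeriv ((n + 1) * (ε * y - c))‖ = ∫ y, ‖transDeriv y‖ := by
    intro n c ε hε
    have hn : (0 : ℝ) < n + 1 := by positivity
    have hε0 : ε ≠ 0 := fun h => by simp [h] at hε
    have h0 : ε * (n + 1) ≠ 0 := mul_ne_zero hε0 hn.ne'
    have e : (fun y => ε * (n + 1) * transDeriv ((n + 1) * (ε * y - c)))
        = fun y => ε * (n + 1) * (fun w => transDeriv (w - (n + 1) * c)) ((ε * (n + 1)) * y) := by
      ext y
      simp only
      congr 2
      ring
    have hi' := hi.comp_sub_right ((n + 1) * c)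
    refine ⟨?_, ?_⟩
    · rw [e]
      exact (hi'.comp_mul_left' h0).const_mul _
    · have e2 : ∀ y, ‖ε * (n + 1) * transDeriv ((n + 1) * (ε * y - c))‖
          = |ε * (n + 1)| * (fun w => ‖transDeriv (w - (n + 1) * c)‖) ((ε * (n + 1)) * y) := by
        intro y
        rw [congrFun e y, norm_mul]
        rfl
      simp only [e2]
      rw [integral_const_mul,
        Measure.integral_comp_mul_left (fun w => ‖transDeriv (w - (n + 1) * c)‖),
        integral_sub_right_eq_self (fun w => ‖transDeriv w‖), smul_eq_mul, abs_inv,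
        mul_inv_cancel_left₀ (abs_ne_zero.2 h0)]
  refine ⟨4 * ∫ y, ‖transDeriv y‖, fun n => ?_⟩
  have hd : ∀ y, HasDerivAt (oddCutoff R n)
      (((1 * (n + 1) * transDeriv ((n + 1) * (1 * y - 0)))
        - (1 * (n + 1) * transDeriv ((n + 1) * (1 * y - R))))
        - ((-1 * (n + 1) * transDeriv ((n + 1) * (-1 * y - 0)))
        - (-1 * (n + 1) * transDeriv ((n + 1) * (-1 * y - R))))) y := by
    intro y
    have key : ∀ ε c : ℝ, HasDerivAt (fun y => Real.smoothTransition ((n + 1) * (ε * y - c)))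
        (ε * (n + 1) * transDeriv ((n + 1) * (ε * y - c))) y := fun ε c => by
      have h1 : HasDerivAt (fun y : ℝ => ((n : ℝ) + 1) * (ε * y - c)) ((n + 1) * (ε * 1)) y :=
        (((hasDerivAt_id y).const_mul ε).sub_const c).const_mul _
      exact ((hasDerivAt_smoothTransition _).comp y h1).congr_deriv (by ring)
    have := ((key 1 0).sub (key 1 R)).sub ((key (-1) 0).sub (key (-1) R))
    convert! this using 1
    ext w
    simp [oddCutoff]
  have h1 := hterm n 0 1 (by simp)
  have h2 := hterm n R 1 (by simp)
  have h3 := hterm n 0 (-1) (by simp)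
  have h4 := hterm n R (-1) (by simp)
  have hdi : Integrable (deriv (oddCutoff R n)) := by
    rw [funext fun y => (hd y).deriv]
    exact (h1.1.sub h2.1).sub (h3.1.sub h4.1)
  refine ⟨hdi, ?_⟩
  calc _ ≤ ∫ y, ((‖1 * (n + 1) * transDeriv ((n + 1) * (1 * y - 0))‖
        + ‖1 * (n + 1) * transDeriv ((n + 1) * (1 * y - R))‖)
        + (‖-1 * (n + 1) * transDeriv ((n + 1) * (-1 * y - 0))‖
        + ‖-1 * (n + 1) * transDeriv ((n + 1) * (-1 * y - R))‖)) := by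
        refine integral_mono hdi.norm
          ((h1.1.norm.add h2.1.norm).add (h3.1.norm.add h4.1.norm)) fun y => ?_
        simp only
        rw [(hd y).deriv]
        exact (norm_sub_le _ _).trans (add_le_add (norm_sub_le _ _) (norm_sub_le _ _))
    _ = _ := by
        rw [integral_add (by exact h1.1.norm.add h2.1.norm) (by exact h3.1.norm.add h4.1.norm),
          integral_add h1.1.norm h2.1.norm, integral_add h3.1.norm h4.1.norm,
          h1.2, h2.2, h3.2, h4.2]
        ring

lemma integral_mul_chirp {b : ℝ} (hb : b ≠ 0) (hR : 0 < R) :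
    ∫ y in Ioc 0 R, y * chirp b y = (chirp b R - 1) / (2 * b * Complex.I) := by
  have hbC : (b : ℂ) ≠ 0 := by exact_mod_cast hb
  rw [← intervalIntegral.integral_of_le hR.le]
  have hd : ∀ y ∈ uIcc 0 R, HasDerivAt (fun y => chirp b y / (2 * b * Complex.I))
      (y * chirp b y) y := fun y _ => by
    refine ((hasDerivAt_chirp b y).div_const _).congr_deriv ?_
    have := Complex.I_ne_zero
    field_simp
  rw [intervalIntegral.integral_eq_sub_of_hasDerivAt hd
    (Continuous.intervalIntegrable (by fun_prop) _ _)]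
  have h0 : chirp b 0 = 1 := by simp [chirp]
  rw [h0, sub_div]

lemma integral_eq_two_mul_of_even {f : ℝ → ℂ} (hf : Integrable f) (he : ∀ y, f (-y) = f y) :
    ∫ y, f y = 2 * ∫ y in Ioi (0 : ℝ), f y := by
  rw [← intervalIntegral.integral_Iic_add_Ioi (b := 0) hf.integrableOn hf.integrableOn, two_mul]
  congr 1
  rw [← neg_zero, ← integral_comp_neg_Iic]
  simp only [he, neg_zero]

/-- The overlap with the test function `exp (-i k x² / (2 D))` cut off at `x = R`. -/
lemma IsHalfPlaneField.overlap_truncated (hk : 0 < k) (hV : IsHalfPlaneField k z V v₀) {D : ℝ}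
    (hD : 0 < D) (hR : 0 < R) :
    -(2 * Complex.I * k) * (∫ x in Ioc 0 R, V (x, z) * chirp (-(k / (2 * D))) x)
      = ∫ ζ in Iio z, v₀ ζ * (kernelAmp k (z - ζ) * (2 * D / (D - (z - ζ) : ℝ)
        * (1 - chirp (k / (2 * (z - ζ)) - k / (2 * D)) R))) := by
  obtain ⟨A, hA⟩ := exists_integral_deriv_oddCutoff_le R
  set b := -(k / (2 * D)) with hb
  -- The cutoff is odd and the chirp even, so the product is an admissible odd test function.
  let g : ℕ → ℝ → ℂ := fun n y => oddCutoff R n y * chirp b y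
  have hg : ∀ n, ContDiff ℝ ∞ (g n) := fun n =>
    (Complex.ofRealCLM.contDiff.comp (contDiff_oddCutoff R n)).mul (contDiff_chirp b)
  have hg0 : ∀ n y, y ∉ Icc (-(R + 1)) (R + 1) → g n y = 0 := fun n y hy => by
    have : R + 1 < |y| := by
      by_contra h
      exact hy (abs_le.1 (not_lt.1 h))
    simp only [g, oddCutoff_eq_zero hR n this, Complex.ofReal_zero, zero_mul]
  have hgc : ∀ n, HasCompactSupport (g n) := fun n =>
    HasCompactSupport.of_support_subset_isCompact (K := Icc (-(R + 1)) (R + 1)) isCompact_Icc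
      fun y hy => by
        by_contra h
        exact hy (hg0 n y h)
  have hgo : ∀ n y, g n (-y) = -g n y := fun n y => by
    simp only [g, oddCutoff_neg, chirp, neg_sq]
    push_cast
    ring
  have hgb : ∀ n y, ‖g n y‖ ≤ 2 := fun n y => by
    rw [norm_mul, norm_chirp, mul_one, Complex.norm_real]
    exact abs_oddCutoff_le n y
  have hgcont : ∀ n, Continuous (g n) := fun n => (hg n).continuous
  have hR1 : 0 ≤ R + 1 := by linarith
  have hBn : ∀ n, ∫ y, ‖g n y * y‖ ≤ 2 * (R + 1) * (2 * (R + 1)) := by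
    intro n
    have h0 : ∀ y, y ∉ Icc (-(R + 1)) (R + 1) → ‖g n y * y‖ = 0 := fun y hy => by
      rw [hg0 n y hy]; simp
    rw [← setIntegral_eq_integral_of_forall_compl_eq_zero h0]
    calc _ ≤ ∫ y in Icc (-(R + 1)) (R + 1), 2 * (R + 1) := by
          refine setIntegral_mono_on
            (Continuous.integrableOn_Icc ((hgcont n).mul Complex.continuous_ofReal).norm)
            (integrableOn_const (by simp)) measurableSet_Icc fun y hy => ?_
          rw [norm_mul, Complex.norm_real]
          exact mul_le_mul (hgb n y) (abs_le.2 hy) (norm_nonneg _) (by norm_num)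
      _ = _ := by
          rw [setIntegral_const, Measure.real, Real.volume_Icc, ENNReal.toReal_ofReal (by linarith),
            smul_eq_mul]
          ring
  set A' := A + 2 * (2 * |b| * (R + 1)) * (2 * (R + 1)) with hA'
  have hAn : ∀ n, ∫ y, ‖deriv (g n) y‖ ≤ A' := by
    intro n
    have hd : ∀ y, deriv (g n) y = deriv (oddCutoff R n) y * chirp b y
        + oddCutoff R n y * (2 * b * y * Complex.I * chirp b y) := fun y => by
      have h1 := ((contDiff_oddCutoff R n).differentiable (by simp) y).hasDerivAt.ofReal_comp
      exact (h1.mul (hasDerivAt_chirp b y)).deriv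
    have hind : Integrable ((Icc (-(R + 1)) (R + 1)).indicator
        fun _ : ℝ => 2 * (2 * |b| * (R + 1))) :=
      (integrable_indicator_iff measurableSet_Icc).2 (integrableOn_const (by simp))
    calc _ ≤ ∫ y, (‖deriv (oddCutoff R n) y‖ + (Icc (-(R + 1)) (R + 1)).indicator
          (fun _ => 2 * (2 * |b| * (R + 1))) y) := by
          refine integral_mono_of_nonneg (ae_of_all _ fun _ => norm_nonneg _)
            ((hA n).1.norm.add hind) (ae_of_all _ fun y => ?_)
          simp only [hd]
          refine (norm_add_le _ _).trans (add_le_add ?_ ?_)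
          · rw [norm_mul, norm_chirp, mul_one, Complex.norm_real]
          · by_cases hy : y ∈ Icc (-(R + 1)) (R + 1)
            · rw [indicator_of_mem hy]
              simp only [norm_mul, Complex.norm_real, norm_chirp, Complex.norm_I, mul_one,
                Complex.norm_two, Real.norm_eq_abs]
              exact mul_le_mul (abs_oddCutoff_le n y)
                (mul_le_mul_of_nonneg_left (abs_le.2 hy) (by positivity)) (by positivity)
                (by norm_num)
            · rw [indicator_of_notMem hy, oddCutoff_eq_zero hR n]
              · simp
              · by_contra h
                exact hy (abs_le.1 (not_lt.1 h))
      _ = (∫ y, ‖deriv (oddCutoff R n) y‖) + 2 * (2 * |b| * (R + 1)) * (2 * (R + 1)) := by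
          rw [integral_add (hA n).1.norm hind, integral_indicator measurableSet_Icc,
            setIntegral_const, Measure.real, Real.volume_Icc, ENNReal.toReal_ofReal (by linarith),
            smul_eq_mul]
          ring
      _ ≤ _ := by rw [hA']; gcongr; exact (hA n).2
  have hmain := fun n => hV.integrableOn_mul_boundaryDeriv hk (hg n) (hgc n) (hgo n)
  have hglim : ∀ y, 0 < y → Tendsto (fun n => g n y) atTop
      (𝓝 ((Ioc 0 R).indicator (chirp b) y)) := fun y hy => by
    have h := ((Complex.continuous_ofReal.tendsto _).comp (tendsto_oddCutoff hR hy)).mul_const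
      (chirp b y)
    refine h.trans (le_of_eq ?_)
    congr 1
    by_cases h : y ≤ R
    · rw [indicator_of_mem (show y ∈ Ioc 0 R from ⟨hy, h⟩)]; simp [h]
    · rw [indicator_of_notMem (show y ∉ Ioc 0 R from fun h' => h h'.2)]; simp [h]
  have hleft : Tendsto (fun n => ∫ x in Ioi (0 : ℝ), V (x, z) * g n x) atTop
      (𝓝 (∫ x in Ioi (0 : ℝ), V (x, z) * (Ioc 0 R).indicator (chirp b) x)) := by
    refine tendsto_integral_of_dominated_convergence
      (fun x => (Ioc 0 (R + 1)).indicator (fun x => ‖V (x, z)‖ * 2) x) (fun n => ?_) ?_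
      (fun n => ?_) ?_
    · exact ((hV.continuousOn_slice le_rfl).mul (hgcont n).continuousOn).aestronglyMeasurable
        measurableSet_Ioi
    · exact ((integrable_indicator_iff measurableSet_Ioc).2
        ((hV.integrableOn_Ioc (R + 1)).norm.mul_const 2)).integrableOn
    · refine (ae_restrict_iff' measurableSet_Ioi).2 (ae_of_all _ fun x hx => ?_)
      by_cases h : x ≤ R + 1
      · rw [indicator_of_mem (show x ∈ Ioc 0 (R + 1) from ⟨hx, h⟩), norm_mul]
        exact mul_le_mul_of_nonneg_left (hgb n x) (norm_nonneg _)
      · rw [hg0 n x fun h' => h h'.2, indicator_of_notMem (show x ∉ Ioc 0 (R + 1) from fun h' => h h'.2)]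
        simp
    · exact (ae_restrict_iff' measurableSet_Ioi).2 (ae_of_all _ fun x hx =>
        (hglim x hx).const_mul _)
  -- At `s = D` the two chirps cancel and the explicit formula would divide by zero; this single
  -- point is harmless.
  have hbd : ∀ ζ < z, z - ζ ≠ D → Tendsto (fun n => boundaryDeriv k (g n) (z - ζ)) atTop
      (𝓝 (kernelAmp k (z - ζ) * (2 * D / (D - (z - ζ) : ℝ)
        * (1 - chirp (k / (2 * (z - ζ)) - k / (2 * D)) R)))) := by
    intro ζ hζ hne
    set s := z - ζ
    have hs : 0 < s := sub_pos.2 hζ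
    have heq : ∀ n, boundaryDeriv k (g n) s = kernelAmp k s * (-(k / s * Complex.I)
        * (2 * ∫ y in Ioi (0 : ℝ), g n y * (y * chirp (k / (2 * s)) y))) := fun n => by
      rw [boundaryDeriv_eq (hg n) (hgc n) hs]
      congr 2
      have := hgcont n
      refine integral_eq_two_mul_of_even (Continuous.integrable_of_hasCompactSupport
        (by fun_prop) (hgc n).mul_right) fun y => ?_
      rw [hgo]
      simp only [chirp, neg_sq]
      push_cast
      ring
    simp only [heq]
    have hlim : Tendsto (fun n => ∫ y in Ioi (0 : ℝ), g n y * (y * chirp (k / (2 * s)) y)) atTop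
        (𝓝 (∫ y in Ioi (0 : ℝ), (Ioc 0 R).indicator (chirp b) y
          * (y * chirp (k / (2 * s)) y))) := by
      refine tendsto_integral_of_dominated_convergence
        (fun x => (Ioc 0 (R + 1)).indicator (fun _ => 2 * (R + 1)) x) (fun n => ?_) ?_
        (fun n => ?_) ?_
      · have := hgcont n
        exact Continuous.aestronglyMeasurable (by fun_prop)
      · exact ((integrable_indicator_iff measurableSet_Ioc).2
          (integrableOn_const (by simp))).integrableOn
      · refine (ae_restrict_iff' measurableSet_Ioi).2 (ae_of_all _ fun x hx => ?_)
        by_cases h : x ≤ R + 1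
        · rw [indicator_of_mem (show x ∈ Ioc 0 (R + 1) from ⟨hx, h⟩), norm_mul]
          refine mul_le_mul (hgb n x) ?_ (norm_nonneg _) (by norm_num)
          rwa [norm_mul, norm_chirp, mul_one, Complex.norm_real, Real.norm_of_nonneg (le_of_lt hx)]
        · rw [hg0 n x fun h' => h h'.2, indicator_of_notMem (show x ∉ Ioc 0 (R + 1) from fun h' => h h'.2)]
          simp
      · exact (ae_restrict_iff' measurableSet_Ioi).2 (ae_of_all _ fun x hx =>
          (hglim x hx).mul_const _)
    -- The chirps at `z` and along the kernel combine into one, and `y * chirp` has an elementary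
    -- primitive; hence the closed form.
    have hval : ∫ y in Ioi (0 : ℝ), (Ioc 0 R).indicator (chirp b) y * (y * chirp (k / (2 * s)) y)
        = (chirp (k / (2 * s) - k / (2 * D)) R - 1)
          / (2 * (k / (2 * s) - k / (2 * D) : ℝ) * Complex.I) := by
      have hβ : k / (2 * s) - k / (2 * D) ≠ 0 := by
        rw [sub_ne_zero]
        intro h
        apply hne
        field_simp at h
        exact h.symm
      rw [← integral_mul_chirp hβ hR]
      have e : ∀ y, (Ioc 0 R).indicator (chirp b) y * (y * chirp (k / (2 * s)) y)
          = (Ioc 0 R).indicator (fun y => y * chirp (k / (2 * s) - k / (2 * D)) y) y := fun y => by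
        by_cases hy : y ∈ Ioc 0 R
        · rw [indicator_of_mem hy, indicator_of_mem hy, sub_eq_add_neg, ← hb, ← chirp_mul_chirp]
          ring
        · rw [indicator_of_notMem hy, indicator_of_notMem hy, zero_mul]
      simp only [e]
      rw [setIntegral_indicator measurableSet_Ioc, inter_eq_right.2 Ioc_subset_Ioi_self]
    have h := ((hlim.const_mul 2).const_mul (-(k / s * Complex.I))).const_mul (kernelAmp k s)
    refine h.trans (le_of_eq ?_)
    rw [hval]
    congr 2
    have hsC : (s : ℂ) ≠ 0 := by exact_mod_cast hs.ne'
    have hDC : (D : ℂ) ≠ 0 := by exact_mod_cast hD.ne'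
    have hkC : (k : ℂ) ≠ 0 := by exact_mod_cast hk.ne'
    have hDs : ((D - s : ℝ) : ℂ) ≠ 0 := by exact_mod_cast (sub_ne_zero.2 hne.symm)
    have hI := Complex.I_ne_zero
    have e : ((k / (2 * s) - k / (2 * D) : ℝ) : ℂ) = k * (D - s : ℝ) / (2 * s * D) := by
      push_cast
      field_simp
    rw [e]
    field_simp
    ring
  have hright : Tendsto (fun n => ∫ ζ in Iio z, v₀ ζ * boundaryDeriv k (g n) (z - ζ)) atTop
      (𝓝 (∫ ζ in Iio z, v₀ ζ * (kernelAmp k (z - ζ) * (2 * D / (D - (z - ζ) : ℝ)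
        * (1 - chirp (k / (2 * (z - ζ)) - k / (2 * D)) R))))) := by
    refine tendsto_integral_of_dominated_convergence
      (fun ζ => Real.sqrt (k / (2 * Real.pi)) * (A' + k * (2 * (R + 1) * (2 * (R + 1))))
        * ‖v₀ ζ / ((Real.sqrt (z - ζ) * (1 + (z - ζ)) : ℝ) : ℂ)‖)
      (fun n => (hmain n).1.1) (hV.data_integrable.norm.const_mul _) (fun n => ?_) ?_
    · exact (ae_restrict_iff' measurableSet_Iio).2 (ae_of_all _ fun ζ hζ =>
        norm_data_mul_le hζ
          (norm_boundaryDeriv_le hk (hg n) (hgc n) (hAn n) (hBn n) (sub_pos.2 hζ)))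
    · have hne : ∀ᵐ ζ : ℝ, ζ ≠ z - D := Measure.ae_ne volume _
      refine (ae_restrict_iff' measurableSet_Iio).2 ?_
      filter_upwards [hne] with ζ h1 hζ
      exact (hbd ζ hζ fun h => h1 (by linarith)).const_mul _
  have hfin := hleft.const_mul (-(2 * Complex.I * (k : ℂ)))
  simp only [(hmain _).2] at hfin
  rw [← tendsto_nhds_unique hfin hright]
  congr 1
  have e : ∀ x, V (x, z) * (Ioc 0 R).indicator (chirp b) x
      = (Ioc 0 R).indicator (fun x => V (x, z) * chirp b x) x := fun x => by
    by_cases hx : x ∈ Ioc 0 R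
    · rw [indicator_of_mem hx, indicator_of_mem hx]
    · rw [indicator_of_notMem hx, indicator_of_notMem hx, mul_zero]
  simp only [e]
  rw [setIntegral_indicator measurableSet_Ioc, inter_eq_right.2 Ioc_subset_Ioi_self]

end Truncated

/-! ### The Dirichlet integral and its complex form. -/

section Dirichlet

lemma integral_exp_neg_mul_sin (x L : ℝ) :
    ∫ t in (0 : ℝ)..L, Real.exp (-x * t) * Real.sin t
      = 1 / (1 + x ^ 2) - Real.exp (-x * L) * (Real.cos L + x * Real.sin L) / (1 + x ^ 2) := by
  have h0 : (1 + x ^ 2 : ℝ) ≠ 0 := by positivity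
  have hd : ∀ t ∈ uIcc 0 L, HasDerivAt
      (fun t => -(Real.exp (-x * t) * (Real.cos t + x * Real.sin t)) / (1 + x ^ 2))
      (Real.exp (-x * t) * Real.sin t) t := fun t _ => by
    have h1 : HasDerivAt (fun t => Real.exp (-x * t)) (Real.exp (-x * t) * (-x)) t := by
      simpa using ((hasDerivAt_id t).const_mul (-x)).exp
    have h2 := (Real.hasDerivAt_cos t).add ((Real.hasDerivAt_sin t).const_mul x)
    refine ((h1.mul h2).neg.div_const _).congr_deriv ?_
    simp only [Pi.add_apply]
    field_simp
    ring
  rw [intervalIntegral.integral_eq_sub_of_hasDerivAt hd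
    (Continuous.intervalIntegrable (by fun_prop) _ _)]
  simp
  ring

/-- Write `1/t = ∫ exp (-xt) dx` over `x > 0` and exchange the integrals. The remaining integral is
at most of order `1/L`. -/
lemma integral_sin_div_eq {L : ℝ} (hL : 0 < L) :
    ∫ t in (0 : ℝ)..L, Real.sin t / t = Real.pi / 2
      - ∫ x in Ioi (0 : ℝ), Real.exp (-x * L) * (Real.cos L + x * Real.sin L) / (1 + x ^ 2) := by
  have hslice : ∀ t : ℝ, 0 < t → IntegrableOn (fun x => Real.exp (-x * t) * Real.sin t) (Ioi 0) ∧
      ∫ x in Ioi (0 : ℝ), Real.exp (-x * t) = 1 / t := fun t ht => by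
    have e : (fun x : ℝ => Real.exp (-x * t)) = fun x => Real.exp (-t * x) := by
      ext x; ring_nf
    refine ⟨?_, ?_⟩
    · refine Integrable.mul_const ?_ _
      rw [e]
      exact integrableOn_exp_mul_Ioi (neg_lt_zero.2 ht) 0
    · rw [e, integral_exp_mul_Ioi (neg_lt_zero.2 ht) 0]
      simp
  have hprod : Integrable (fun p : ℝ × ℝ => Real.exp (-p.2 * p.1) * Real.sin p.1)
      ((volume.restrict (Ioc 0 L)).prod (volume.restrict (Ioi (0 : ℝ)))) := by
    rw [integrable_prod_iff (Continuous.aestronglyMeasurable (by fun_prop))]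
    refine ⟨(ae_restrict_iff' measurableSet_Ioc).2 (ae_of_all _ fun t ht => (hslice t ht.1).1), ?_⟩
    have hb : IntegrableOn (fun _ : ℝ => (1 : ℝ)) (Ioc 0 L) := integrableOn_const (by simp)
    refine hb.mono' ?_ ?_
    · have hc : AEStronglyMeasurable (fun t : ℝ => 1 / t * |Real.sin t|)
          (volume.restrict (Ioc 0 L)) := Measurable.aestronglyMeasurable (by fun_prop)
      refine hc.congr ((ae_restrict_iff' measurableSet_Ioc).2 (ae_of_all _ fun t ht => ?_))
      simp only [norm_mul, Real.norm_eq_abs, Real.abs_exp]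
      rw [integral_mul_const, (hslice t ht.1).2]
    · refine (ae_restrict_iff' measurableSet_Ioc).2 (ae_of_all _ fun t ht => ?_)
      simp only [norm_mul, Real.norm_eq_abs, Real.abs_exp]
      rw [integral_mul_const, (hslice t ht.1).2, abs_mul, abs_abs, abs_of_pos (by
        have := ht.1; positivity), one_div, inv_mul_le_iff₀ ht.1, mul_one]
      exact (Real.abs_sin_le_abs).trans_eq (abs_of_pos ht.1)
  have hinner : ∀ x : ℝ, ∫ t in Ioc 0 L, Real.exp (-x * t) * Real.sin t
      = 1 / (1 + x ^ 2) - Real.exp (-x * L) * (Real.cos L + x * Real.sin L) / (1 + x ^ 2) :=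
    fun x => by rw [← intervalIntegral.integral_of_le hL.le, integral_exp_neg_mul_sin]
  have hswap : ∫ t in Ioc 0 L, ∫ x in Ioi (0 : ℝ), Real.exp (-x * t) * Real.sin t
      = ∫ x in Ioi (0 : ℝ), (1 / (1 + x ^ 2)
        - Real.exp (-x * L) * (Real.cos L + x * Real.sin L) / (1 + x ^ 2)) := by
    simp only [← hinner]
    exact integral_integral_swap hprod
  have hi1 : IntegrableOn (fun x : ℝ => 1 / (1 + x ^ 2)) (Ioi 0) := by
    simp [integrable_inv_one_add_sq.integrableOn]
  have hi2 : IntegrableOn (fun x : ℝ =>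
      Real.exp (-x * L) * (Real.cos L + x * Real.sin L) / (1 + x ^ 2)) (Ioi 0) := by
    have := hprod.integral_prod_right
    simp only [hinner] at this
    refine (hi1.sub this).congr (ae_of_all _ fun x => ?_)
    simp
  rw [integral_sub hi1 hi2] at hswap
  rw [intervalIntegral.integral_of_le hL.le]
  have e1 : ∫ x in Ioi (0 : ℝ), 1 / (1 + x ^ 2) = Real.pi / 2 := by
    simp
  rw [← e1, ← hswap]
  refine setIntegral_congr_fun measurableSet_Ioc fun t ht => ?_
  rw [integral_mul_const, (hslice t ht.1).2]
  ring

/-- The Dirichlet integral. -/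
lemma tendsto_integral_sin_div :
    Tendsto (fun L : ℝ => ∫ t in (0 : ℝ)..L, Real.sin t / t) atTop (𝓝 (Real.pi / 2)) := by
  have hb : Tendsto (fun L : ℝ =>
      ∫ x in Ioi (0 : ℝ), Real.exp (-x * L) * (Real.cos L + x * Real.sin L) / (1 + x ^ 2)) atTop
      (𝓝 0) := by
    have hlim : Tendsto (fun L : ℝ => 2 * (1 / L)) atTop (𝓝 0) := by
      simpa using (tendsto_const_nhds (x := (1 : ℝ))).div_atTop tendsto_id |>.const_mul 2
    refine squeeze_zero_norm' ?_ hlim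
    filter_upwards [eventually_gt_atTop 0] with L hL
    have e : (fun x : ℝ => 2 * Real.exp (-x * L)) = fun x => 2 * Real.exp (-L * x) := by
      ext x; ring_nf
    have hint : IntegrableOn (fun x : ℝ => 2 * Real.exp (-x * L)) (Ioi 0) := by
      rw [e]
      exact (integrableOn_exp_mul_Ioi (neg_lt_zero.2 hL) 0).const_mul 2
    have hval : ∫ x in Ioi (0 : ℝ), 2 * Real.exp (-x * L) = 2 * (1 / L) := by
      rw [e, integral_const_mul, integral_exp_mul_Ioi (neg_lt_zero.2 hL) 0]
      simp
    rw [← hval]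
    refine norm_integral_le_of_norm_le hint
      ((ae_restrict_iff' measurableSet_Ioi).2 (ae_of_all _ fun x hx => ?_))
    have hx0 : 0 < x := hx
    rw [norm_div, norm_mul, Real.norm_eq_abs, Real.norm_eq_abs, Real.norm_eq_abs, Real.abs_exp,
      abs_of_pos (by positivity : (0 : ℝ) < 1 + x ^ 2), div_le_iff₀ (by positivity)]
    have h1 : |Real.cos L + x * Real.sin L| ≤ 1 + x := by
      refine (abs_add_le _ _).trans (add_le_add (Real.abs_cos_le_one L) ?_)
      rw [abs_mul, abs_of_pos hx0]
      exact mul_le_of_le_one_right hx0.le (Real.abs_sin_le_one L)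
    have h2 : 1 + x ≤ 2 * (1 + x ^ 2) := by nlinarith [sq_nonneg (x - 1), sq_nonneg (x + 1)]
    calc _ ≤ Real.exp (-x * L) * (2 * (1 + x ^ 2)) := by gcongr; exact h1.trans h2
      _ = _ := by ring
  have := hb.const_sub (Real.pi / 2)
  rw [sub_zero] at this
  refine this.congr' ?_
  filter_upwards [eventually_gt_atTop 0] with L hL
  rw [integral_sin_div_eq hL]

/-- Over a symmetric interval the odd part `(1 - cos μρ)/ρ` cancels; what remains is `-2i` times the
integral of `sin(μρ)/ρ` from `0` to `1/2`. -/
lemma tendsto_integral_one_sub_exp_div :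
    Tendsto (fun μ : ℝ => ∫ ρ in Ioo (-(1 / 2) : ℝ) (1 / 2),
      (1 - Complex.exp ((μ * ρ : ℝ) * Complex.I)) / (ρ : ℂ)) atTop
      (𝓝 (-(Complex.I * Real.pi))) := by
  have hcomp : Tendsto (fun μ : ℝ => μ / 2) atTop atTop := tendsto_id.atTop_div_const (by norm_num)
  have h := ((Complex.continuous_ofReal.tendsto _).comp
    (tendsto_integral_sin_div.comp hcomp)).const_mul (-(2 * Complex.I))
  have e0 : -(2 * Complex.I) * ((Real.pi / 2 : ℝ) : ℂ) = -(Complex.I * Real.pi) := by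
    push_cast; ring
  rw [e0] at h
  refine h.congr' ?_
  filter_upwards [eventually_gt_atTop 0] with μ hμ
  set f : ℝ → ℂ := fun ρ => (1 - Complex.exp ((μ * ρ : ℝ) * Complex.I)) / (ρ : ℂ) with hf
  have hfb : ∀ ρ, ‖f ρ‖ ≤ μ := fun ρ => by
    rcases eq_or_ne ρ 0 with rfl | hρ
    · simp [hf, hμ.le]
    · rw [hf, norm_div, Complex.norm_real, Real.norm_eq_abs, div_le_iff₀ (abs_pos.2 hρ),
        norm_sub_rev, mul_comm (_ : ℂ) Complex.I]
      refine Real.norm_exp_I_mul_ofReal_sub_one_le.trans ?_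
      rw [Real.norm_eq_abs, abs_mul, abs_of_pos hμ]
  have hfm : Measurable f := by
    simp only [hf]
    fun_prop
  have hfi : ∀ a b : ℝ, IntervalIntegrable f volume a b := fun a b => by
    rw [intervalIntegrable_iff]
    exact Integrable.mono' (g := fun _ => μ) (integrableOn_const (by simp))
      hfm.aestronglyMeasurable (ae_of_all _ hfb)
  have hsplit : ∫ ρ in Ioo (-(1 / 2) : ℝ) (1 / 2), f ρ
      = ∫ ρ in (0 : ℝ)..(1 / 2), (f ρ + f (-ρ)) := by
    have hneg : IntervalIntegrable (fun ρ => f (-ρ)) volume 0 (1 / 2) := by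
      rw [intervalIntegrable_iff]
      exact Integrable.mono' (g := fun _ => μ) (integrableOn_const (by simp))
        (hfm.comp measurable_neg).aestronglyMeasurable (ae_of_all _ fun ρ => hfb (-ρ))
    rw [← integral_Ioc_eq_integral_Ioo, ← intervalIntegral.integral_of_le (by norm_num),
      ← intervalIntegral.integral_add_adjacent_intervals (hfi _ 0) (hfi 0 _),
      intervalIntegral.integral_add (hfi _ _) hneg, intervalIntegral.integral_comp_neg, add_comm,
      neg_zero]
  -- At `ρ = 0` both sides are `0`, since division by zero gives zero.
  have hpt : ∀ ρ : ℝ, f ρ + f (-ρ) = -(2 * Complex.I) * (μ * (Real.sin (μ * ρ) / (μ * ρ)) : ℝ) := by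
    intro ρ
    rcases eq_or_ne ρ 0 with rfl | hρ
    · simp [hf]
    have hρC : (ρ : ℂ) ≠ 0 := by exact_mod_cast hρ
    have hμC : (μ : ℂ) ≠ 0 := by exact_mod_cast hμ.ne'
    simp only [hf]
    rw [Complex.exp_mul_I, Complex.exp_mul_I]
    push_cast
    rw [mul_neg, Complex.cos_neg, Complex.sin_neg]
    field_simp
    ring
  rw [hsplit]
  simp only [hpt, Function.comp]
  rw [intervalIntegral.integral_const_mul, intervalIntegral.integral_ofReal,
    intervalIntegral.integral_const_mul, intervalIntegral.mul_integral_comp_mul_left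
      (f := fun t => Real.sin t / t) μ]
  rw [mul_zero, mul_one_div]

end Dirichlet

/-! ### The substitution `ρ = D/s - 1` and the model singularity. -/

section SingularIntegral

variable {z c : ℝ} {v : ℝ → ℂ}

/-- The phase `exp (i μ (D / s - 1))` at distance `s = z - ζ`. -/
def recipPhase (D z μ ζ : ℝ) : ℂ := Complex.exp ((μ * (D / (z - ζ) - 1) : ℝ) * Complex.I)

lemma norm_recipPhase (D z μ ζ : ℝ) : ‖recipPhase D z μ ζ‖ = 1 := Complex.norm_exp_ofReal_mul_I _

@[fun_prop]
lemma measurable_recipPhase (D z μ : ℝ) : Measurable (recipPhase D z μ) := by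
  unfold recipPhase
  fun_prop

lemma image_sub_div (z : ℝ) {D : ℝ} (hD : 0 < D) :
    (fun ρ => z - D / (1 + ρ)) '' Ioi (-1) = Iio z := by
  ext ζ
  simp only [mem_image, mem_Ioi, mem_Iio]
  constructor
  · rintro ⟨ρ, hρ, rfl⟩
    have : 0 < D / (1 + ρ) := div_pos hD (by linarith)
    linarith
  · intro h
    have h1 : 0 < z - ζ := by linarith
    refine ⟨D / (z - ζ) - 1, ?_, ?_⟩
    · have := div_pos hD h1
      linarith
    · rw [add_sub_cancel, div_div_cancel₀ hD.ne', sub_sub_cancel]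

/-- The asymmetric interval about `c` is chosen so that it is symmetric in `ρ`. -/
lemma image_sub_div_Ioo (hc : c < z) :
    (fun ρ => z - (z - c) / (1 + ρ)) '' Ioo (-(1 / 2)) (1 / 2)
      = Ioo (c - (z - c)) (c + (z - c) / 3) := by
  have hD : 0 < z - c := by linarith
  ext ζ
  simp only [mem_image, mem_Ioo]
  constructor
  · rintro ⟨ρ, ⟨h1, h2⟩, rfl⟩
    have h3 : 0 < 1 + ρ := by linarith
    have e : z - (z - c) / (1 + ρ) = c + (z - c) * ρ / (1 + ρ) := by field_simp; ring
    rw [e]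
    constructor
    · have : -(z - c) < (z - c) * ρ / (1 + ρ) := by
        rw [lt_div_iff₀ h3]; nlinarith
      linarith
    · have : (z - c) * ρ / (1 + ρ) < (z - c) / 3 := by
        rw [div_lt_iff₀ h3]; nlinarith
      linarith
  · rintro ⟨h1, h2⟩
    have h3 : 0 < z - ζ := by linarith
    refine ⟨(z - c) / (z - ζ) - 1, ⟨?_, ?_⟩, ?_⟩
    · have : 1 / 2 < (z - c) / (z - ζ) := by rw [lt_div_iff₀ h3]; linarith
      linarith
    · have : (z - c) / (z - ζ) < 3 / 2 := by rw [div_lt_iff₀ h3]; linarith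
      linarith
    · rw [add_sub_cancel, div_div_cancel₀ hD.ne', sub_sub_cancel]

lemma integral_image_sub_div (z : ℝ) {D : ℝ} (hD : 0 < D) {S : Set ℝ} (hS : MeasurableSet S)
    (hS1 : S ⊆ Ioi (-1)) (g : ℝ → ℂ) :
    ∫ ζ in (fun ρ => z - D / (1 + ρ)) '' S, g ζ
      = ∫ ρ in S, ((D / (1 + ρ) ^ 2 : ℝ) : ℂ) * g (z - D / (1 + ρ)) := by
  have hpos : ∀ ρ ∈ S, 0 < 1 + ρ := fun ρ hρ => by
    have : -1 < ρ := hS1 hρ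
    linarith
  rw [integral_image_eq_integral_abs_deriv_smul (f' := fun ρ => D / (1 + ρ) ^ 2) hS]
  · refine setIntegral_congr_fun hS fun ρ hρ => ?_
    have := hpos ρ hρ
    rw [abs_of_pos (by positivity), Complex.real_smul]
  · intro ρ hρ
    have h := hpos ρ hρ
    have h1 : HasDerivAt (fun ρ : ℝ => 1 + ρ) 1 ρ := (hasDerivAt_id ρ).const_add 1
    refine ((((hasDerivAt_const ρ D).div h1 h.ne').const_sub z).congr_deriv ?_).hasDerivWithinAt
    ring
  · intro ρ hρ σ hσ h
    have h1 := hpos ρ hρ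
    have h2 := hpos σ hσ
    have h3 : D / (1 + ρ) = D / (1 + σ) := by simpa using h
    rw [div_eq_div_iff h1.ne' h2.ne'] at h3
    have := mul_left_cancel₀ hD.ne' h3
    linarith

/-- In the variable `ρ = D/s - 1` the phase is `exp (iμρ)`, so this is the Riemann–Lebesgue lemma
for `b` times the Jacobian. -/
lemma tendsto_integral_mul_recipPhase (z : ℝ) {D : ℝ} (hD : 0 < D) (b : ℝ → ℂ) :
    Tendsto (fun μ => ∫ ζ in Iio z, b ζ * recipPhase D z μ ζ) atTop (𝓝 0) := by
  set F : ℝ → ℂ := (Ioi (-1)).indicator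
    fun ρ => ((D / (1 + ρ) ^ 2 : ℝ) : ℂ) * b (z - D / (1 + ρ)) with hF
  have hw : Tendsto (fun μ : ℝ => -μ / (2 * Real.pi)) atTop (cocompact ℝ) := by
    refine Tendsto.mono_right ?_ atBot_le_cocompact
    exact (tendsto_neg_atTop_atBot).atBot_div_const (by positivity)
  refine ((Real.tendsto_integral_exp_smul_cocompact F).comp hw).congr fun μ => ?_
  rw [← image_sub_div z hD, integral_image_sub_div z hD measurableSet_Ioi subset_rfl,
    ← integral_indicator measurableSet_Ioi]
  refine integral_congr_ae (ae_of_all _ fun ρ => ?_)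
  by_cases hρ : ρ ∈ Ioi (-1 : ℝ)
  · have h1 : 1 + ρ ≠ 0 := by
      have : (-1 : ℝ) < ρ := hρ
      linarith
    simp only [hF, indicator_of_mem hρ, recipPhase, Circle.smul_def, Real.fourierChar_apply,
      smul_eq_mul]
    have e1 : 2 * Real.pi * -(ρ * (-μ / (2 * Real.pi))) = μ * ρ := by
      field_simp
    have e2 : μ * (D / (z - (z - D / (1 + ρ))) - 1) = μ * ρ := by
      rw [sub_sub_cancel, div_div_cancel₀ hD.ne', add_sub_cancel_left]
    rw [e1, e2]
    ring
  · simp only [hF, indicator_of_notMem hρ, smul_zero]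

/-- The model singularity `√D / (s (c - ζ))`, `D = z - c`, `s = z - ζ`. -/
def modelSing (z c ζ : ℝ) : ℂ := ((√(z - c) / ((z - ζ) * (c - ζ)) : ℝ) : ℂ)

@[fun_prop]
lemma measurable_modelSing (z c : ℝ) : Measurable (modelSing z c) := by
  unfold modelSing
  fun_prop

/-- The extra factor `1/s` in the model absorbs the Jacobian: it becomes exactly `-1/(√D ρ)`. The
limit `iπ/√D` is the source of the boundary value in the final formula. -/
lemma tendsto_integral_modelSing_mul (hc : c < z) :
    Tendsto (fun μ => ∫ ζ in Ioo (c - (z - c)) (c + (z - c) / 3),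
      modelSing z c ζ * (1 - recipPhase (z - c) z μ ζ)) atTop
      (𝓝 (Complex.I * Real.pi / (√(z - c) : ℝ))) := by
  have hD : 0 < z - c := by linarith
  have hs : (√(z - c)) ^ 2 = z - c := Real.sq_sqrt hD.le
  have hs0 : 0 < √(z - c) := Real.sqrt_pos.2 hD
  have h := tendsto_integral_one_sub_exp_div.const_mul (-1 / ((√(z - c) : ℝ) : ℂ))
  have e0 : -1 / ((√(z - c) : ℝ) : ℂ) * -(Complex.I * Real.pi)
      = Complex.I * Real.pi / (√(z - c) : ℝ) := by ring
  rw [e0] at h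
  refine h.congr fun μ => ?_
  have hS1 : Ioo (-(1 / 2) : ℝ) (1 / 2) ⊆ Ioi (-1) := fun ρ hρ => by
    have := hρ.1
    simp only [mem_Ioi]
    linarith
  rw [← image_sub_div_Ioo hc, integral_image_sub_div z hD measurableSet_Ioo hS1,
    ← integral_const_mul]
  refine setIntegral_congr_fun measurableSet_Ioo fun ρ hρ => ?_
  have h1 : 0 < 1 + ρ := by have := hρ.1; linarith
  simp only [recipPhase, modelSing]
  have e2 : μ * ((z - c) / (z - (z - (z - c) / (1 + ρ))) - 1) = μ * ρ := by
    rw [sub_sub_cancel, div_div_cancel₀ hD.ne', add_sub_cancel_left]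
  rw [e2, ← mul_assoc, ← Complex.ofReal_mul]
  have e3 : (z - c) / (1 + ρ) ^ 2 * (√(z - c) / ((z - (z - (z - c) / (1 + ρ))) *
      (c - (z - (z - c) / (1 + ρ))))) = -1 / √(z - c) / ρ := by
    rcases eq_or_ne ρ 0 with rfl | hρ0
    · simp
    have e4 : c - (z - (z - c) / (1 + ρ)) = -((z - c) * ρ / (1 + ρ)) := by
      field_simp
      ring
    rw [e4, sub_sub_cancel]
    field_simp
    rw [hs]
  rw [e3]
  push_cast
  ring

lemma integrableOn_modelSing_diff {ε : ℝ} (hc : c < z) (hε : 0 < ε) :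
    IntegrableOn (modelSing z c)
      (Ioo (c - (z - c)) (c + (z - c) / 3) \ Metric.ball c ε) := by
  have hD : 0 < z - c := by linarith
  refine Measure.integrableOn_of_bounded (M := √(z - c) / (2 * (z - c) / 3 * ε))
    ((measure_mono sdiff_subset).trans_lt measure_Ioo_lt_top).ne
    (measurable_modelSing z c).aestronglyMeasurable ?_
  refine (ae_restrict_iff' (measurableSet_Ioo.diff Metric.isOpen_ball.measurableSet)).2
    (ae_of_all _ fun ζ hζ => ?_)
  have h1 : 2 * (z - c) / 3 ≤ z - ζ := by have := hζ.1.2; linarith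
  have h2 : ε ≤ |c - ζ| := by
    have := hζ.2
    rw [Metric.mem_ball, Real.dist_eq, not_lt, abs_sub_comm] at this
    exact this
  rw [modelSing, Complex.norm_real, norm_div, norm_mul, Real.norm_of_nonneg (Real.sqrt_nonneg _),
    Real.norm_of_nonneg (by linarith : 0 ≤ z - ζ), Real.norm_eq_abs]
  have h3 : 0 < 2 * (z - c) / 3 := by linarith
  exact div_le_div_of_nonneg_left (Real.sqrt_nonneg _) (by positivity)
    (mul_le_mul h1 h2 hε.le (by linarith))

/-- The primitive is `(log (z - ζ) - log |ζ - c|)/√D`. At both ends of the interval the difference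
of logarithms is `log 2`, so only the contributions at `c ± ε` survive. -/
lemma integral_modelSing_diff {ε : ℝ} (hε : 0 < ε) (hε' : ε < (z - c) / 3) :
    ∫ ζ in Ioo (c - (z - c)) (c + (z - c) / 3) \ Metric.ball c ε, modelSing z c ζ
      = ((1 / √(z - c) * (Real.log (z - c + ε) - Real.log (z - c - ε)) : ℝ) : ℂ) := by
  have hc : c < z := by linarith
  have hD : 0 < z - c := by linarith
  have hs : (√(z - c)) ^ 2 = z - c := Real.sq_sqrt hD.le
  have hs0 : 0 < √(z - c) := Real.sqrt_pos.2 hD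
  have hset : Ioo (c - (z - c)) (c + (z - c) / 3) \ Metric.ball c ε
      = Ioc (c - (z - c)) (c - ε) ∪ Ico (c + ε) (c + (z - c) / 3) := by
    ext ζ
    simp only [Set.mem_sdiff, mem_Ioo, Real.ball_eq_Ioo, mem_union, mem_Ioc, mem_Ico, not_and,
      not_lt]
    constructor
    · rintro ⟨⟨h1, h2⟩, h3⟩
      by_cases h : c - ε < ζ
      · exact Or.inr ⟨h3 h, h2⟩
      · exact Or.inl ⟨h1, by linarith⟩
    · rintro (⟨h1, h2⟩ | ⟨h1, h2⟩)
      · exact ⟨⟨h1, by linarith⟩, fun h => by linarith⟩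
      · exact ⟨⟨by linarith, h2⟩, fun _ => h1⟩
  have hint := integrableOn_modelSing_diff hc hε
  rw [hset] at hint ⊢
  rw [setIntegral_union (Set.disjoint_left.2 fun ζ h1 h2 => by
      have := h1.2
      have := h2.1
      linarith) measurableSet_Ico hint.left_of_union hint.right_of_union,
    ← intervalIntegral.integral_of_le (by linarith),
    integral_Ico_eq_integral_Ioc, ← intervalIntegral.integral_of_le (by linarith)]
  -- `Real.log` is the logarithm of the absolute value, so one primitive serves on both sides of
  -- `c`.
  have hd : ∀ ζ, ζ ≠ c → ζ < z → HasDerivAt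
      (fun ζ => 1 / √(z - c) * (Real.log (z - ζ) - Real.log (ζ - c)))
      (√(z - c) / ((z - ζ) * (c - ζ))) ζ := fun ζ h1 h2 => by
    have a1 : z - ζ ≠ 0 := by linarith
    have a2 : ζ - c ≠ 0 := sub_ne_zero.2 h1
    have a3 : c - ζ ≠ 0 := sub_ne_zero.2 h1.symm
    have d1 : HasDerivAt (fun ζ => z - ζ) (-1) ζ := by simpa using (hasDerivAt_id ζ).const_sub z
    have d2 : HasDerivAt (fun ζ => ζ - c) 1 ζ := (hasDerivAt_id ζ).sub_const c
    refine (((d1.log a1).sub (d2.log a2)).const_mul (1 / √(z - c))).congr_deriv ?_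
    rw [← neg_sub ζ c]
    field_simp
    rw [hs]
    ring
  have hFTC : ∀ a b : ℝ, (∀ ζ ∈ uIcc a b, ζ ≠ c ∧ ζ < z) →
      ∫ ζ in a..b, modelSing z c ζ = ((1 / √(z - c) * (Real.log (z - b) - Real.log (b - c))
        - 1 / √(z - c) * (Real.log (z - a) - Real.log (a - c)) : ℝ) : ℂ) := fun a b hab => by
    simp only [modelSing]
    rw [intervalIntegral.integral_ofReal, intervalIntegral.integral_eq_sub_of_hasDerivAt
      (fun ζ hζ => hd ζ (hab ζ hζ).1 (hab ζ hζ).2)]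
    refine ContinuousOn.intervalIntegrable fun ζ hζ => ContinuousAt.continuousWithinAt ?_
    have a1 : z - ζ ≠ 0 := by have := (hab ζ hζ).2; linarith
    have a3 : c - ζ ≠ 0 := sub_ne_zero.2 (hab ζ hζ).1.symm
    have a4 : (z - ζ) * (c - ζ) ≠ 0 := mul_ne_zero a1 a3
    fun_prop (disch := exact a4)
  rw [hFTC _ _ fun ζ hζ => ?_, hFTC _ _ fun ζ hζ => ?_, ← Complex.ofReal_add]
  · have l1 : Real.log (c - ε - c) = Real.log ε := by
      rw [show c - ε - c = -ε by ring, Real.log_neg_eq_log]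
    have l2 : Real.log (c - (z - c) - c) = Real.log (z - c) := by
      rw [show c - (z - c) - c = -(z - c) by ring, Real.log_neg_eq_log]
    have l3 : Real.log (z - (c - (z - c))) = Real.log 2 + Real.log (z - c) := by
      rw [show z - (c - (z - c)) = 2 * (z - c) by ring, Real.log_mul (by norm_num) hD.ne']
    have l4 : Real.log (z - (c + (z - c) / 3)) = Real.log 2 + Real.log ((z - c) / 3) := by
      rw [show z - (c + (z - c) / 3) = 2 * ((z - c) / 3) by ring,
        Real.log_mul (by norm_num) (by positivity)]
    rw [l1, l2, l3, l4, add_sub_cancel_left, add_sub_cancel_left,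
      show z - (c - ε) = z - c + ε by ring, show z - (c + ε) = z - c - ε by ring]
    congr 1
    ring
  · rw [uIcc_of_le (by linarith)] at hζ
    exact ⟨by have := hζ.1; intro h; linarith, by have := hζ.2; linarith⟩
  · rw [uIcc_of_le (by linarith)] at hζ
    exact ⟨by have := hζ.2; intro h; linarith, by have := hζ.2; linarith⟩

lemma tendsto_integral_modelSing_diff (hc : c < z) :
    Tendsto (fun ε => ∫ ζ in Ioo (c - (z - c)) (c + (z - c) / 3) \ Metric.ball c ε,
      modelSing z c ζ) (𝓝[>] 0) (𝓝 0) := by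
  have hD : 0 < z - c := by linarith
  have hcont : ContinuousAt (fun ε : ℝ =>
      ((1 / √(z - c) * (Real.log (z - c + ε) - Real.log (z - c - ε)) : ℝ) : ℂ)) 0 := by
    have h1 : z - c + 0 ≠ 0 := by linarith
    have h2 : z - c - 0 ≠ 0 := by linarith
    refine Complex.continuous_ofReal.continuousAt.comp (ContinuousAt.mul continuousAt_const
      (ContinuousAt.sub ?_ ?_))
    · exact ContinuousAt.log (by fun_prop) h1
    · exact ContinuousAt.log (by fun_prop) h2
  have h := hcont.tendsto
  simp only [add_zero, sub_zero, sub_self, mul_zero, Complex.ofReal_zero] at h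
  refine (h.mono_left nhdsWithin_le_nhds).congr' ?_
  filter_upwards [Ioo_mem_nhdsGT (show (0 : ℝ) < (z - c) / 3 by linarith)] with ε hε
  exact (integral_modelSing_diff hε.1 hε.2).symm

end SingularIntegral

/-! ### The principal value and the limit of the oscillating Cauchy integral. -/

section CauchyIntegral

variable {k z c : ℝ} {v : ℝ → ℂ}

/-- The integrand of the singular integral. -/
def cauchyIntegrand (z c : ℝ) (v : ℝ → ℂ) (ζ : ℝ) : ℂ :=
  v ζ / ((c - ζ : ℝ) : ℂ) / (√(z - ζ) : ℂ)

/-- The interval about `c` on which the model singularity is subtracted. -/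
def modelIoo (z c : ℝ) : Set ℝ := Ioo (c - (z - c)) (c + (z - c) / 3)

lemma measurableSet_modelIoo : MeasurableSet (modelIoo z c) := measurableSet_Ioo

lemma modelIoo_subset (hc : c < z) : modelIoo z c ⊆ Iio z := fun ζ hζ => by
  have : ζ < c + (z - c) / 3 := hζ.2
  simp only [mem_Iio]
  linarith

/-- The singular integrand minus its model singularity. -/
def cauchyRegular (z c : ℝ) (v : ℝ → ℂ) (ζ : ℝ) : ℂ :=
  cauchyIntegrand z c v ζ - v c * (modelIoo z c).indicator (modelSing z c) ζ

/-- Relative to the weighted data the integrand has the factor `(1 + s)/(c - ζ)`, bounded off the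
ball because `1 + s = 1 + D + (c - ζ)`. -/
lemma integrableOn_cauchyIntegrand_diff
    (hdata : IntegrableOn (fun ζ => v ζ / ((√(z - ζ) * (1 + (z - ζ)) : ℝ) : ℂ)) (Iio z))
    (hc : c < z) {ε : ℝ} (hε : 0 < ε) :
    IntegrableOn (cauchyIntegrand z c v) (Iio z \ Metric.ball c ε) := by
  have hm : MeasurableSet (Iio z \ Metric.ball c ε) :=
    measurableSet_Iio.diff Metric.isOpen_ball.measurableSet
  have hb : Measurable fun ζ : ℝ => (((1 + (z - ζ)) / (c - ζ) : ℝ) : ℂ) := by fun_prop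
  have h := (hdata.mono_set (sdiff_subset (t := Metric.ball c ε))).integrable.bdd_mul
    (c := (1 + (z - c)) / ε + 1) hb.aestronglyMeasurable
    ((ae_restrict_iff' hm).2 (ae_of_all _ fun ζ hζ => ?_))
  · refine h.congr ((ae_restrict_iff' hm).2 (ae_of_all _ fun ζ hζ => ?_))
    have h1 : 0 < z - ζ := sub_pos.2 hζ.1
    have h2 : (1 : ℂ) + (z - ζ) ≠ 0 := by
      exact_mod_cast (by linarith : (1 + (z - ζ)) ≠ 0)
    simp only [cauchyIntegrand]
    push_cast
    rw [div_mul_div_comm, div_div, mul_comm (1 + ((z : ℂ) - ζ)) (v ζ), mul_comm (√(z - ζ) : ℂ),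
      mul_left_comm, mul_comm (v ζ), mul_div_mul_left _ _ h2]
  · have h1 : 0 < z - ζ := sub_pos.2 hζ.1
    have h2 : ε ≤ |c - ζ| := by
      have := hζ.2
      rw [Metric.mem_ball, Real.dist_eq, not_lt, abs_sub_comm] at this
      exact this
    have h0 : 0 < |c - ζ| := hε.trans_le h2
    rw [Complex.norm_real, Real.norm_eq_abs, abs_div, abs_of_pos (by linarith), div_le_iff₀ h0]
    have h3 : (1 + (z - c)) ≤ (1 + (z - c)) / ε * |c - ζ| := by
      rw [div_mul_eq_mul_div, le_div_iff₀ hε]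
      exact mul_le_mul_of_nonneg_left h2 (by linarith)
    have h4 := le_abs_self (c - ζ)
    rw [add_mul]
    linarith

/-- Since `c - ζ = s - D = (√s - √D)(√s + √D)`, replacing `1/√s` by `√D/s` costs only a bounded
term; the rest is the difference quotient in Dini's condition. -/
lemma cauchyRegular_eq (hc : c < z) {ζ : ℝ} (hζ : ζ ∈ modelIoo z c) (hne : ζ ≠ c) :
    cauchyRegular z c v ζ = -((1 / √(z - ζ) : ℝ) : ℂ) * ((v ζ - v c) / ((ζ - c : ℝ) : ℂ))
      + v c * ((1 / ((z - ζ) * (√(z - ζ) + √(z - c))) : ℝ) : ℂ) := by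
  have hs : 0 < z - ζ := sub_pos.2 (modelIoo_subset hc hζ)
  have hD : 0 < z - c := sub_pos.2 hc
  have hs' : 0 < √(z - ζ) := Real.sqrt_pos.2 hs
  have hD' : 0 < √(z - c) := Real.sqrt_pos.2 hD
  have key : √(z - c) / ((z - ζ) * (c - ζ)) =
      1 / √(z - ζ) / (c - ζ) - 1 / ((z - ζ) * (√(z - ζ) + √(z - c))) := by
    have hx : c - ζ ≠ 0 := sub_ne_zero.2 hne.symm
    have e1 : (√(z - ζ)) ^ 2 = z - ζ := Real.sq_sqrt hs.le
    have e2 : (√(z - c)) ^ 2 = z - c := Real.sq_sqrt hD.le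
    have e3 : c - ζ = (√(z - ζ)) ^ 2 - (√(z - c)) ^ 2 := by rw [e1, e2]; ring
    rw [e3] at hx ⊢
    rw [← e1, Real.sqrt_sq hs'.le]
    field_simp
    ring
  have hx : ((c - ζ : ℝ) : ℂ) ≠ 0 := by exact_mod_cast sub_ne_zero.2 hne.symm
  have hn : ((ζ - c : ℝ) : ℂ) = -((c - ζ : ℝ) : ℂ) := by push_cast; ring
  rw [cauchyRegular, indicator_of_mem hζ, modelSing, key, cauchyIntegrand, hn]
  push_cast at hx ⊢
  have hsC : (√(z - ζ) : ℂ) ≠ 0 := by exact_mod_cast hs'.ne'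
  field_simp
  ring

lemma integrableOn_cauchyRegular
    (hdata : IntegrableOn (fun ζ => v ζ / ((√(z - ζ) * (1 + (z - ζ)) : ℝ) : ℂ)) (Iio z))
    (hc : c < z) (hDini : DiniAt v c) : IntegrableOn (cauchyRegular z c v) (Iio z) := by
  obtain ⟨S, hS, hSint⟩ := hDini
  obtain ⟨r', hr', hr'S⟩ := Metric.mem_nhds_iff.1 hS
  have hD : 0 < z - c := sub_pos.2 hc
  -- `D/4 < D/3` keeps the ball inside the model interval and at a distance from `z`.
  set r := min r' ((z - c) / 4) with hr
  have hr0 : 0 < r := lt_min hr' (by linarith)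
  have hrI : Metric.ball c r ⊆ modelIoo z c := by
    rw [Real.ball_eq_Ioo]
    have : r ≤ (z - c) / 4 := min_le_right _ _
    exact Ioo_subset_Ioo (by linarith) (by linarith)
  have hsplit : Iio z = (Iio z \ Metric.ball c r) ∪ Metric.ball c r := by
    rw [sdiff_union_self, union_eq_left.2 (hrI.trans (modelIoo_subset hc))]
  rw [hsplit]
  refine IntegrableOn.union ?_ ?_
  · refine (integrableOn_cauchyIntegrand_diff hdata hc hr0).sub (Integrable.const_mul ?_ _)
    have h : IntegrableOn (modelSing z c) (modelIoo z c \ Metric.ball c r) :=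
      integrableOn_modelSing_diff hc hr0
    rw [← integrable_indicator_iff
      (measurableSet_modelIoo.diff Metric.isOpen_ball.measurableSet)] at h
    refine h.integrableOn.congr_fun (fun ζ hζ => ?_)
      (measurableSet_Iio.diff Metric.isOpen_ball.measurableSet)
    by_cases hI : ζ ∈ modelIoo z c
    · rw [indicator_of_mem hI, indicator_of_mem
        (show ζ ∈ modelIoo z c \ Metric.ball c r from ⟨hI, hζ.2⟩)]
    · rw [indicator_of_notMem hI, indicator_of_notMem fun h => hI h.1]
  · have hball : MeasurableSet (Metric.ball c r) := Metric.isOpen_ball.measurableSet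
    have hlow : ∀ ζ ∈ Metric.ball c r, (z - c) / 2 ≤ z - ζ := fun ζ hζ => by
      have : ζ < c + (z - c) / 3 := (hrI hζ).2
      linarith
    have h1 : IntegrableOn (fun ζ => -((1 / √(z - ζ) : ℝ) : ℂ)
        * ((v ζ - v c) / ((ζ - c : ℝ) : ℂ))) (Metric.ball c r) := by
      have hmeas : Measurable fun ζ : ℝ => -((1 / √(z - ζ) : ℝ) : ℂ) := by fun_prop
      refine (hSint.mono_set ((Metric.ball_subset_ball (min_le_left _ _)).trans
        hr'S)).integrable.bdd_mul (c := 1 / √((z - c) / 2)) hmeas.aestronglyMeasurable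
        ((ae_restrict_iff' hball).2 (ae_of_all _ fun ζ hζ => ?_))
      rw [norm_neg, Complex.norm_real, Real.norm_of_nonneg (by positivity)]
      exact one_div_le_one_div_of_le (Real.sqrt_pos.2 (by linarith))
        (Real.sqrt_le_sqrt (hlow ζ hζ))
    have h2 : IntegrableOn (fun ζ => v c *
        ((1 / ((z - ζ) * (√(z - ζ) + √(z - c))) : ℝ) : ℂ)) (Metric.ball c r) := by
      refine Integrable.const_mul ?_ _
      have hmeas : Measurable fun ζ : ℝ =>
          ((1 / ((z - ζ) * (√(z - ζ) + √(z - c))) : ℝ) : ℂ) := by fun_prop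
      refine Measure.integrableOn_of_bounded (M := 1 / ((z - c) / 2 * √(z - c)))
        measure_ball_lt_top.ne hmeas.aestronglyMeasurable
        ((ae_restrict_iff' hball).2 (ae_of_all _ fun ζ hζ => ?_))
      have h3 := hlow ζ hζ
      have h4 : 0 < z - ζ := by linarith
      have h5 : 0 < √(z - c) := Real.sqrt_pos.2 hD
      rw [Complex.norm_real, Real.norm_of_nonneg (by positivity)]
      exact one_div_le_one_div_of_le (by positivity)
        (mul_le_mul h3 (le_add_of_nonneg_left (Real.sqrt_nonneg _)) h5.le h4.le)
    refine (h1.add h2).congr ?_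
    have hne : ∀ᵐ ζ ∂(volume.restrict (Metric.ball c r)), ζ ≠ c :=
      ae_restrict_of_ae (Measure.ae_ne volume c)
    filter_upwards [hne, ae_restrict_mem hball] with ζ h3 h4
    exact (cauchyRegular_eq hc (hrI h4) h3).symm

/-- The regular part is integrable and the model has principal value zero, so the principal value is
an ordinary integral. -/
lemma hasPrincipalValue_cauchyIntegrand
    (hdata : IntegrableOn (fun ζ => v ζ / ((√(z - ζ) * (1 + (z - ζ)) : ℝ) : ℂ)) (Iio z))
    (hc : c < z) (hDini : DiniAt v c) :
    HasPrincipalValue (cauchyIntegrand z c v) c (Iio z)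
      (∫ ζ in Iio z, cauchyRegular z c v ζ) := by
  refine ⟨fun ε hε => integrableOn_cauchyIntegrand_diff hdata hc hε, ?_⟩
  have hreg := integrableOn_cauchyRegular hdata hc hDini
  have h1 : Tendsto (fun ε => ∫ ζ in Iio z \ Metric.ball c ε, cauchyRegular z c v ζ) (𝓝[>] 0)
      (𝓝 (∫ ζ in Iio z, cauchyRegular z c v ζ)) := by
    have hm : ∀ ε : ℝ, MeasurableSet (Metric.ball c ε)ᶜ := fun ε =>
      Metric.isOpen_ball.measurableSet.compl
    have e : ∀ ε : ℝ, ∫ ζ in Iio z \ Metric.ball c ε, cauchyRegular z c v ζ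
        = ∫ ζ in Iio z, (Metric.ball c ε)ᶜ.indicator (cauchyRegular z c v) ζ := fun ε => by
      rw [setIntegral_indicator (hm ε), sdiff_eq]
    simp only [e]
    refine tendsto_integral_filter_of_dominated_convergence (fun ζ => ‖cauchyRegular z c v ζ‖)
      (Eventually.of_forall fun ε => hreg.aestronglyMeasurable.indicator (hm ε))
      (Eventually.of_forall fun ε => ae_of_all _ fun ζ => norm_indicator_le_norm_self _ _)
      hreg.norm ?_
    filter_upwards [ae_restrict_of_ae (Measure.ae_ne volume c)] with ζ hζ
    refine tendsto_const_nhds.congr' ?_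
    filter_upwards [Ioo_mem_nhdsGT (dist_pos.2 hζ)] with ε hε
    rw [indicator_of_mem]
    simp only [mem_compl_iff, Metric.mem_ball, not_lt]
    exact hε.2.le
  have h2 := h1.add ((tendsto_integral_modelSing_diff hc).const_mul (v c))
  rw [mul_zero, add_zero] at h2
  refine h2.congr' ?_
  filter_upwards [self_mem_nhdsWithin] with ε hε
  have hB : MeasurableSet (Metric.ball c ε) := Metric.isOpen_ball.measurableSet
  have e1 : ∫ ζ in Ioo (c - (z - c)) (c + (z - c) / 3) \ Metric.ball c ε, modelSing z c ζ
      = ∫ ζ in Iio z \ Metric.ball c ε, (modelIoo z c).indicator (modelSing z c) ζ := by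
    rw [setIntegral_indicator measurableSet_modelIoo, sdiff_inter_right_comm,
      inter_eq_right.2 (modelIoo_subset hc), modelIoo]
  have hi : IntegrableOn ((modelIoo z c).indicator (modelSing z c)) (Iio z \ Metric.ball c ε) := by
    rw [integrableOn_indicator_iff measurableSet_modelIoo]
    refine (integrableOn_modelSing_diff hc hε).mono_set fun ζ hζ => ?_
    exact ⟨hζ.1, hζ.2.2⟩
  rw [e1, ← integral_const_mul, ← integral_add (hreg.mono_set sdiff_subset) (hi.const_mul _)]
  simp only [cauchyRegular, sub_add_cancel]

/-- The bound `|1 - exp (iμρ)| ≤ |μ ρ|` with `ρ = (ζ - c)/s` cancels the pole. -/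
lemma integrableOn_modelSing_mul (hc : c < z) (μ : ℝ) :
    IntegrableOn (fun ζ => modelSing z c ζ * (1 - recipPhase (z - c) z μ ζ)) (modelIoo z c) := by
  have hD : 0 < z - c := sub_pos.2 hc
  have hm : Measurable fun ζ => modelSing z c ζ * (1 - recipPhase (z - c) z μ ζ) := by fun_prop
  refine Measure.integrableOn_of_bounded
    (M := √(z - c) * |μ| / ((z - c) / 2) ^ 2)
    measure_Ioo_lt_top.ne hm.aestronglyMeasurable
    ((ae_restrict_iff' measurableSet_modelIoo).2 (ae_of_all _ fun ζ hζ => ?_))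
  have h1 : (z - c) / 2 ≤ z - ζ := by
    have : ζ < c + (z - c) / 3 := hζ.2
    linarith
  have hs : 0 < z - ζ := by linarith
  have h2 : ‖1 - recipPhase (z - c) z μ ζ‖ ≤ |μ| * (|c - ζ| / (z - ζ)) := by
    rw [norm_sub_rev, recipPhase, mul_comm (_ : ℂ) Complex.I]
    refine Real.norm_exp_I_mul_ofReal_sub_one_le.trans_eq ?_
    rw [Real.norm_eq_abs, abs_mul, show (z - c) / (z - ζ) - 1 = -(c - ζ) / (z - ζ) by
      field_simp; ring, abs_div, abs_neg, abs_of_pos hs]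
  rw [norm_mul]
  rcases eq_or_ne c ζ with rfl | hne
  · simp only [modelSing, sub_self, mul_zero, div_zero, Complex.ofReal_zero, norm_zero, zero_mul]
    positivity
  have hx : 0 < |c - ζ| := abs_pos.2 (sub_ne_zero.2 hne)
  calc _ ≤ √(z - c) / ((z - ζ) * |c - ζ|) * (|μ| * (|c - ζ| / (z - ζ))) := by
        refine mul_le_mul (le_of_eq ?_) h2 (norm_nonneg _) (by positivity)
        rw [modelSing, Complex.norm_real, norm_div, norm_mul,
          Real.norm_of_nonneg (Real.sqrt_nonneg _), Real.norm_of_nonneg hs.le, Real.norm_eq_abs]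
    _ = √(z - c) * |μ| / (z - ζ) ^ 2 := by
        field_simp
    _ ≤ _ := by gcongr

/-- Split into regular part and model: the former loses its oscillating term by
`tendsto_integral_mul_recipPhase`, the latter contributes by `tendsto_integral_modelSing_mul`. -/
lemma tendsto_integral_cauchyIntegrand_mul
    (hdata : IntegrableOn (fun ζ => v ζ / ((√(z - ζ) * (1 + (z - ζ)) : ℝ) : ℂ)) (Iio z))
    (hc : c < z) (hDini : DiniAt v c) :
    Tendsto (fun μ => ∫ ζ in Iio z,
      cauchyIntegrand z c v ζ * (1 - recipPhase (z - c) z μ ζ)) atTop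
      (𝓝 ((∫ ζ in Iio z, cauchyRegular z c v ζ)
        + v c * (Complex.I * Real.pi / (√(z - c) : ℝ)))) := by
  have hD : 0 < z - c := sub_pos.2 hc
  have hreg := integrableOn_cauchyRegular hdata hc hDini
  have hregE : ∀ μ, IntegrableOn (fun ζ => cauchyRegular z c v ζ * recipPhase (z - c) z μ ζ)
      (Iio z) := fun μ =>
    hreg.integrable.mul_bdd (c := 1) (measurable_recipPhase _ _ _).aestronglyMeasurable
      (ae_of_all _ fun ζ => (norm_recipPhase _ _ _ _).le)
  have h := ((tendsto_integral_mul_recipPhase z hD (cauchyRegular z c v)).const_sub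
    (∫ ζ in Iio z, cauchyRegular z c v ζ)).add
    ((tendsto_integral_modelSing_mul hc).const_mul (v c))
  rw [sub_zero] at h
  refine h.congr fun μ => ?_
  have e1 : ∫ ζ in Ioo (c - (z - c)) (c + (z - c) / 3),
      modelSing z c ζ * (1 - recipPhase (z - c) z μ ζ) = ∫ ζ in Iio z, (modelIoo z c).indicator
        (fun ζ => modelSing z c ζ * (1 - recipPhase (z - c) z μ ζ)) ζ := by
    rw [setIntegral_indicator measurableSet_modelIoo,
      inter_eq_right.2 (modelIoo_subset hc), modelIoo]
  have hi : IntegrableOn ((modelIoo z c).indicator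
      (fun ζ => modelSing z c ζ * (1 - recipPhase (z - c) z μ ζ))) (Iio z) := by
    rw [integrableOn_indicator_iff measurableSet_modelIoo]
    exact (integrableOn_modelSing_mul hc μ).mono_set inter_subset_left
  rw [e1, ← integral_const_mul, ← integral_sub hreg (hregE μ),
    ← integral_add (f := fun ζ => cauchyRegular z c v ζ
      - cauchyRegular z c v ζ * recipPhase (z - c) z μ ζ)
      (hreg.sub (hregE μ)) (hi.const_mul _)]
  refine integral_congr_ae (ae_of_all _ fun ζ => ?_)
  simp only [cauchyRegular]
  by_cases hI : ζ ∈ modelIoo z c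
  · rw [indicator_of_mem hI, indicator_of_mem hI]
    ring
  · rw [indicator_of_notMem hI, indicator_of_notMem hI]
    ring

end CauchyIntegral

/-! ### The formula for the half-plane. -/

section Representation

variable {k z c : ℝ} {V : ℝ × ℝ → ℂ} {v₀ : ℝ → ℂ}

lemma ofReal_mul_cpow_half {s : ℝ} (hs : 0 < s) {w : ℂ} (hw : w ≠ 0) :
    ((s : ℂ) * w) ^ (1 / 2 : ℂ) = (√s : ℂ) * w ^ (1 / 2 : ℂ) := by
  have e1 : (s : ℂ) ^ (1 / 2 : ℂ) = (√s : ℂ) := by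
    rw [Real.sqrt_eq_rpow, Complex.ofReal_cpow hs.le]
    norm_num
  have hsC : (s : ℂ) ≠ 0 := by exact_mod_cast hs.ne'
  rw [← e1, Complex.cpow_def_of_ne_zero (mul_ne_zero hsC hw), Complex.log_ofReal_mul hs hw,
    Complex.ofReal_log hs.le, add_mul, Complex.exp_add, ← Complex.cpow_def_of_ne_zero hsC,
    ← Complex.cpow_def_of_ne_zero hw]

lemma kernelAmp_eq_div_sqrt (hk : 0 < k) {s : ℝ} (hs : 0 < s) :
    kernelAmp k s = kernelAmp k 1 / (√s : ℂ) := by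
  have e : Complex.I * ((2 * Real.pi * s / k : ℝ) : ℂ)
      = (s : ℂ) * (Complex.I * ((2 * Real.pi * 1 / k : ℝ) : ℂ)) := by
    push_cast
    ring
  have h0 : Complex.I * ((2 * Real.pi * 1 / k : ℝ) : ℂ) ≠ 0 :=
    mul_ne_zero Complex.I_ne_zero (by exact_mod_cast (by positivity : 2 * Real.pi * 1 / k ≠ 0))
  rw [kernelAmp, kernelAmp, e, ofReal_mul_cpow_half hs h0, div_div, mul_comm]

/-- Normalization: the prefactor in the theorem is the inverse of the constant with which `v₀ c`
enters the limit. The factors of `√i` cancel because both roots are principal. -/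
lemma sqrt_mul_kernelAmp (hk : 0 < k) {D : ℝ} (hD : 0 < D) :
    (2 * k * Complex.I / (Real.pi * (D : ℂ))) ^ (1 / 2 : ℂ)
      * (D * kernelAmp k 1 / (Complex.I * k) * (Complex.I * Real.pi / (√D : ℂ))) = 1 := by
  have hpi := Real.pi_pos
  have e1 : 2 * k * Complex.I / (Real.pi * (D : ℂ))
      = ((2 * k / (Real.pi * D) : ℝ) : ℂ) * Complex.I := by
    push_cast
    ring
  have e2 : (k * √D) * √(2 * Real.pi * 1 / k) = √(2 * k / (Real.pi * D)) * D * Real.pi := by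
    have h1 : k * √D = √(k ^ 2 * D) := by
      rw [Real.sqrt_mul (by positivity), Real.sqrt_sq hk.le]
    have h2 : √(2 * k / (Real.pi * D)) * D * Real.pi
        = √(2 * k / (Real.pi * D)) * √((D * Real.pi) ^ 2) := by
      rw [Real.sqrt_sq (by positivity), mul_assoc]
    rw [h1, h2, ← Real.sqrt_mul (by positivity), ← Real.sqrt_mul (by positivity)]
    congr 1
    field_simp
  have e3 : ((k * √D) * √(2 * Real.pi * 1 / k) : ℂ) = √(2 * k / (Real.pi * D)) * D * Real.pi := by
    exact_mod_cast congrArg (fun x : ℝ => (x : ℂ)) e2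
  have hI : Complex.I ^ (1 / 2 : ℂ) ≠ 0 := by
    rw [Complex.cpow_ne_zero_iff]
    exact Or.inl Complex.I_ne_zero
  have hD' : (√D : ℂ) ≠ 0 := by exact_mod_cast (Real.sqrt_pos.2 hD).ne'
  have hk' : (k : ℂ) ≠ 0 := by exact_mod_cast hk.ne'
  have hs : (√(2 * Real.pi * 1 / k) : ℂ) ≠ 0 := by
    exact_mod_cast (Real.sqrt_pos.2 (by positivity : 0 < 2 * Real.pi * 1 / k)).ne'
  rw [e1, ofReal_mul_cpow_half (by positivity) Complex.I_ne_zero, kernelAmp,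
    mul_comm Complex.I ((2 * Real.pi * 1 / k : ℝ) : ℂ),
    ofReal_mul_cpow_half (by positivity) Complex.I_ne_zero]
  have e4 : ∀ a b p d i j κ r : ℂ, i ≠ 0 → j ≠ 0 → κ ≠ 0 → r ≠ 0 → b ≠ 0 →
      (κ * r) * b = a * d * p → a * j * (d * (1 / (b * j)) / (i * κ) * (i * p / r)) = 1 := by
    intro a b p d i j κ r hi hj hκ hr hb h
    field_simp
    linear_combination -h
  exact e4 _ _ _ _ _ _ _ _ Complex.I_ne_zero hI hk' hD' hs e3

theorem IsHalfPlaneField.exists_representation (hk : 0 < k) (hV : IsHalfPlaneField k z V v₀)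
    (hc : c < z) (hDini : DiniAt v₀ c) :
    ∃ P J : ℂ, HasPrincipalValue (cauchyIntegrand z c v₀) c (Iio z) P ∧
      HasImproperIntegral (fun x => V (x, z) * chirp (-(k / (2 * (z - c)))) x) 0 J ∧
      v₀ c - Complex.I / Real.pi * (√(z - c) : ℂ) * P
        = (2 * k * Complex.I / (Real.pi * ((z - c : ℝ) : ℂ))) ^ (1 / 2 : ℂ) * J := by
  have hD : 0 < z - c := sub_pos.2 hc
  set D := z - c with hDdef
  set P := ∫ ζ in Iio z, cauchyRegular z c v₀ ζ with hP
  -- The value is read off from the limit in `tendsto_integral_cauchyIntegrand_mul`; convergence of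
  -- the improper integral is thus a conclusion.
  set J := D * kernelAmp k 1 / (Complex.I * k) * (P + v₀ c * (Complex.I * Real.pi / (√D : ℝ)))
    with hJ
  have hkC : (k : ℂ) ≠ 0 := by exact_mod_cast hk.ne'
  refine ⟨P, J, hasPrincipalValue_cauchyIntegrand hV.data_integrable hc hDini, ⟨fun R hR => ?_, ?_⟩,
    ?_⟩
  · exact (hV.integrableOn_Ioc R).integrable.mul_bdd (c := 1)
      (continuous_chirp _).aestronglyMeasurable (ae_of_all _ fun x => (norm_chirp _ _).le)
  -- Truncation at `R` corresponds to the frequency `μ = kR²/(2D)` in the variable `ρ`.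
  · have hμ : Tendsto (fun R : ℝ => k / (2 * D) * R ^ 2) atTop atTop :=
      (tendsto_pow_atTop two_ne_zero).const_mul_atTop (by positivity)
    have h := ((tendsto_integral_cauchyIntegrand_mul hV.data_integrable hc hDini).comp
      hμ).const_mul (D * kernelAmp k 1 / (Complex.I * k))
    refine h.congr' ?_
    filter_upwards [eventually_gt_atTop 0] with R hR
    have hmain := hV.overlap_truncated hk hD hR
    rw [intervalIntegral.integral_of_le hR.le]
    have e : ∫ ζ in Iio z, v₀ ζ * (kernelAmp k (z - ζ) * (2 * D / (D - (z - ζ) : ℝ)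
        * (1 - chirp (k / (2 * (z - ζ)) - k / (2 * D)) R)))
        = -(2 * D * kernelAmp k 1) * ∫ ζ in Iio z, cauchyIntegrand z c v₀ ζ
          * (1 - recipPhase D z (k / (2 * D) * R ^ 2) ζ) := by
      rw [← integral_const_mul]
      refine setIntegral_congr_fun measurableSet_Iio fun ζ hζ => ?_
      have hs : 0 < z - ζ := sub_pos.2 hζ
      have e1 : chirp (k / (2 * (z - ζ)) - k / (2 * D)) R
          = recipPhase D z (k / (2 * D) * R ^ 2) ζ := by
        rw [chirp, recipPhase]
        congr 3
        field_simp
      have e2 : ((D - (z - ζ) : ℝ) : ℂ) = -((c - ζ : ℝ) : ℂ) := by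
        rw [hDdef]; push_cast; ring
      simp only [kernelAmp_eq_div_sqrt hk hs, e1, e2, cauchyIntegrand]
      ring
    rw [e] at hmain
    simp only [Function.comp]
    have e3 : ∀ a b i κ d p : ℂ, i ≠ 0 → κ ≠ 0 → -(2 * i * κ) * b = -(2 * d * p) * a →
        d * p / (i * κ) * a = b := by
      intro a b i κ d p hi hκ h
      field_simp
      linear_combination (1 / 2 : ℂ) * h
    exact e3 _ _ _ _ _ _ Complex.I_ne_zero hkC hmain
  · have h := sqrt_mul_kernelAmp hk hD
    have hs : (√D : ℂ) ≠ 0 := by exact_mod_cast (Real.sqrt_pos.2 hD).ne'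
    have hpi : (Real.pi : ℂ) ≠ 0 := by exact_mod_cast Real.pi_ne_zero
    have e : P + v₀ c * (Complex.I * Real.pi / (√D : ℝ))
        = Complex.I * Real.pi / (√D : ℂ) * (v₀ c - Complex.I / Real.pi * (√D : ℂ) * P) := by
      field_simp
      linear_combination (P * (√D : ℂ)) * Complex.I_sq
    rw [hJ, e]
    linear_combination (-(v₀ c - Complex.I / Real.pi * (√D : ℂ) * P)) * h

end Representation

/-! ### Galilean covariance of the parabolic equation. -/

section Galilean

variable {k T z : ℝ} {u : ℝ × ℝ → ℂ} {u₀ : ℝ → ℂ}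

/-- The phase of the Galilean transformation `y = x + T ζ` of the parabolic equation. -/
def galileanPhase (k T : ℝ) (p : ℝ × ℝ) : ℂ :=
  Complex.exp ((k * T * p.1 - k * T ^ 2 * p.2 / 2 : ℝ) * Complex.I)

lemma norm_galileanPhase (k T : ℝ) (p : ℝ × ℝ) : ‖galileanPhase k T p‖ = 1 :=
  Complex.norm_exp_ofReal_mul_I _

lemma contDiff_galileanPhase (k T : ℝ) : ContDiff ℝ ∞ (galileanPhase k T) := by
  unfold galileanPhase
  refine ((Complex.ofRealCLM.contDiff.comp (ContDiff.sub ?_ ?_)).mul contDiff_const).cexp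
  · exact contDiff_const.mul contDiff_fst
  · exact (contDiff_const.mul contDiff_snd).div_const _

@[fun_prop]
lemma continuous_galileanPhase (k T : ℝ) : Continuous (galileanPhase k T) :=
  (contDiff_galileanPhase k T).continuous

lemma hasDerivAt_galileanPhase_fst (k T ζ x : ℝ) :
    HasDerivAt (fun x => galileanPhase k T (x + T * ζ, ζ))
      (Complex.I * k * T * galileanPhase k T (x + T * ζ, ζ)) x := by
  have h : HasDerivAt (fun x : ℝ => k * T * (x + T * ζ) - k * T ^ 2 * ζ / 2) (k * T) x := by
    simpa using (((hasDerivAt_id x).add_const (T * ζ)).const_mul (k * T)).sub_const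
      (k * T ^ 2 * ζ / 2)
  refine ((h.ofReal_comp.mul_const Complex.I).cexp).congr_deriv ?_
  simp only [galileanPhase]
  push_cast
  ring

lemma hasDerivAt_galileanPhase_snd (k T x ζ : ℝ) :
    HasDerivAt (fun ζ => galileanPhase k T (x + T * ζ, ζ))
      (Complex.I * k * T ^ 2 / 2 * galileanPhase k T (x + T * ζ, ζ)) ζ := by
  have h : HasDerivAt (fun ζ : ℝ => k * T * (x + T * ζ) - k * T ^ 2 * ζ / 2)
      (k * T ^ 2 / 2) ζ := by
    refine ((((hasDerivAt_id ζ).const_mul T).const_add x |>.const_mul (k * T)).sub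
      (((hasDerivAt_id ζ).const_mul (k * T ^ 2)).div_const 2)).congr_deriv ?_
    ring
  refine ((h.ofReal_comp.mul_const Complex.I).cexp).congr_deriv ?_
  simp only [galileanPhase]
  push_cast
  ring

/-- The shear `(x, ζ) ↦ (x + T ζ, ζ)`. -/
def shear (T : ℝ) : ℝ × ℝ ≃ₜ ℝ × ℝ where
  toFun p := (p.1 + T * p.2, p.2)
  invFun p := (p.1 - T * p.2, p.2)
  left_inv p := by simp
  right_inv p := by simp
  continuous_toFun := by fun_prop
  continuous_invFun := by fun_prop

lemma measurePreserving_shear (T : ℝ) : MeasurePreserving (shear T) := by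
  -- Skew products have the base as first coordinate, hence the swaps.
  have h : MeasurePreserving (fun p : ℝ × ℝ => (p.1, p.2 + T * p.1)) := by
    refine (MeasurePreserving.id volume).skew_product (g := fun ζ x => x + T * ζ)
      (by fun_prop) (ae_of_all _ fun ζ => ?_)
    exact (measurePreserving_add_right volume (T * ζ)).map_eq
  exact Measure.measurePreserving_swap.comp (h.comp Measure.measurePreserving_swap)

lemma contDiff_shear (T : ℝ) : ContDiff ℝ ∞ (shear T) :=
  (contDiff_fst.add (contDiff_const.mul contDiff_snd)).prodMk contDiff_snd

/-- Along the shear the `ζ`-derivative produces `-2ikT φ_y`, which the cross term of the second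
`x`-derivative cancels; the terms `±k²T² φ` cancel as well. -/
lemma parabolic_shear {φ : ℝ × ℝ → ℂ} (hφ : ContDiff ℝ ∞ φ) (x ζ : ℝ) :
    -(2 * Complex.I * k) * deriv (fun η => φ (x + T * η, η) * galileanPhase k T (x + T * η, η)) ζ
      + iteratedDeriv 2 (fun x => φ (x + T * ζ, ζ) * galileanPhase k T (x + T * ζ, ζ)) x
    = galileanPhase k T (x + T * ζ, ζ) * (-(2 * Complex.I * k)
        * deriv (fun η => φ (x + T * ζ, η)) ζ
      + iteratedDeriv 2 (fun y => φ (y, ζ)) (x + T * ζ)) := by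
  have hd : Differentiable ℝ φ := hφ.differentiable (by simp)
  set f : ℝ → ℂ := fun y => φ (y, ζ) with hf
  have hfs : ContDiff ℝ ∞ f := hφ.comp (contDiff_id.prodMk contDiff_const)
  have hf1 : ∀ y, HasDerivAt f (deriv f y) y := fun y =>
    (hfs.differentiable (by simp) y).hasDerivAt
  have hf2 : ∀ y, HasDerivAt (deriv f) (deriv (deriv f) y) y := fun y =>
    ((contDiff_infty_iff_deriv.1 hfs).2.differentiable (by simp) y).hasDerivAt
  have hx1 : ∀ x, HasDerivAt (fun x => φ (x + T * ζ, ζ)) (deriv f (x + T * ζ)) x := fun x =>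
    (hf1 (x + T * ζ)).comp_add_const x (T * ζ)
  have hx2 : ∀ x, HasDerivAt (fun x => deriv f (x + T * ζ)) (deriv (deriv f) (x + T * ζ)) x :=
    fun x => (hf2 (x + T * ζ)).comp_add_const x (T * ζ)
  have hg := fun x => hasDerivAt_galileanPhase_fst k T ζ x
  have e1 : deriv (fun x => φ (x + T * ζ, ζ) * galileanPhase k T (x + T * ζ, ζ))
      = fun x => deriv f (x + T * ζ) * galileanPhase k T (x + T * ζ, ζ)
        + φ (x + T * ζ, ζ) * (Complex.I * k * T * galileanPhase k T (x + T * ζ, ζ)) :=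
    funext fun x => ((hx1 x).mul (hg x)).deriv
  have e2 := (((hx2 x).mul (hg x)).add ((hx1 x).mul ((hg x).const_mul (Complex.I * k * T)))).deriv
  have hF := (hd (x + T * ζ, ζ)).hasFDerivAt
  have hs1 : deriv f (x + T * ζ) = fderiv ℝ φ (x + T * ζ, ζ) (1, 0) :=
    (HasFDerivAt.comp_hasDerivAt (x + T * ζ) hF
      ((hasDerivAt_id (x + T * ζ)).prodMk (hasDerivAt_const (x + T * ζ) ζ))).deriv
  have hs2 : deriv (fun η => φ (x + T * ζ, η)) ζ = fderiv ℝ φ (x + T * ζ, ζ) (0, 1) :=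
    (HasFDerivAt.comp_hasDerivAt ζ hF
      ((hasDerivAt_const ζ (x + T * ζ)).prodMk (hasDerivAt_id ζ))).deriv
  have hlin : HasDerivAt (fun η : ℝ => x + T * η) T ζ := by
    simpa using ((hasDerivAt_id ζ).const_mul T).const_add x
  have hs3 : HasDerivAt (fun η => φ (x + T * η, η)) (fderiv ℝ φ (x + T * ζ, ζ) (T, 1)) ζ :=
    HasFDerivAt.comp_hasDerivAt ζ hF (hlin.prodMk (hasDerivAt_id ζ))
  have hvec : fderiv ℝ φ (x + T * ζ, ζ) (T, 1)
      = T * deriv f (x + T * ζ) + deriv (fun η => φ (x + T * ζ, η)) ζ := by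
    have : ((T, 1) : ℝ × ℝ) = T • (1, 0) + (0, 1) := by simp
    rw [this, map_add, map_smul, ← hs1, ← hs2, Complex.real_smul]
  have e3 := (hs3.mul (hasDerivAt_galileanPhase_snd k T x ζ)).deriv
  have e4 : iteratedDeriv 2 f (x + T * ζ) = deriv (deriv f) (x + T * ζ) := by
    rw [iteratedDeriv_succ, iteratedDeriv_one]
  rw [iteratedDeriv_succ, iteratedDeriv_one, e1, e4]
  erw [e2, e3]
  rw [hvec]
  ring

end Galilean

/-! ### From the inclined line to the half-plane. -/

section Reduction

variable {k T z θ : ℝ} {u : ℝ × ℝ → ℂ} {u₀ : ℝ → ℂ}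

/-- The amplitude in the coordinates `y = x + T ζ`, in which the line is `y = 0`. -/
def galileanField (k T : ℝ) (u : ℝ × ℝ → ℂ) (p : ℝ × ℝ) : ℂ :=
  u (p.1 - T * p.2, p.2) * galileanPhase k T p

/-- The data in the coordinates `y = x + T ζ`. -/
def galileanData (k T : ℝ) (u₀ : ℝ → ℂ) (ζ : ℝ) : ℂ := u₀ ζ * galileanPhase k T (0, ζ)

lemma galileanField_comp_shear (p : ℝ × ℝ) :
    galileanField k T u (shear T p) = u p * galileanPhase k T (shear T p) := by
  simp [galileanField, shear]

/-- A test function is pulled back by the shear and multiplied by the phase; the shear preserves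
Lebesgue measure. -/
lemma isWeakParabolicSolution_galileanField {D : Set (ℝ × ℝ)}
    (h : IsWeakParabolicSolution k u (shear T ⁻¹' D)) :
    IsWeakParabolicSolution k (galileanField k T u) D := by
  intro φ hφ hφc hφD
  have hψ : ContDiff ℝ ∞ fun p => φ (shear T p) * galileanPhase k T (shear T p) :=
    (hφ.comp (contDiff_shear T)).mul ((contDiff_galileanPhase k T).comp (contDiff_shear T))
  have hc : HasCompactSupport (φ ∘ shear T) := hφc.comp_homeomorph (shear T)
  have hsub : tsupport (fun p => φ (shear T p) * galileanPhase k T (shear T p))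
      ⊆ shear T ⁻¹' D := by
    refine (tsupport_mul_subset_left (f := fun p => φ (shear T p))).trans ?_
    refine (tsupport_comp_subset_preimage φ (shear T).continuous).trans (preimage_mono hφD)
  have key := h _ hψ (hc.mul_right (f' := fun p => galileanPhase k T (shear T p))) hsub
  rw [← (measurePreserving_shear T).integral_comp (shear T).measurableEmbedding, ← key]
  refine integral_congr_ae (ae_of_all _ fun p => ?_)
  have := parabolic_shear (k := k) (T := T) hφ p.1 p.2
  simp only [galileanField_comp_shear]
  simp only [shear, Homeomorph.homeomorph_mk_coe, Equiv.coe_fn_mk] at this ⊢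
  rw [this]
  ring

/-- Shifting the frequency by `kT` and completing the square gives the boosted packet. This carries
the radiation condition from one frame to the other. -/
lemma wavePacket_compSub (hk : 0 < k) (a : SchwartzMap ℝ ℂ) (x ζ : ℝ) :
    wavePacket k (SchwartzMap.compSubConstCLM ℂ (-(k * T)) a) (x, ζ)
      = conj (galileanPhase k T (x + T * ζ, ζ)) * wavePacket k a (x + T * ζ, ζ) := by
  have hk' : (k : ℂ) ≠ 0 := by exact_mod_cast hk.ne'
  rw [wavePacket_eq, wavePacket_eq, ← integral_add_right_eq_self _ (-(k * T)),
    ← integral_const_mul]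
  refine integral_congr_ae (ae_of_all _ fun q => ?_)
  simp only [SchwartzMap.compSubConstCLM_apply, planeWave, galileanPhase]
  rw [← Complex.exp_conj, mul_left_comm, ← Complex.exp_add]
  congr 2
  · ring
  · rw [map_mul, Complex.conj_I, Complex.conj_ofReal]
    push_cast
    field_simp
    ring

lemma setIntegral_Ioi_sub (f : ℝ → ℂ) (c : ℝ) :
    ∫ x in Ioi (-c), f x = ∫ y in Ioi (0 : ℝ), f (y - c) := by
  rw [← (measurePreserving_sub_right volume c).setIntegral_preimage_emb
    (measurableEmbedding_subRight c)]
  simp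

lemma setLIntegral_Ioi_sub (f : ℝ → ENNReal) (c : ℝ) :
    ∫⁻ x in Ioi (-c), f x = ∫⁻ y in Ioi (0 : ℝ), f (y - c) := by
  rw [← (measurePreserving_sub_right volume c).setLIntegral_comp_preimage_emb
    (measurableEmbedding_subRight c)]
  simp

/-- The second term is the change of phase between the line and distance `y`, which is of order `y`.
-/
lemma galileanField_sub_galileanData (y ζ : ℝ) :
    ‖galileanField k T u (y, ζ) - galileanData k T u₀ ζ‖ₑ
      ≤ ‖u (y - ζ * T, ζ) - u₀ ζ‖ₑ + ENNReal.ofReal |k * T * y| * ‖u₀ ζ‖ₑ := by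
  have e1 : galileanPhase k T (y, ζ)
      = Complex.exp (Complex.I * (k * T * y : ℝ)) * galileanPhase k T (0, ζ) := by
    rw [galileanPhase, galileanPhase, ← Complex.exp_add]
    congr 1
    push_cast
    ring
  have e2 : galileanField k T u (y, ζ) - galileanData k T u₀ ζ
      = (u (y - ζ * T, ζ) - u₀ ζ) * galileanPhase k T (y, ζ)
        + (Complex.exp (Complex.I * (k * T * y : ℝ)) - 1) * u₀ ζ * galileanPhase k T (0, ζ) := by
    rw [galileanField, galileanData, e1, mul_comm T]
    ring
  rw [e2]
  refine (enorm_add_le _ _).trans (add_le_add ?_ ?_)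
  · rw [enorm_mul, ← ofReal_norm (galileanPhase k T (y, ζ)), norm_galileanPhase]
    simp
  · rw [enorm_mul, enorm_mul, ← ofReal_norm (galileanPhase k T (0, ζ)), norm_galileanPhase,
      ENNReal.ofReal_one, mul_one]
    gcongr
    rw [← ofReal_norm]
    exact ENNReal.ofReal_le_ofReal Real.norm_exp_I_mul_ofReal_sub_one_le

theorem IsFieldOfInclinedLine.isHalfPlaneField (hk : 0 < k)
    (hu : IsFieldOfInclinedLine k θ z u u₀) :
    IsHalfPlaneField k z (galileanField k (Real.tan θ) u) (galileanData k (Real.tan θ) u₀) where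
  continuousOn := by
    refine ContinuousOn.mul (hu.continuousOn.comp (by fun_prop) fun p hp => ?_) (by fun_prop)
    refine ⟨?_, hp.2⟩
    have := hp.1
    simp only
    linarith [mul_comm (Real.tan θ) p.2]
  equation := by
    refine isWeakParabolicSolution_galileanField ?_
    have e : shear (Real.tan θ) ⁻¹' {p : ℝ × ℝ | 0 < p.1 ∧ p.2 < z}
        = {p : ℝ × ℝ | 0 < p.1 + p.2 * Real.tan θ ∧ p.2 < z} := by
      ext p
      simp [shear, mul_comm]
    rw [e]
    exact hu.equation
  growth := fun a ha => by
    obtain ⟨N, C, hC⟩ := hu.growth a ha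
    refine ⟨N, C, fun ζ hζ => ?_⟩
    have h := hC ζ hζ
    rw [neg_mul, setLIntegral_Ioi_sub] at h
    simpa [galileanField, norm_galileanPhase, mul_comm] using h
  trace := fun a ha => by
    have hi := integrableOn_of_div_weight hu.data_integrable a
    have hfin : ∫⁻ ζ in Ioo a z, ‖u₀ ζ‖ₑ ≠ ⊤ := hi.2.ne
    have h0 : Tendsto (fun y : ℝ => ENNReal.ofReal |k * Real.tan θ * y|
        * ∫⁻ ζ in Ioo a z, ‖u₀ ζ‖ₑ) (𝓝[>] 0) (𝓝 0) := by
      have h1 : Tendsto (fun y : ℝ => ENNReal.ofReal |k * Real.tan θ * y|) (𝓝[>] 0) (𝓝 0) := by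
        have hc : Continuous fun y : ℝ => ENNReal.ofReal |k * Real.tan θ * y| :=
          ENNReal.continuous_ofReal.comp (by fun_prop)
        have := hc.tendsto 0
        simp only [mul_zero, abs_zero, ENNReal.ofReal_zero] at this
        exact this.mono_left nhdsWithin_le_nhds
      simpa using ENNReal.Tendsto.mul_const h1 (Or.inr hfin)
    have hsum := (hu.trace a ha).add h0
    rw [add_zero] at hsum
    refine tendsto_of_tendsto_of_tendsto_of_le_of_le tendsto_const_nhds hsum
      (fun _ => bot_le) fun y => ?_
    refine (lintegral_mono fun ζ => galileanField_sub_galileanData y ζ).trans ?_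
    rw [lintegral_add_right' _ (hi.aestronglyMeasurable.enorm.const_mul _),
      lintegral_const_mul' _ _ ENNReal.ofReal_ne_top]
  data_integrable := by
    have hc : Continuous fun ζ : ℝ => galileanPhase k (Real.tan θ) (0, ζ) := by fun_prop
    refine (hu.data_integrable.integrable.bdd_mul (c := 1) hc.aestronglyMeasurable
      (ae_of_all _ fun ζ => (norm_galileanPhase _ _ _).le)).congr (ae_of_all _ fun ζ => ?_)
    simp only [galileanData]
    ring
  radiation := fun a ha => by
    -- A packet with odd spectrum in the new frame becomes one that vanishes on the inclined line.
    have h := hu.radiation (SchwartzMap.compSubConstCLM ℂ (-(k * Real.tan θ)) a) fun ζ => by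
      rw [wavePacket_compSub hk, show -ζ * Real.tan θ + Real.tan θ * ζ = 0 by ring,
        wavePacket_zero_of_odd ha, mul_zero]
    refine h.congr fun ζ => ?_
    rw [neg_mul, setIntegral_Ioi_sub]
    refine setIntegral_congr_fun measurableSet_Ioi fun y _ => ?_
    simp only [galileanField]
    rw [wavePacket_compSub hk, mul_comm ζ, sub_add_cancel, map_mul, Complex.conj_conj]
    ring

/-- The phase is Lipschitz in `ζ`, so its own difference quotient is bounded. -/
lemma DiniAt.galileanData {c : ℝ} (h : DiniAt u₀ c) : DiniAt (galileanData k T u₀) c := by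
  obtain ⟨S, hS, hSint⟩ := h
  have hball : Metric.ball c 1 ∈ 𝓝 c := Metric.ball_mem_nhds c one_pos
  refine ⟨S ∩ Metric.ball c 1, inter_mem hS hball, ?_⟩
  have hc : Continuous fun ζ : ℝ => galileanPhase k T (0, ζ) := by fun_prop
  have h1 : IntegrableOn (fun ζ => galileanPhase k T (0, ζ)
      * ((u₀ ζ - u₀ c) / ((ζ - c : ℝ) : ℂ))) (S ∩ Metric.ball c 1) :=
    (hSint.mono_set inter_subset_left).integrable.bdd_mul (c := 1) hc.aestronglyMeasurable
      (ae_of_all _ fun ζ => (norm_galileanPhase _ _ _).le)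
  have h2 : IntegrableOn (fun ζ => u₀ c * ((galileanPhase k T (0, ζ) - galileanPhase k T (0, c))
      / ((ζ - c : ℝ) : ℂ))) (S ∩ Metric.ball c 1) := by
    refine Integrable.const_mul ?_ _
    have hm : Measurable fun ζ : ℝ => (galileanPhase k T (0, ζ) - galileanPhase k T (0, c))
        / ((ζ - c : ℝ) : ℂ) := (hc.measurable.sub_const _).div (by fun_prop)
    refine Measure.integrableOn_of_bounded (M := |k * T ^ 2 / 2|)
      ((measure_mono inter_subset_right).trans_lt measure_ball_lt_top).ne
      hm.aestronglyMeasurable (ae_of_all _ fun ζ => ?_)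
    rcases eq_or_ne ζ c with rfl | hne
    · simp
    rw [norm_div, Complex.norm_real, Real.norm_eq_abs, div_le_iff₀ (abs_pos.2 (sub_ne_zero.2 hne))]
    have e : galileanPhase k T (0, ζ) - galileanPhase k T (0, c)
        = (Complex.exp (Complex.I * (-(k * T ^ 2 / 2) * (ζ - c) : ℝ)) - 1)
          * galileanPhase k T (0, c) := by
      rw [sub_mul, one_mul, galileanPhase, galileanPhase, ← Complex.exp_add]
      congr 2
      push_cast
      ring
    rw [e, norm_mul, norm_galileanPhase, mul_one]
    refine Real.norm_exp_I_mul_ofReal_sub_one_le.trans_eq ?_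
    rw [Real.norm_eq_abs, abs_mul, abs_neg]
  refine (h1.add h2).congr (ae_of_all _ fun ζ => ?_)
  simp only [Pi.add_apply, _root_.galileanData]
  ring

end Reduction

/-! ### Returning to the original coordinates. -/

section Final

variable {f g : ℝ → ℂ} {S : Set ℝ} {c : ℝ} {P : ℂ}

lemma HasPrincipalValue.const_mul (h : HasPrincipalValue f c S P) (w : ℂ) :
    HasPrincipalValue (fun ζ => w * f ζ) c S (w * P) := by
  refine ⟨fun ε hε => (h.1 ε hε).const_mul w, ?_⟩
  simp only [integral_const_mul]
  exact h.2.const_mul w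

lemma HasPrincipalValue.congr (h : HasPrincipalValue f c S P) (hS : MeasurableSet S)
    (hfg : EqOn f g S) : HasPrincipalValue g c S P := by
  have hm : ∀ ε : ℝ, MeasurableSet (S \ Metric.ball c ε) := fun ε =>
    hS.diff Metric.isOpen_ball.measurableSet
  refine ⟨fun ε hε => (h.1 ε hε).congr_fun (hfg.mono sdiff_subset) (hm ε), ?_⟩
  refine h.2.congr fun ε => ?_
  exact setIntegral_congr_fun (hm ε) (hfg.mono sdiff_subset)

lemma HasPrincipalValue.comp_neg (h : HasPrincipalValue f (-c) (Iio 0) P) :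
    HasPrincipalValue (fun μ => f (-μ)) c (Ioi 0) P := by
  have e : ∀ ε : ℝ, Ioi 0 \ Metric.ball c ε = Neg.neg ⁻¹' (Iio 0 \ Metric.ball (-c) ε) :=
    fun ε => by
      ext μ
      simp only [Set.mem_sdiff, mem_Ioi, Metric.mem_ball, mem_preimage, mem_Iio, dist_neg_neg,
        Left.neg_neg_iff]
  have hp := Measure.measurePreserving_neg (volume : Measure ℝ)
  have hemb : MeasurableEmbedding (Neg.neg : ℝ → ℝ) := (Homeomorph.neg ℝ).measurableEmbedding
  constructor
  · intro ε hε
    rw [e]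
    exact (hp.integrableOn_comp_preimage hemb).2 (h.1 ε hε)
  · refine h.2.congr fun ε => ?_
    rw [e]
    exact (hp.setIntegral_preimage_emb hemb f _).symm

lemma HasImproperIntegral.of_sub {a : ℝ} {J w : ℂ} (h : HasImproperIntegral f 0 J)
    (hfg : ∀ x, 0 < x → g (x - a) = w * f x) : HasImproperIntegral g (-a) (w * J) := by
  have hg : ∀ R, -a < R → IntervalIntegrable g volume (-a) R := fun R hR => by
    have h1 : IntervalIntegrable (fun x => w * f x) volume 0 (R + a) := by
      rw [intervalIntegrable_iff_integrableOn_Ioc_of_le (by linarith)]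
      exact (h.1 (R + a) (by linarith)).const_mul w
    have h2 : IntervalIntegrable (fun x => g (x - a)) volume 0 (R + a) := by
      refine h1.congr fun x hx => ?_
      rw [uIoc_of_le (by linarith)] at hx
      exact (hfg x hx.1).symm
    simpa using h2.comp_add_right a
  refine ⟨fun R hR => ?_, ?_⟩
  · rw [← intervalIntegrable_iff_integrableOn_Ioc_of_le hR.le]
    exact hg R hR
  · have ht : Tendsto (fun R : ℝ => R + a) atTop atTop := tendsto_atTop_add_const_right _ _ tendsto_id
    refine ((h.2.comp ht).const_mul w).congr' ?_
    filter_upwards [eventually_gt_atTop (-a)] with R hR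
    have e : ∫ x in (-a)..R, g x = ∫ x in (0 : ℝ)..(R + a), g (x - a) := by
      rw [intervalIntegral.integral_comp_sub_right]
      simp
    rw [Function.comp, e, ← intervalIntegral.integral_const_mul]
    refine intervalIntegral.integral_congr_ae (ae_of_all _ fun x hx => ?_)
    rw [uIoc_of_le (by linarith)] at hx
    exact (hfg x hx.1).symm

theorem IsFieldOfInclinedLine.exists_representation {k θ z : ℝ} {u : ℝ × ℝ → ℂ} {u₀ : ℝ → ℂ}
    (hk : 0 < k) (hu : IsFieldOfInclinedLine k θ z u u₀) (hc : c < z) (hDini : DiniAt u₀ c) :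
    ∃ P J : ℂ,
      HasPrincipalValue
        (fun ζ : ℝ => u₀ ζ / ((c - ζ : ℝ) : ℂ)
          * Complex.exp (Complex.I * k / 2 * (Real.tan θ : ℂ) ^ 2 * ((c - ζ : ℝ) : ℂ))
          / (Real.sqrt (z - ζ) : ℂ))
        c (Set.Iio z) P ∧
      HasImproperIntegral
        (fun x' : ℝ => u (x', z)
          * Complex.exp (-(Complex.I * k * ((x' + c * Real.tan θ : ℝ) : ℂ) ^ 2
              / (2 * ((z - c : ℝ) : ℂ)))))
        (-z * Real.tan θ) J ∧
      u₀ c - Complex.I / Real.pi * (Real.sqrt (z - c) : ℂ) * P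
        = (2 * k * Complex.I / (Real.pi * ((z - c : ℝ) : ℂ))) ^ (1 / 2 : ℂ) * J := by
  obtain ⟨P, J, hP, hJ, heq⟩ := (hu.isHalfPlaneField hk).exists_representation hk hc
    hDini.galileanData
  set T := Real.tan θ with hT
  have hD : ((z - c : ℝ) : ℂ) ≠ 0 := by exact_mod_cast (sub_pos.2 hc).ne'
  -- The inverse of the phase at `(0, c)`. Multiplying the half-plane identity by it refers all
  -- phases to `c`.
  set w := Complex.exp (Complex.I * k / 2 * (T : ℂ) ^ 2 * (c : ℂ)) with hw
  have hwc : w * galileanPhase k T (0, c) = 1 := by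
    rw [hw, galileanPhase, ← Complex.exp_add, ← Complex.exp_zero]
    congr 1
    push_cast
    ring
  refine ⟨w * P, w * J, (hP.const_mul w).congr measurableSet_Iio fun ζ _ => ?_, ?_, ?_⟩
  · simp only [cauchyIntegrand, galileanData]
    have e : w * galileanPhase k T (0, ζ)
        = Complex.exp (Complex.I * k / 2 * (T : ℂ) ^ 2 * ((c - ζ : ℝ) : ℂ)) := by
      rw [hw, galileanPhase, ← Complex.exp_add]
      congr 1
      push_cast
      ring
    rw [← e]
    ring
  · rw [neg_mul]
    refine hJ.of_sub fun x _ => ?_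
    have e : Complex.exp (-(Complex.I * k * ((x - z * T + c * T : ℝ) : ℂ) ^ 2
        / (2 * ((z - c : ℝ) : ℂ))))
        = w * (galileanPhase k T (x, z) * chirp (-(k / (2 * (z - c)))) x) := by
      rw [hw, galileanPhase, chirp, ← Complex.exp_add, ← Complex.exp_add]
      congr 1
      push_cast at hD ⊢
      field_simp
      ring
    rw [e]
    simp only [galileanField]
    rw [mul_comm T z]
    ring
  · have e : u₀ c = w * galileanData k T u₀ c := by
      rw [galileanData, mul_left_comm, hwc, mul_one]
    rw [e]
    linear_combination w * heq

end Final

end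

theorem mainTheorem1 (k : ℝ) (hk : 0 < k) :
    (∀ (θ z : ℝ) (u : ℝ × ℝ → ℂ) (u₀ : ℝ → ℂ), θ ∈ Set.Ioo (-(Real.pi / 2)) (Real.pi / 2) →
      IsFieldOfInclinedLine k θ z u u₀ →
      ∀ z'' : ℝ, z'' < z → DiniAt u₀ z'' →
        ∃ P J : ℂ,
          HasPrincipalValue
            (fun ζ : ℝ => u₀ ζ / ((z'' - ζ : ℝ) : ℂ)
              * Complex.exp (Complex.I * k / 2 * (Real.tan θ : ℂ) ^ 2 * ((z'' - ζ : ℝ) : ℂ))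
              / (Real.sqrt (z - ζ) : ℂ))
            z'' (Set.Iio z) P ∧
          HasImproperIntegral
            (fun x' : ℝ => u (x', z)
              * Complex.exp (-(Complex.I * k * ((x' + z'' * Real.tan θ : ℝ) : ℂ) ^ 2
                  / (2 * ((z - z'' : ℝ) : ℂ)))))
            (-z * Real.tan θ) J ∧
          u₀ z'' - Complex.I / Real.pi * (Real.sqrt (z - z'') : ℂ) * P
            = (2 * k * Complex.I / (Real.pi * ((z - z'' : ℝ) : ℂ))) ^ (1 / 2 : ℂ) * J) ∧
    (∀ (z : ℝ) (u : ℝ × ℝ → ℂ) (u₀ : ℝ → ℂ),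
      IsFieldOfInclinedLine k 0 z u u₀ →
      ∀ z'' : ℝ, z'' < z → DiniAt u₀ z'' →
        ∃ P J : ℂ,
          HasPrincipalValue
            (fun ζ : ℝ => u₀ ζ / ((z'' - ζ : ℝ) : ℂ) / (Real.sqrt (z - ζ) : ℂ))
            z'' (Set.Iio z) P ∧
          HasImproperIntegral
            (fun x' : ℝ => u (x', z)
              * Complex.exp (-(Complex.I * k * (x' : ℂ) ^ 2 / (2 * ((z - z'' : ℝ) : ℂ)))))
            0 J ∧
          u₀ z'' - Complex.I / Real.pi * (Real.sqrt (z - z'') : ℂ) * P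
            = (2 * k * Complex.I / (Real.pi * ((z - z'' : ℝ) : ℂ))) ^ (1 / 2 : ℂ) * J) ∧
    (∀ (u : ℝ × ℝ → ℂ) (u₀ v : ℝ → ℂ),
      IsFieldOfInclinedLine k 0 0 u u₀ →
      (∀ t : ℝ, 0 < t → v t = u₀ (-t) / (Real.sqrt t : ℂ)) →
      ∀ t : ℝ, 0 < t → DiniAt u₀ (-t) →
        ∃ P J : ℂ,
          HasPrincipalValue (fun μ : ℝ => v μ / ((μ - t : ℝ) : ℂ)) t (Set.Ioi 0) P ∧
          HasImproperIntegral
            (fun x' : ℝ => u (x', 0)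
              * Complex.exp (-(Complex.I * k * (x' : ℂ) ^ 2 / (2 * (t : ℂ)))))
            0 J ∧
          v t + 1 / (Real.pi * Complex.I) * P
            = (2 * k * Complex.I / Real.pi) ^ (1 / 2 : ℂ) * (1 / (t : ℂ)) * J) := by
  have part2 : ∀ (z : ℝ) (u : ℝ × ℝ → ℂ) (u₀ : ℝ → ℂ),
      IsFieldOfInclinedLine k 0 z u u₀ →
      ∀ z'' : ℝ, z'' < z → DiniAt u₀ z'' →
        ∃ P J : ℂ,
          HasPrincipalValue
            (fun ζ : ℝ => u₀ ζ / ((z'' - ζ : ℝ) : ℂ) / (Real.sqrt (z - ζ) : ℂ))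
            z'' (Set.Iio z) P ∧
          HasImproperIntegral
            (fun x' : ℝ => u (x', z)
              * Complex.exp (-(Complex.I * k * (x' : ℂ) ^ 2 / (2 * ((z - z'' : ℝ) : ℂ)))))
            0 J ∧
          u₀ z'' - Complex.I / Real.pi * (Real.sqrt (z - z'') : ℂ) * P
            = (2 * k * Complex.I / (Real.pi * ((z - z'' : ℝ) : ℂ))) ^ (1 / 2 : ℂ) * J := by
    intro z u u₀ hu z'' hz hDini
    simpa only [Real.tan_zero, Complex.ofReal_zero, ne_eq, OfNat.ofNat_ne_zero, not_false_eq_true,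
      zero_pow, mul_zero, zero_mul, Complex.exp_zero, mul_one, add_zero] using
      hu.exists_representation hk hz hDini
  refine ⟨fun θ z u u₀ _ hu z'' hz hDini => hu.exists_representation hk hz hDini, part2, ?_⟩
  intro u u₀ v hu hv t ht hDini
  obtain ⟨P, J, hP, hJ, heq⟩ := part2 0 u u₀ hu (-t) (neg_lt_zero.2 ht) hDini
  have ht' : (0 : ℝ) - -t = t := by ring
  rw [ht'] at heq hJ
  refine ⟨P, J, hP.comp_neg.congr measurableSet_Ioi fun μ hμ => ?_, hJ, ?_⟩
  · simp only
    rw [hv μ hμ, show -t - -μ = μ - t by ring, show (0 : ℝ) - -μ = μ by ring]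
    ring
  · have hs : (√t : ℂ) ≠ 0 := by exact_mod_cast (Real.sqrt_pos.2 ht).ne'
    have hpi : (Real.pi : ℂ) ≠ 0 := by exact_mod_cast Real.pi_ne_zero
    have hkC : (k : ℂ) ≠ 0 := by exact_mod_cast hk.ne'
    have hss : (√t : ℂ) * (√t : ℂ) = t := by exact_mod_cast Real.mul_self_sqrt ht.le
    have e1 : 2 * k * Complex.I / (Real.pi * (t : ℂ))
        = ((1 / t : ℝ) : ℂ) * (2 * k * Complex.I / Real.pi) := by
      push_cast
      ring
    have e2 : (√(1 / t) : ℂ) = 1 / (√t : ℂ) := by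
      rw [one_div, Real.sqrt_inv]
      push_cast
      ring
    -- The positive factor `1/t` leaves the principal root as `1/√t`; dividing the identity by `√t`
    -- supplies the other half of `1/t`.
    rw [e1, ofReal_mul_cpow_half (by positivity) (by simp [hkC, hpi, Complex.I_ne_zero]), e2] at heq
    have e3 : 1 / (Real.pi * Complex.I) = -(Complex.I / Real.pi) := by
      rw [one_div, mul_inv, Complex.inv_I]
      ring
    rw [hv t ht, e3, ← hss]
    have e5 : ∀ a p s r j i : ℂ, s ≠ 0 → a - i * s * p = 1 / s * r * j →
        a / s + -i * p = r * (1 / (s * s)) * j := by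
      intro a p s r j i hs h
      field_simp at h ⊢
      linear_combination h
    exact e5 _ _ _ _ _ _ hs heq
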